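/- Let $t\ge 0$, let $c_0=0,c_1,\dots,c_t$ be pairwise distinct complex numbers, and for each $s\in\{0,\dots,t\}$ let $m_s\ge 0$ and $n_{s,j}$ ($1\le j<m_s$) be integers and let $r_{s,j}\in\mathbf C[y,z,u_{s,1},\dots,u_{s,j}]$ ($0\le j<m_s$) be polynomials such that the degree of $r_{s,j}$ with respect to $u_{s,i}$ is less than $n_{s,i}$ for all $1\le i\le j$ (in particular, $n_{s,i}\ge 1$). Suppose that $m_0\ge 2$ and $r_{0,0}(y,z)=y^k-z^l$ with $k,l$ coprime and $k>l\ge 2$. Let $X'\subset\mathbf C^{N}$, $N=3+m_0+\dots+m_t$, be the set of common zeros, in the coordinates $x,y,z,u_{s,j}$ ($0\le s\le t$, $1\le j\le m_s$), of the system $$(x-c_s)u_{s,1}-r_{s,0}(y,z)=0 \quad (0\le s\le t,\ m_s\ge 1),$$ $$(x-c_s)u_{s,j+1}-u_{s,j}^{\,n_{s,j}}+r_{s,j}(y,z,u_{s,1},\dots,u_{s,j})=0\quad (0\le s\le t,\ 1\le j<m_s),$$ and let $\mathbf C[X']$ be its algebra of regular functions (polynomials modulo those vanishing at every point of $X'$).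 Suppose that $X'$ is smooth. Then: 1. every locally nilpotent $\mathbf C$-derivation $\partial$ of $\mathbf C[X']$ satisfies $\partial(x)=0$; 2. the Makar-Limanov invariant $\mathrm{ML}(X')=\bigcap_{\partial}\ker\partial$, the intersection over all locally nilpotent derivations $\partial$ of $\mathbf C[X']$, is nontrivial, i.e. $\mathrm{ML}(X')\ne\mathbf C$; 3. $X'$ is not isomorphic, as an affine algebraic variety, to $\mathbf C^3$. -/

import Mathlib

open MvPolynomial

namespace ExoticAffine

/-! ### Affine varieties in complex affine space -/

section Varieties

variable {σ τ : Type*}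

/-- The algebra `ℂ[X]` of regular functions on a subvariety `X` of the affine space `ℂ^σ`:
polynomials modulo those that vanish at every point of `X`. -/
abbrev RegularFunctions (X : Set (σ → ℂ)) : Type _ :=
  MvPolynomial σ ℂ ⧸ vanishingIdeal ℂ X

/-- The restriction to `X` of the coordinate function with index `i`. -/
noncomputable def coordFun (X : Set (σ → ℂ)) (i : σ) : RegularFunctions X :=
  Ideal.Quotient.mk (vanishingIdeal ℂ X) (MvPolynomial.X i)

/-- The polynomial map `ℂ^σ → ℂ^τ` with components `F`. -/
noncomputable def polyMap (F : τ → MvPolynomial σ ℂ) (p : σ → ℂ) : τ → ℂ :=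
  fun i => eval p (F i)

/-- Two closed subvarieties of affine spaces are isomorphic: there are polynomial maps between the
ambient spaces that restrict to mutually inverse maps between them. -/
def IsIsomorphic (X : Set (σ → ℂ)) (Y : Set (τ → ℂ)) : Prop :=
  ∃ (F : τ → MvPolynomial σ ℂ) (G : σ → MvPolynomial τ ℂ),
    Set.MapsTo (polyMap F) X Y ∧ Set.MapsTo (polyMap G) Y X ∧
    Set.LeftInvOn (polyMap G) (polyMap F) X ∧ Set.LeftInvOn (polyMap F) (polyMap G) Y

end Varieties

/-! ### Locally nilpotent derivations and the Makar-Limanov invariant -/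

section Derivations

variable {A : Type*} [CommRing A] [Algebra ℂ A]

/-- A derivation is locally nilpotent if each element is killed by some iterate of it. -/
def IsLocallyNilpotent (D : Derivation ℂ A A) : Prop :=
  ∀ a : A, ∃ n : ℕ, (⇑D)^[n] a = 0

variable (A) in
/-- The Makar-Limanov invariant: the intersection of the kernels of all locally nilpotent
derivations, as a subalgebra. -/
def makarLimanov : Subalgebra ℂ A where
  carrier := {a | ∀ D : Derivation ℂ A A, IsLocallyNilpotent D → D a = 0}
  mul_mem' := by
    intro a b ha hb D hD
    simp [D.leibniz, ha D hD, hb D hD]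
  add_mem' := by
    intro a b ha hb D hD
    simp [ha D hD, hb D hD]
  algebraMap_mem' := by
    intro r D _
    exact D.map_algebraMap r

end Derivations

/-! ### The system of equations -/

/-- The data of the block of equations that belongs to one root `c`. With coordinates
`x, y, z, u₁, …, u_len` the equations are
* `(x - c) u₁ - r₀(y, z) = 0`,
* `(x - c) u_{j+1} - u_j ^ n_j + r_j(y, z, u₁, …, u_j) = 0` for `1 ≤ j < len`,

where the degree of `r_j` in `u_i` is less than `n_i` for `1 ≤ i ≤ j`.

Here `len` is the number of equations, `exp j` is `n_j`, and `pol j` is `r_j`, a polynomial in the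
variables `inl 0 = y`, `inl 1 = z` and `inr i = u_{i+1}` for `i < j`. Only `pol j` with `j < len`
and `exp j` with `1 ≤ j < len` play a role. -/
structure Block where
  len : ℕ
  exp : ℕ → ℕ
  pol : (j : ℕ) → MvPolynomial (Fin 2 ⊕ Fin j) ℂ
  degree_lt : ∀ j : ℕ, j < len → ∀ i : Fin j, (pol j).degreeOf (Sum.inr i) < exp (i + 1)

variable {t : ℕ}

/-- The coordinates of the ambient space: `x, y, z`, and `len` further coordinates for each
block. -/
inductive Coord (B : Fin (t + 1) → Block) : Type
  | x : Coord B
  | y : Coord B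
  | z : Coord B
  /-- `u s i` is the `(i + 1)`-st coordinate of the block `s`. -/
  | u (s : Fin (t + 1)) (i : Fin (B s).len) : Coord B

/-- The polynomial `r_j(y, z, u_{s,1}, …, u_{s,j})` of the block `s`, as a polynomial in all
coordinates. -/
noncomputable def Block.polIn (B : Fin (t + 1) → Block) (s : Fin (t + 1)) (j : ℕ)
    (hj : j < (B s).len) : MvPolynomial (Coord B) ℂ :=
  rename (Sum.elim ![Coord.y, Coord.z] (fun i : Fin j => Coord.u s ⟨i, i.2.trans hj⟩))
    ((B s).pol j)

/-- The left-hand side of the equation number `j` (counted from `0`) of the block `s`, which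
belongs to the root `c s`. -/
noncomputable def equation (c : Fin (t + 1) → ℂ) (B : Fin (t + 1) → Block) (s : Fin (t + 1)) :
    (j : ℕ) → j < (B s).len → MvPolynomial (Coord B) ℂ
  | 0, h => (X Coord.x - C (c s)) * X (Coord.u s ⟨0, h⟩) - Block.polIn B s 0 h
  | j + 1, h =>
      (X Coord.x - C (c s)) * X (Coord.u s ⟨j + 1, h⟩)
        - X (Coord.u s ⟨j, (Nat.lt_succ_self j).trans h⟩) ^ (B s).exp (j + 1)
        + Block.polIn B s (j + 1) h

/-- The zero set of the whole system. -/
def solutionSet (c : Fin (t + 1) → ℂ) (B : Fin (t + 1) → Block) : Set (Coord B → ℂ) :=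
  {p | ∀ (s : Fin (t + 1)) (j : ℕ) (hj : j < (B s).len), eval p (equation c B s j hj) = 0}

end ExoticAffine

open ExoticAffine

/-!
Let `D` be a locally nilpotent derivation of `ℂ[X']`. Solving the equations for the `u_{s,j}` expands
regular functions into Laurent series in `x` with coefficients in `ℂ[y, z]` (`expand`). Up to
elements killed by `∏ (x - c s)` the expansion is injective, and `D` becomes a vector field `Δ` on the
Laurent series (`expand_apply`). It suffices to show `Δ x = 0` (`NilTower.apply_x`): then
`∏ (x - c s) * D x = 0`, and applying `D` once more gives `D x = 0`, since the `c s` are distinct and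
`ℂ[X']` is reduced (`apply_x_eq_zero`).

The equations of the root `0` show that `u_j` has the leading term `(yᵏ - zˡ) ^ N_j / x ^ d_j`, and
the degree bounds on the `r_j` make the filtration of the algebra of `x, y, z, u_j` by weights of
monomials agree with the one by the order in `x` (`Tower.mem_filtration_of_mem`). In each degree, its
graded ring is generated over `ℂ[y, z]` by a single monomial in the leading terms `û_j` and `x`.

The part of `Δ` of lowest order in `x` and then of highest weight, where `y` and `z` have the weights
`l` and `k`, is a nonzero locally nilpotent derivation `δ` of the graded ring, in which
`x û₀ = yᵏ - zˡ` and `x û_{j+1} = û_j ^ n_j`. The exponential of such a derivation sends nil elements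
to polynomials in one variable, so its kernel is factorially closed, and the following facts reduce
to statements about polynomials in one variable:
* `δ` does not kill `yᵏ - a zˡ` with `a ≠ 0`, as the curves `Yᵏ - a Zˡ = w` have no polynomial
  parametrization (`GradedNil.not_pow_sub_pow`);
* `δ` kills `û_j` at most for the last index `j`, and then kills neither `x`, nor `y`, nor `z`: along
  the flow all prime factors of `yᵏ - zˡ` are multiple, because they divide both `x` and `û₀`
  (`GradedNil.eq_of_u`, `GradedNil.not_u_x`, `GradedNil.not_y_or_z`). This is where the existence of
  two equations for the root `0` enters.

Suppose that `Δ x ≠ 0`. The kernel of `Δ` contains two algebraically independent elements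
(`exists_algebraicIndependent_kernel`). If one of its elements has a pole along `x = 0`, then `δ`
kills the last `û_j`. So, as a nonconstant weighted homogeneous polynomial is divisible by `y`, by `z`
or by some `yᵏ - a zˡ`, all leading coefficients of kernel elements are constant multiples of powers
of `yᵏ - zˡ`. Then kernel elements of bounded pole order `≤ N` form a space of dimension at most
`N + 1`, which contradicts the algebraic independence (`not_algebraicIndependent_of_leading`). If no
kernel element has a pole, restrict the kernel to `x = 0`. Either two restrictions are algebraically
independent, so that the part of `Δ` of lowest order kills `y` and `z`, which is impossible; or some
nonzero kernel element is divisible by `x`, and then `Δ x = 0` by factorial closedness.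

The other two claims follow, since `x` is not constant on `X'`, while in a polynomial ring only
constants are killed by all partial derivatives.
-/

namespace ExoticAffine

/-! ### Locally nilpotent elements and the flow of a derivation -/

section Nilpotent

variable {F : Type*} [CommRing F] [Algebra ℂ F]

/-- An element is nil for a derivation if some iterate of the derivation kills it. -/
def IsNil (δ : Derivation ℂ F F) (a : F) : Prop := ∃ n : ℕ, (⇑δ)^[n] a = 0

lemma isNil_of_apply_eq_zero {δ : Derivation ℂ F F} {a : F} (h : δ a = 0) : IsNil δ a := ⟨1, h⟩

/-- The formal flow `a ↦ ∑ δⁿ(a) Xⁿ / n!` of a derivation, as an additive map. -/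
noncomputable def flowAdd (δ : Derivation ℂ F F) : F →+ PowerSeries F where
  toFun a := PowerSeries.mk fun n => ((n.factorial : ℂ)⁻¹) • (⇑δ)^[n] a
  map_zero' := by
    ext n
    simp [iterate_map_zero]
  map_add' a b := by
    ext n
    simp [iterate_map_add]

lemma coeff_flowAdd (δ : Derivation ℂ F F) (a : F) (n : ℕ) :
    PowerSeries.coeff n (flowAdd δ a) = ((n.factorial : ℂ)⁻¹) • (⇑δ)^[n] a := by
  simp [flowAdd]

lemma derivative_flowAdd (δ : Derivation ℂ F F) (a : F) :
    PowerSeries.derivative F (flowAdd δ a) = flowAdd δ (δ a) := by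
  ext n
  rw [PowerSeries.coeff_derivative, coeff_flowAdd, coeff_flowAdd, Function.iterate_succ_apply]
  have h : ((n : F) + 1) = algebraMap ℂ F ((n : ℂ) + 1) := by simp
  have h0 : (n : ℂ) + 1 ≠ 0 := by exact_mod_cast Nat.succ_ne_zero n
  rw [h, mul_comm, ← Algebra.smul_def, smul_smul, Nat.factorial_succ]
  congr 1
  push_cast
  have : (n.factorial : ℂ) ≠ 0 := by exact_mod_cast n.factorial_ne_zero
  field_simp

lemma flowAdd_mul (δ : Derivation ℂ F F) (a b : F) :
    flowAdd δ (a * b) = flowAdd δ a * flowAdd δ b := by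
  ext n
  induction n generalizing a b with
  | zero => simp [coeff_flowAdd, PowerSeries.coeff_mul]
  | succ n ih =>
    have h0 : (n : ℂ) + 1 ≠ 0 := by exact_mod_cast Nat.succ_ne_zero n
    have hu : IsUnit ((n : F) + 1) := by
      have h : ((n : F) + 1) = algebraMap ℂ F ((n : ℂ) + 1) := by simp
      rw [h]
      exact (IsUnit.mk0 _ h0).map _
    apply hu.mul_right_cancel
    rw [← PowerSeries.coeff_derivative, ← PowerSeries.coeff_derivative, derivative_flowAdd,
      δ.leibniz, Derivation.leibniz, derivative_flowAdd, derivative_flowAdd]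
    simp only [smul_eq_mul, map_add]
    rw [ih, ih]

/-- The formal flow `a ↦ ∑ δⁿ(a) Xⁿ / n!` of a derivation is a ring homomorphism. -/
noncomputable def flow (δ : Derivation ℂ F F) : F →+* PowerSeries F where
  __ := flowAdd δ
  map_one' := by
    ext n
    change PowerSeries.coeff n (flowAdd δ 1) = _
    rw [coeff_flowAdd]
    cases n with
    | zero => simp
    | succ n => simp [Function.iterate_succ_apply, PowerSeries.coeff_one, iterate_map_zero]
  map_mul' := flowAdd_mul δ

lemma coeff_flow (δ : Derivation ℂ F F) (a : F) (n : ℕ) :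
    PowerSeries.coeff n (flow δ a) = ((n.factorial : ℂ)⁻¹) • (⇑δ)^[n] a := coeff_flowAdd δ a n

lemma flow_eq_C {δ : Derivation ℂ F F} {a : F} (h : δ a = 0) : flow δ a = PowerSeries.C a := by
  ext n
  rw [coeff_flow, PowerSeries.coeff_C]
  cases n with
  | zero => simp
  | succ n => simp [Function.iterate_succ_apply, h, iterate_map_zero]

lemma apply_eq_coeff_flow (δ : Derivation ℂ F F) (a : F) :
    δ a = PowerSeries.coeff 1 (flow δ a) := by
  simp [coeff_flow]

/-- The flow of a nil element is a polynomial. -/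
lemma IsNil.exists_flow {δ : Derivation ℂ F F} {a : F} (h : IsNil δ a) :
    ∃ P : Polynomial F, (P : PowerSeries F) = flow δ a := by
  obtain ⟨n, hn⟩ := h
  refine ⟨PowerSeries.trunc n (flow δ a), ?_⟩
  ext m
  rw [Polynomial.coeff_coe, PowerSeries.coeff_trunc]
  split_ifs with hm
  · rfl
  · rw [coeff_flow]
    obtain ⟨d, rfl⟩ := Nat.exists_eq_add_of_le (not_lt.mp hm)
    rw [add_comm, Function.iterate_add_apply, hn, iterate_map_zero, smul_zero]

lemma isNil_of_flow {δ : Derivation ℂ F F} {a : F} {P : Polynomial F}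
    (h : (P : PowerSeries F) = flow δ a) : IsNil δ a := by
  refine ⟨P.natDegree + 1, ?_⟩
  have h1 := coeff_flow δ a (P.natDegree + 1)
  rw [← h, Polynomial.coeff_coe,
    Polynomial.coeff_eq_zero_of_natDegree_lt (Nat.lt_succ_self _)] at h1
  have h2 : ((P.natDegree + 1).factorial : ℂ) ≠ 0 := by exact_mod_cast Nat.factorial_ne_zero _
  have h3 := congrArg (fun v => ((P.natDegree + 1).factorial : ℂ) • v) h1
  simpa [smul_smul, h2] using h3.symm

lemma IsNil.mul {δ : Derivation ℂ F F} {a b : F} (ha : IsNil δ a) (hb : IsNil δ b) :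
    IsNil δ (a * b) := by
  obtain ⟨P, hP⟩ := ha.exists_flow
  obtain ⟨Q, hQ⟩ := hb.exists_flow
  exact isNil_of_flow (P := P * Q) (by rw [Polynomial.coe_mul, hP, hQ, map_mul])

lemma IsNil.add {δ : Derivation ℂ F F} {a b : F} (ha : IsNil δ a) (hb : IsNil δ b) :
    IsNil δ (a + b) := by
  obtain ⟨P, hP⟩ := ha.exists_flow
  obtain ⟨Q, hQ⟩ := hb.exists_flow
  exact isNil_of_flow (P := P + Q) (by rw [Polynomial.coe_add, hP, hQ, map_add])

/-- The elements on which a derivation is locally nilpotent form a subalgebra. -/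
def nilSubalgebra (δ : Derivation ℂ F F) : Subalgebra ℂ F where
  carrier := {a | IsNil δ a}
  mul_mem' := IsNil.mul
  add_mem' := IsNil.add
  algebraMap_mem' r := isNil_of_apply_eq_zero (δ.map_algebraMap r)

lemma mem_nilSubalgebra {δ : Derivation ℂ F F} {a : F} : a ∈ nilSubalgebra δ ↔ IsNil δ a := Iff.rfl

variable [IsDomain F]

/-- The kernel of a derivation is factorially closed among the nil elements. -/
lemma IsNil.apply_eq_zero_of_mul {δ : Derivation ℂ F F} {a b : F} (ha : IsNil δ a)
    (hb : IsNil δ b) (hab : δ (a * b) = 0) (h0 : a * b ≠ 0) : δ a = 0 := by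
  obtain ⟨P, hP⟩ := ha.exists_flow
  obtain ⟨Q, hQ⟩ := hb.exists_flow
  have h : P * Q = Polynomial.C (a * b) := by
    apply Polynomial.coe_injective
    rw [Polynomial.coe_mul, hP, hQ, ← map_mul, flow_eq_C hab, Polynomial.coe_C]
  have hPQ : P * Q ≠ 0 := by
    rw [h]; simpa using h0
  have hdeg : P.natDegree + Q.natDegree = 0 := by
    rw [← Polynomial.natDegree_mul (left_ne_zero_of_mul hPQ) (right_ne_zero_of_mul hPQ), h,
      Polynomial.natDegree_C]
  rw [apply_eq_coeff_flow, ← hP, Polynomial.coeff_coe]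
  exact Polynomial.coeff_eq_zero_of_natDegree_lt (by omega)

lemma IsNil.apply_eq_zero_of_pow {δ : Derivation ℂ F F} {a : F} {n : ℕ} (hn : n ≠ 0)
    (h : δ (a ^ n) = 0) : δ a = 0 := by
  by_cases h0 : a = 0
  · simp [h0]
  rw [Derivation.leibniz_pow, nsmul_eq_mul, smul_eq_mul] at h
  have hc : (n : F) ≠ 0 := by
    have : (n : F) = algebraMap ℂ F n := by simp
    rw [this, Ne, map_eq_zero_iff _ (FaithfulSMul.algebraMap_injective ℂ F)]
    exact_mod_cast hn
  simpa [hc, h0] using h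

end Nilpotent

/-! ### Polynomial solutions of cuspidal equations in one variable -/

section Polynomials

open Polynomial

variable {κ : Type*} [Field κ] [CharZero κ]

/-- A curve `Yᵏ - c Zˡ = w` with `c, w ≠ 0` has no nonconstant polynomial parametrization. -/
lemma derivative_eq_zero_of_pow_sub_pow {Y Z : κ[X]} {k l : ℕ} (hk : 2 ≤ k) (hl : 2 ≤ l) {c w : κ}
    (hc : c ≠ 0) (hw : w ≠ 0) (h : Y ^ k - Polynomial.C c * Z ^ l = Polynomial.C w) :
    derivative Y = 0 ∧ derivative Z = 0 := by
  have hcop : IsCoprime Y Z := by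
    refine ⟨Polynomial.C w⁻¹ * Y ^ (k - 1), -(Polynomial.C w⁻¹ * Polynomial.C c * Z ^ (l - 1)), ?_⟩
    have h1 : Y ^ (k - 1) * Y = Y ^ k := by rw [← pow_succ]; congr 1; omega
    have h2 : Z ^ (l - 1) * Z = Z ^ l := by rw [← pow_succ]; congr 1; omega
    have h3 : Polynomial.C w⁻¹ * Polynomial.C w = 1 := by
      rw [← Polynomial.C_mul, inv_mul_cancel₀ hw, Polynomial.C_1]
    linear_combination Polynomial.C w⁻¹ * h1 - Polynomial.C w⁻¹ * Polynomial.C c * h2 +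
      Polynomial.C w⁻¹ * h + h3
  have hd : Polynomial.C (k : κ) * Y ^ (k - 1) * derivative Y =
      Polynomial.C (c * l) * Z ^ (l - 1) * derivative Z := by
    have := congrArg derivative h
    simp only [derivative_sub, derivative_C, derivative_C_mul, derivative_pow] at this
    rw [Polynomial.C_mul]
    linear_combination this
  have hk0 : (k : κ) ≠ 0 := by exact_mod_cast (by omega : k ≠ 0)
  have hl0 : c * (l : κ) ≠ 0 := mul_ne_zero hc (by exact_mod_cast (by omega : l ≠ 0))
  have hYZ : Y ^ (k - 1) ∣ derivative Z := by
    have h1 : Y ^ (k - 1) ∣ Polynomial.C (c * l) * Z ^ (l - 1) * derivative Z := by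
      rw [← hd, mul_assoc, mul_left_comm]
      exact dvd_mul_right _ _
    rw [mul_assoc, IsUnit.dvd_mul_left (isUnit_C.mpr (IsUnit.mk0 _ hl0))] at h1
    exact (hcop.pow).dvd_of_dvd_mul_left h1
  have hZY : Z ^ (l - 1) ∣ derivative Y := by
    have h1 : Z ^ (l - 1) ∣ Polynomial.C (k : κ) * Y ^ (k - 1) * derivative Y := by
      rw [hd, mul_assoc, mul_left_comm]
      exact dvd_mul_right _ _
    rw [mul_assoc, IsUnit.dvd_mul_left (isUnit_C.mpr (IsUnit.mk0 _ hk0))] at h1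
    exact (hcop.symm.pow).dvd_of_dvd_mul_left h1
  have key : ∀ {P Q : κ[X]} {n : ℕ}, 2 ≤ n → P ^ (n - 1) ∣ derivative Q → derivative Q ≠ 0 →
      P.natDegree < Q.natDegree := by
    intro P Q n hn hdvd hQ
    have h1 := natDegree_le_of_dvd hdvd hQ
    rw [natDegree_pow] at h1
    have h2 : Q.natDegree ≠ 0 := fun h0 => hQ (by
      rw [eq_C_of_natDegree_eq_zero h0, derivative_C])
    have h3 := natDegree_derivative_lt h2
    have h4 : P.natDegree ≤ (n - 1) * P.natDegree := Nat.le_mul_of_pos_left _ (by omega)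
    omega
  have hZ0 : Z = 0 → derivative Y = 0 := fun hZ => by
    rw [hZ, zero_pow (by omega), zero_dvd_iff] at hZY
    exact hZY
  by_cases hY : derivative Y = 0
  · refine ⟨hY, ?_⟩
    by_contra hZ
    rw [hY, mul_zero] at hd
    have hZ1 : Z ≠ 0 := fun h => hZ (by simp [h])
    exact mul_ne_zero (mul_ne_zero (Polynomial.C_ne_zero.mpr hl0) (pow_ne_zero _ hZ1)) hZ hd.symm
  · exfalso
    have hY1 : Y ≠ 0 := fun h => hY (by simp [h])
    have hZ : derivative Z ≠ 0 := fun hZ => by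
      rw [hZ, mul_zero] at hd
      exact mul_ne_zero (mul_ne_zero (Polynomial.C_ne_zero.mpr hk0) (pow_ne_zero _ hY1)) hY hd
    have h1 := key hk hYZ hZ
    have h2 := key hl hZY hY
    omega

omit [CharZero κ] in
/-- A polynomial all of whose prime factors are multiple divides the square of its derivative. -/
lemma dvd_derivative_sq {Q : κ[X]} (hQ : Q ≠ 0) (h : ∀ π : κ[X], Prime π → π ∣ Q → π ^ 2 ∣ Q) :
    Q ∣ derivative Q ^ 2 := by
  rw [UniqueFactorizationMonoid.dvd_iff_emultiplicity_le hQ]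
  intro π hπ
  have hfin : FiniteMultiplicity π Q := FiniteMultiplicity.of_prime_left hπ hQ
  rw [hfin.emultiplicity_eq_multiplicity]
  apply le_emultiplicity_of_pow_dvd
  set n := multiplicity π Q with hn
  rcases Nat.eq_zero_or_pos n with h0 | h0
  · simp [h0]
  have h1 : π ^ n ∣ Q := pow_multiplicity_dvd π Q
  have h2 : 2 ≤ n := by
    have := h π hπ ((dvd_pow_self π h0.ne').trans h1)
    exact hfin.le_multiplicity_of_pow_dvd this
  have h3 := pow_sub_one_dvd_derivative_of_pow_dvd h1
  have h4 := pow_dvd_pow_of_dvd h3 2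
  rw [← pow_mul] at h4
  exact (pow_dvd_pow π (by omega)).trans h4

/-- If all prime factors of `Zˡ - a` are multiple and `a ≠ 0`, then `Z` is constant. -/
lemma derivative_eq_zero_of_squareful {Z : κ[X]} {l : ℕ} (hl : 2 ≤ l) {a : κ} (ha : a ≠ 0)
    (hQ : Z ^ l - Polynomial.C a ≠ 0)
    (h : ∀ π : κ[X], Prime π → π ∣ Z ^ l - Polynomial.C a → π ^ 2 ∣ Z ^ l - Polynomial.C a) :
    derivative Z = 0 := by
  by_contra hZ
  have h1 := dvd_derivative_sq hQ h
  have hcop : IsCoprime (Z ^ l - Polynomial.C a) Z := by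
    refine ⟨-Polynomial.C a⁻¹, Polynomial.C a⁻¹ * Z ^ (l - 1), ?_⟩
    have h2 : Z ^ (l - 1) * Z = Z ^ l := by rw [← pow_succ]; congr 1; omega
    have h3 : Polynomial.C a⁻¹ * Polynomial.C a = 1 := by
      rw [← Polynomial.C_mul, inv_mul_cancel₀ ha, Polynomial.C_1]
    linear_combination Polynomial.C a⁻¹ * h2 + h3
  have hl0 : (l : κ) ≠ 0 := by exact_mod_cast (by omega : l ≠ 0)
  have h4 : derivative (Z ^ l - Polynomial.C a) ^ 2 =
      Polynomial.C ((l : κ) ^ 2) * ((Z ^ (l - 1)) ^ 2 * derivative Z ^ 2) := by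
    simp only [derivative_sub, derivative_C, derivative_pow, Polynomial.C_pow]
    ring
  rw [h4, IsUnit.dvd_mul_left (isUnit_C.mpr (IsUnit.mk0 _ (pow_ne_zero 2 hl0)))] at h1
  have h5 : Z ^ l - Polynomial.C a ∣ derivative Z ^ 2 :=
    (hcop.pow_right.pow_right).dvd_of_dvd_mul_left h1
  have h6 := natDegree_le_of_dvd h5 (pow_ne_zero 2 hZ)
  rw [natDegree_pow, natDegree_sub_C, natDegree_pow] at h6
  have h2 : Z.natDegree ≠ 0 := fun h0 => hZ (by
      rw [eq_C_of_natDegree_eq_zero h0, derivative_C])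
  have h3 := natDegree_derivative_lt h2
  have h7 : 2 * Z.natDegree ≤ l * Z.natDegree := Nat.mul_le_mul_right _ hl
  omega

end Polynomials

/-! ### Laurent series in `x` and their vector fields -/

/-- The polynomial ring `ℂ[y, z]`. -/
abbrev YZ : Type := MvPolynomial (Fin 2) ℂ

/-- The ring `ℂ[y, z]((x))` of Laurent series in `x` over `ℂ[y, z]`. -/
abbrev Lau : Type := HahnSeries ℤ YZ

/-- The coefficientwise structure; `Algebra.toModule` then agrees with `HahnSeries.instModule`. -/
noncomputable instance instAlgebraComplexLau : Algebra ℂ Lau := HahnSeries.instAlgebra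

/-- The coefficientwise structure; `Algebra.toModule` then agrees with `HahnSeries.instModule`. -/
noncomputable instance instAlgebraYZLau : Algebra YZ Lau := HahnSeries.instAlgebra

namespace Lau

/-- The series `x`. -/
noncomputable def x : Lau := HahnSeries.single 1 1

/-- The series of order at least `n` in `x`. -/
def orderGE (n : ℤ) : Submodule YZ Lau where
  carrier := {a | ∀ i < n, a.coeff i = 0}
  zero_mem' := fun i _ => by simp
  add_mem' := fun {a b} ha hb i hi => by simp [ha i hi, hb i hi]
  smul_mem' := fun r a ha i hi => by simp [ha i hi]

lemma orderGE_anti {m n : ℤ} (h : m ≤ n) : orderGE n ≤ orderGE m :=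
  fun _ ha i hi => ha i (hi.trans_le h)

lemma single_mem_orderGE (n : ℤ) (p : YZ) : HahnSeries.single n p ∈ orderGE n :=
  fun _ hi => HahnSeries.coeff_single_of_ne hi.ne

lemma mem_orderGE_succ {n : ℤ} {a : Lau} (ha : a ∈ orderGE n) (h : a.coeff n = 0) :
    a ∈ orderGE (n + 1) := by
  intro i hi
  rcases (Int.lt_add_one_iff.mp hi).lt_or_eq with h1 | h1
  · exact ha i h1
  · rw [h1, h]

lemma mul_mem_orderGE {m n : ℤ} {a b : Lau} (ha : a ∈ orderGE m) (hb : b ∈ orderGE n) :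
    a * b ∈ orderGE (m + n) := by
  intro i hi
  rw [HahnSeries.coeff_mul]
  refine Finset.sum_eq_zero fun ij hij => ?_
  have h := (Finset.mem_antidiagonal.mp hij).2.2
  by_cases h1 : ij.1 < m
  · rw [ha _ h1, zero_mul]
  · rw [hb _ (by omega), mul_zero]

lemma coeff_mul_of_mem {m n : ℤ} {a b : Lau} (ha : a ∈ orderGE m) (hb : b ∈ orderGE n) :
    (a * b).coeff (m + n) = a.coeff m * b.coeff n := by
  rw [HahnSeries.coeff_mul]
  rw [Finset.sum_eq_single (m, n)]
  · rintro ⟨i, j⟩ hij hne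
    have h : i + j = m + n := (Finset.mem_antidiagonal.mp hij).2.2
    by_cases h1 : i < m
    · simp only [ha _ h1, zero_mul]
    · have h2 : j < n := by
        by_contra h2
        exact hne (Prod.ext (by simp only; omega) (by simp only; omega))
      simp only [hb _ h2, mul_zero]
  · intro h
    rw [Finset.mem_antidiagonal] at h
    by_contra h0
    exact h ⟨left_ne_zero_of_mul h0, right_ne_zero_of_mul h0, rfl⟩

lemma coeff_mul_of_mem' {m n k : ℤ} {a b : Lau} (ha : a ∈ orderGE m) (hb : b ∈ orderGE n)
    (hk : k = m + n) : (a * b).coeff k = a.coeff m * b.coeff n := by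
  rw [hk, coeff_mul_of_mem ha hb]

/-- A nonzero series has an order. -/
lemma exists_order {a : Lau} (ha : a ≠ 0) : ∃ n, a ∈ orderGE n ∧ a.coeff n ≠ 0 := by
  refine ⟨a.order, fun i hi => HahnSeries.coeff_eq_zero_of_lt_order hi, ?_⟩
  exact HahnSeries.coeff_order_eq_zero.not.mpr ha

lemma exists_mem_orderGE (a : Lau) : ∃ n, a ∈ orderGE n :=
  ⟨a.order, fun _ hi => HahnSeries.coeff_eq_zero_of_lt_order hi⟩

/-- Apply linear maps to the coefficients of a series. -/
noncomputable def mapCoeff (δ : ℤ → YZ →ₗ[ℂ] YZ) : Lau →ₗ[ℂ] Lau where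
  toFun a := ⟨fun i => δ i (a.coeff i), a.isPWO_support.mono fun i hi h => hi (by simp [h])⟩
  map_add' a b := by ext1; funext i; simp
  map_smul' r a := by ext1; funext i; simp

lemma coeff_mapCoeff (δ : ℤ → YZ →ₗ[ℂ] YZ) (a : Lau) (i : ℤ) :
    (mapCoeff δ a).coeff i = δ i (a.coeff i) := rfl

lemma support_mapCoeff_subset (δ : ℤ → YZ →ₗ[ℂ] YZ) (a : Lau) :
    (mapCoeff δ a).support ⊆ a.support := fun i hi h => hi (by simp [coeff_mapCoeff, h])

/-- A family of maps satisfying a graded Leibniz rule, applied to coefficients, is a derivation. -/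
noncomputable def coeffDerivation (δ : ℤ → YZ →ₗ[ℂ] YZ)
    (h : ∀ i j a b, δ (i + j) (a * b) = a * δ j b + b * δ i a) : Derivation ℂ Lau Lau :=
  Derivation.mk' (mapCoeff δ) (by
    intro a b
    ext1
    funext n
    rw [coeff_mapCoeff, smul_eq_mul, smul_eq_mul, mul_comm b, HahnSeries.coeff_add,
      HahnSeries.coeff_mul, HahnSeries.coeff_mul_right' b.isPWO_support
      (support_mapCoeff_subset δ b), HahnSeries.coeff_mul_left' a.isPWO_support
      (support_mapCoeff_subset δ a), map_sum, ← Finset.sum_add_distrib]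
    refine Finset.sum_congr rfl fun ij hij => ?_
    rw [← (Finset.mem_antidiagonal.mp hij).2.2, h, coeff_mapCoeff, coeff_mapCoeff,
      mul_comm (b.coeff _)])

/-- The derivation `x ∂/∂x`. -/
noncomputable def euler : Derivation ℂ Lau Lau :=
  coeffDerivation (fun i => (i : ℂ) • LinearMap.id) (by
    intro i j a b
    change ((i + j : ℤ) : ℂ) • (a * b) = a * ((j : ℂ) • b) + b * ((i : ℂ) • a)
    simp only [Algebra.smul_def, Int.cast_add, map_add]
    ring)

/-- The derivations `∂/∂y` and `∂/∂z`. -/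
noncomputable def partialYZ (s : Fin 2) : Derivation ℂ Lau Lau :=
  coeffDerivation (fun _ => (pderiv s : Derivation ℂ YZ YZ)) (by
    intro i j a b
    simp)

/-- The derivation `X x ∂/∂x + Y ∂/∂y + Z ∂/∂z`. -/
noncomputable def vectorField (X Y Z : Lau) : Derivation ℂ Lau Lau :=
  X • euler + Y • partialYZ 0 + Z • partialYZ 1

lemma vectorField_apply (X Y Z a : Lau) :
    vectorField X Y Z a = X * euler a + Y * partialYZ 0 a + Z * partialYZ 1 a := rfl

lemma coeff_euler (a : Lau) (i : ℤ) : (euler a).coeff i = (i : ℂ) • a.coeff i := rfl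

lemma coeff_partialYZ (s : Fin 2) (a : Lau) (i : ℤ) :
    (partialYZ s a).coeff i = pderiv s (a.coeff i) := rfl

lemma euler_single (n : ℤ) (p : YZ) :
    euler (HahnSeries.single n p) = HahnSeries.single n ((n : ℂ) • p) := by
  ext1; funext i
  rw [coeff_euler]
  by_cases h : i = n
  · subst h; simp
  · simp [HahnSeries.coeff_single_of_ne h]

lemma partialYZ_single (s : Fin 2) (n : ℤ) (p : YZ) :
    partialYZ s (HahnSeries.single n p) = HahnSeries.single n (pderiv s p) := by
  ext1; funext i
  rw [coeff_partialYZ]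
  by_cases h : i = n
  · subst h; simp
  · simp [HahnSeries.coeff_single_of_ne h]

lemma vectorField_x (X Y Z : Lau) : vectorField X Y Z x = X * x := by
  simp [vectorField_apply, x, euler_single, partialYZ_single]

lemma vectorField_C (X Y Z : Lau) (p : YZ) : vectorField X Y Z (HahnSeries.C p) =
    Y * HahnSeries.C (pderiv 0 p) + Z * HahnSeries.C (pderiv 1 p) := by
  rw [HahnSeries.C_apply, vectorField_apply, euler_single, partialYZ_single, partialYZ_single]
  simp

lemma vectorField_y (X Y Z : Lau) : vectorField X Y Z (HahnSeries.C (MvPolynomial.X 0)) = Y := by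
  rw [vectorField_C]
  simp

lemma vectorField_z (X Y Z : Lau) : vectorField X Y Z (HahnSeries.C (MvPolynomial.X 1)) = Z := by
  rw [vectorField_C]
  simp

/-- The action of `x ^ e * (f₀ x ∂/∂x + f₁ ∂/∂y + f₂ ∂/∂z)` on the coefficient of `x ^ n`. -/
noncomputable def gradedAction (f₀ f₁ f₂ : YZ) (n : ℤ) (p : YZ) : YZ :=
  f₀ * ((n : ℂ) • p) + f₁ * pderiv 0 p + f₂ * pderiv 1 p

/-- The derivation `x ^ e * (f₀ x ∂/∂x + f₁ ∂/∂y + f₂ ∂/∂z)`, homogeneous in `x`. -/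
noncomputable def gradedField (e : ℤ) (f₀ f₁ f₂ : YZ) : Derivation ℂ Lau Lau :=
  vectorField (HahnSeries.single e f₀) (HahnSeries.single e f₁) (HahnSeries.single e f₂)

lemma gradedField_single (e : ℤ) (f₀ f₁ f₂ : YZ) (n : ℤ) (p : YZ) :
    gradedField e f₀ f₁ f₂ (HahnSeries.single n p) =
      HahnSeries.single (n + e) (gradedAction f₀ f₁ f₂ n p) := by
  rw [gradedField, vectorField_apply, euler_single, partialYZ_single, partialYZ_single]
  simp only [HahnSeries.single_mul_single, gradedAction, HahnSeries.single_add, add_comm e n]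

lemma euler_mem {n : ℤ} {a : Lau} (ha : a ∈ orderGE n) : euler a ∈ orderGE n := fun i hi => by
  rw [coeff_euler, ha i hi, smul_zero]

lemma partialYZ_mem (s : Fin 2) {n : ℤ} {a : Lau} (ha : a ∈ orderGE n) :
    partialYZ s a ∈ orderGE n := fun i hi => by
  rw [coeff_partialYZ, ha i hi, map_zero]

lemma vectorField_mem {X Y Z : Lau} {e : ℤ} (hX : X ∈ orderGE e) (hY : Y ∈ orderGE e)
    (hZ : Z ∈ orderGE e) {n : ℤ} {a : Lau} (ha : a ∈ orderGE n) :
    vectorField X Y Z a ∈ orderGE (n + e) := by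
  rw [vectorField_apply, add_comm n e]
  exact add_mem (add_mem (mul_mem_orderGE hX (euler_mem ha))
    (mul_mem_orderGE hY (partialYZ_mem 0 ha))) (mul_mem_orderGE hZ (partialYZ_mem 1 ha))

lemma coeff_vectorField {X Y Z : Lau} {e : ℤ} (hX : X ∈ orderGE e) (hY : Y ∈ orderGE e)
    (hZ : Z ∈ orderGE e) {n : ℤ} {a : Lau} (ha : a ∈ orderGE n) :
    (vectorField X Y Z a).coeff (n + e) =
      gradedAction (X.coeff e) (Y.coeff e) (Z.coeff e) n (a.coeff n) := by
  rw [vectorField_apply, add_comm n e, HahnSeries.coeff_add, HahnSeries.coeff_add,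
    coeff_mul_of_mem hX (euler_mem ha), coeff_mul_of_mem hY (partialYZ_mem 0 ha),
    coeff_mul_of_mem hZ (partialYZ_mem 1 ha)]
  rfl

/-- The leading part, in `x`, of an element that is nil for a vector field is nil for the leading
part of the vector field; this is the case of `N` iterations. -/
lemma iterate_gradedField_single {X Y Z : Lau} {e : ℤ} (hX : X ∈ orderGE e) (hY : Y ∈ orderGE e)
    (hZ : Z ∈ orderGE e) {n : ℤ} {a : Lau} (ha : a ∈ orderGE n) (N : ℕ) :
    (vectorField X Y Z)^[N] a ∈ orderGE (n + N * e) ∧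
    (gradedField e (X.coeff e) (Y.coeff e) (Z.coeff e))^[N] (HahnSeries.single n (a.coeff n)) =
      HahnSeries.single (n + N * e) (((vectorField X Y Z)^[N] a).coeff (n + N * e)) := by
  induction N with
  | zero => simpa using ha
  | succ N ih =>
    rw [Function.iterate_succ_apply', Function.iterate_succ_apply', ih.2, gradedField_single,
      ← coeff_vectorField hX hY hZ ih.1]
    have h : n + ((N + 1 : ℕ) : ℤ) * e = n + N * e + e := by push_cast; ring
    rw [h]
    exact ⟨vectorField_mem hX hY hZ ih.1, rfl⟩

lemma gradedField_leading_iterate {X Y Z : Lau} {e : ℤ} (hX : X ∈ orderGE e) (hY : Y ∈ orderGE e)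
    (hZ : Z ∈ orderGE e) {n : ℤ} {a : Lau} (ha : a ∈ orderGE n) {N : ℕ}
    (h : (vectorField X Y Z)^[N] a = 0) :
    (gradedField e (X.coeff e) (Y.coeff e) (Z.coeff e))^[N]
      (HahnSeries.single n (a.coeff n)) = 0 := by
  rw [(iterate_gradedField_single hX hY hZ ha N).2, h]
  simp

end Lau

/-! ### Weights of `y` and `z` -/

section Weights

/-- The polynomials in `y` and `z` all of whose monomials have weight at most `d`. -/
def weightLE (w : Fin 2 → ℤ) (d : ℤ) : Submodule ℂ YZ where
  carrier := {p | ∀ m, coeff m p ≠ 0 → Finsupp.weight w m ≤ d}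
  zero_mem' := fun m h => absurd (coeff_zero m) h
  add_mem' := fun {p q} hp hq m h => by
    rw [coeff_add] at h
    by_cases h1 : coeff m p = 0
    · exact hq m (by rwa [h1, zero_add] at h)
    · exact hp m h1
  smul_mem' := fun r p hp m h => hp m (by
    rw [coeff_smul] at h
    exact right_ne_zero_of_smul h)

variable {w : Fin 2 → ℤ}

lemma weightLE_mono {d d' : ℤ} (h : d ≤ d') : weightLE w d ≤ weightLE w d' :=
  fun _ hp m hm => (hp m hm).trans h

lemma mul_mem_weightLE {d e : ℤ} {p q : YZ} (hp : p ∈ weightLE w d) (hq : q ∈ weightLE w e) :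
    p * q ∈ weightLE w (d + e) := by
  intro m hm
  rw [coeff_mul] at hm
  obtain ⟨ij, hij, hne⟩ := Finset.exists_ne_zero_of_sum_ne_zero hm
  rw [← Finset.HasAntidiagonal.mem_antidiagonal.mp hij, map_add]
  exact add_le_add (hp _ (left_ne_zero_of_mul hne)) (hq _ (right_ne_zero_of_mul hne))

lemma IsWeightedHomogeneous.mem_weightLE {d : ℤ} {p : YZ} (hp : IsWeightedHomogeneous w p d) :
    p ∈ weightLE w d := fun _ hm => (hp hm).le

lemma weightedHomogeneousComponent_mul_of_mem {d e : ℤ} {p q : YZ} (hp : p ∈ weightLE w d)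
    (hq : q ∈ weightLE w e) : weightedHomogeneousComponent w (d + e) (p * q) =
      weightedHomogeneousComponent w d p * weightedHomogeneousComponent w e q := by
  ext m
  rw [coeff_weightedHomogeneousComponent]
  split_ifs with h
  · rw [coeff_mul, coeff_mul]
    refine Finset.sum_congr rfl fun ij hij => ?_
    rw [coeff_weightedHomogeneousComponent, coeff_weightedHomogeneousComponent]
    rw [← Finset.HasAntidiagonal.mem_antidiagonal.mp hij, map_add] at h
    by_cases h1 : coeff ij.1 p = 0
    · simp [h1]
    by_cases h2 : coeff ij.2 q = 0
    · simp [h2]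
    have h3 := hp _ h1
    have h4 := hq _ h2
    rw [if_pos (by omega), if_pos (by omega)]
  · by_contra hne
    exact h (((weightedHomogeneousComponent_isWeightedHomogeneous (w := w) d p).mul
      (weightedHomogeneousComponent_isWeightedHomogeneous (w := w) e q)) (Ne.symm hne))

lemma coeff_ne_zero_of_pderiv {s : Fin 2} {p : YZ} {m : Fin 2 →₀ ℕ}
    (h : coeff m (pderiv s p) ≠ 0) : coeff (m + Finsupp.single s 1) p ≠ 0 := by
  rw [coeff_pderiv] at h
  exact left_ne_zero_of_mul h

lemma pderiv_mem_weightLE {s : Fin 2} {d : ℤ} {p : YZ} (hp : p ∈ weightLE w d) :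
    pderiv s p ∈ weightLE w (d - w s) := by
  intro m hm
  have h := hp _ (coeff_ne_zero_of_pderiv hm)
  rw [map_add, Finsupp.weight_single, one_smul] at h
  omega

lemma weightedHomogeneousComponent_pderiv (s : Fin 2) (d : ℤ) (p : YZ) :
    weightedHomogeneousComponent w (d - w s) (pderiv s p) =
      pderiv s (weightedHomogeneousComponent w d p) := by
  ext m
  rw [coeff_weightedHomogeneousComponent, coeff_pderiv, coeff_pderiv,
    coeff_weightedHomogeneousComponent, map_add, Finsupp.weight_single, one_smul]
  by_cases h : Finsupp.weight w m = d - w s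
  · rw [if_pos h, if_pos (by omega)]
  · rw [if_neg h, if_neg (by omega), zero_mul]

lemma exists_weightLE (p : YZ) : ∃ d, p ∈ weightLE w d := by
  refine ⟨∑ m ∈ p.support, |Finsupp.weight w m|, fun m hm => ?_⟩
  exact (le_abs_self _).trans (Finset.single_le_sum (f := fun m => |Finsupp.weight w m|)
    (fun _ _ => abs_nonneg _) (mem_support_iff.mpr hm))

lemma exists_weightedHomogeneousComponent_ne_zero {p : YZ} (hp : p ≠ 0) :
    ∃ d, p ∈ weightLE w d ∧ weightedHomogeneousComponent w d p ≠ 0 := by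
  obtain ⟨m, hm, hmax⟩ := p.support.exists_max_image (fun m => Finsupp.weight w m)
    (support_nonempty.mpr hp)
  refine ⟨Finsupp.weight w m, fun m' hm' => hmax m' (mem_support_iff.mpr hm'), fun h => ?_⟩
  have := congrArg (coeff m) h
  rw [coeff_weightedHomogeneousComponent, if_pos rfl, coeff_zero] at this
  exact mem_support_iff.mp hm this

lemma mem_weightLE_pred {d : ℤ} {p : YZ} (hp : p ∈ weightLE w d)
    (h : weightedHomogeneousComponent w d p = 0) : p ∈ weightLE w (d - 1) := by
  intro m hm
  have h1 := hp m hm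
  by_contra h2
  have := congrArg (coeff m) h
  rw [coeff_weightedHomogeneousComponent, if_pos (by omega), coeff_zero] at this
  exact hm this

namespace Lau

lemma gradedAction_mem {f₀ f₁ f₂ : YZ} {e : ℤ} (h₀ : f₀ ∈ weightLE w e)
    (h₁ : f₁ ∈ weightLE w (e + w 0)) (h₂ : f₂ ∈ weightLE w (e + w 1)) (n : ℤ) {d : ℤ} {p : YZ}
    (hp : p ∈ weightLE w d) : gradedAction f₀ f₁ f₂ n p ∈ weightLE w (d + e) := by
  refine add_mem (add_mem ?_ ?_) ?_
  · rw [add_comm]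
    exact mul_mem_weightLE h₀ (Submodule.smul_mem _ _ hp)
  · have := mul_mem_weightLE h₁ (pderiv_mem_weightLE (s := 0) hp)
    rwa [show e + w 0 + (d - w 0) = d + e by ring] at this
  · have := mul_mem_weightLE h₂ (pderiv_mem_weightLE (s := 1) hp)
    rwa [show e + w 1 + (d - w 1) = d + e by ring] at this

lemma weightedHomogeneousComponent_gradedAction {f₀ f₁ f₂ : YZ} {e : ℤ} (h₀ : f₀ ∈ weightLE w e)
    (h₁ : f₁ ∈ weightLE w (e + w 0)) (h₂ : f₂ ∈ weightLE w (e + w 1)) (n : ℤ) {d : ℤ} {p : YZ}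
    (hp : p ∈ weightLE w d) :
    weightedHomogeneousComponent w (d + e) (gradedAction f₀ f₁ f₂ n p) =
      gradedAction (weightedHomogeneousComponent w e f₀)
        (weightedHomogeneousComponent w (e + w 0) f₁)
        (weightedHomogeneousComponent w (e + w 1) f₂) n
        (weightedHomogeneousComponent w d p) := by
  rw [gradedAction, map_add, map_add, gradedAction, ← map_smul,
    ← weightedHomogeneousComponent_mul_of_mem h₀ (Submodule.smul_mem _ _ hp),
    ← weightedHomogeneousComponent_pderiv 0 d p, ← weightedHomogeneousComponent_pderiv 1 d p,
    ← weightedHomogeneousComponent_mul_of_mem h₁ (pderiv_mem_weightLE (s := 0) hp),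
    ← weightedHomogeneousComponent_mul_of_mem h₂ (pderiv_mem_weightLE (s := 1) hp)]
  have e1 : e + w 0 + (d - w 0) = d + e := by ring
  have e2 : e + w 1 + (d - w 1) = d + e := by ring
  rw [e1, e2, add_comm e d]

/-- The part of highest weight of an element that is nil for a vector field homogeneous in `x` is
nil for the part of highest weight of the vector field; this is the case of `N` iterations. -/
lemma iterate_gradedField_component {f₀ f₁ f₂ : YZ} {e : ℤ} (h₀ : f₀ ∈ weightLE w e)
    (h₁ : f₁ ∈ weightLE w (e + w 0)) (h₂ : f₂ ∈ weightLE w (e + w 1)) (s n : ℤ) {d : ℤ} {p : YZ}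
    (hp : p ∈ weightLE w d) (N : ℕ) : ∃ p' ∈ weightLE w (d + N * e),
      (gradedField s f₀ f₁ f₂)^[N] (HahnSeries.single n p) = HahnSeries.single (n + N * s) p' ∧
      (gradedField s (weightedHomogeneousComponent w e f₀)
        (weightedHomogeneousComponent w (e + w 0) f₁)
        (weightedHomogeneousComponent w (e + w 1) f₂))^[N]
        (HahnSeries.single n (weightedHomogeneousComponent w d p)) =
      HahnSeries.single (n + N * s) (weightedHomogeneousComponent w (d + N * e) p') := by
  induction N with
  | zero => exact ⟨p, by simpa using hp, by simp, by simp⟩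
  | succ N ih =>
    obtain ⟨p', hp', h3, h4⟩ := ih
    have h5 : d + ((N + 1 : ℕ) : ℤ) * e = d + N * e + e := by push_cast; ring
    have h6 : n + ((N + 1 : ℕ) : ℤ) * s = n + N * s + s := by push_cast; ring
    refine ⟨gradedAction f₀ f₁ f₂ (n + N * s) p', ?_, ?_, ?_⟩
    · rw [h5]
      exact gradedAction_mem h₀ h₁ h₂ _ hp'
    · rw [Function.iterate_succ_apply', h3, gradedField_single, h6]
    · rw [Function.iterate_succ_apply', h4, gradedField_single, h6, h5,
        weightedHomogeneousComponent_gradedAction h₀ h₁ h₂ _ hp']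

lemma gradedField_component_iterate {f₀ f₁ f₂ : YZ} {e : ℤ} (h₀ : f₀ ∈ weightLE w e)
    (h₁ : f₁ ∈ weightLE w (e + w 0)) (h₂ : f₂ ∈ weightLE w (e + w 1)) (s n : ℤ) {d : ℤ} {p : YZ}
    (hp : p ∈ weightLE w d) {N : ℕ}
    (h : (gradedField s f₀ f₁ f₂)^[N] (HahnSeries.single n p) = 0) :
    (gradedField s (weightedHomogeneousComponent w e f₀)
      (weightedHomogeneousComponent w (e + w 0) f₁)
      (weightedHomogeneousComponent w (e + w 1) f₂))^[N]
      (HahnSeries.single n (weightedHomogeneousComponent w d p)) = 0 := by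
  obtain ⟨p', -, h3, h4⟩ := iterate_gradedField_component h₀ h₁ h₂ s n hp N
  rw [h4]
  rw [h3, HahnSeries.single_eq_zero_iff] at h
  rw [h, map_zero, HahnSeries.single_eq_zero]

end Lau

end Weights

/-! ### Weighted homogeneous polynomials in two variables -/

section Factors

/-- The weights `l` and `k` of `y` and `z`, for which `yᵏ - zˡ` is homogeneous. -/
def cuspWeight (k l : ℕ) : Fin 2 → ℤ := ![(l : ℤ), (k : ℤ)]

lemma weight_cuspWeight (k l : ℕ) (m : Fin 2 →₀ ℕ) :
    Finsupp.weight (cuspWeight k l) m = m 0 * l + m 1 * k := by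
  rw [Finsupp.weight_eq_sum, Fin.sum_univ_two]
  simp [cuspWeight]

lemma X_dvd_of_forall_coeff {p : YZ} {s : Fin 2} (h : ∀ m, coeff m p ≠ 0 → m s ≠ 0) : X s ∣ p := by
  rw [p.as_sum]
  refine Finset.dvd_sum fun m hm => ?_
  rw [X_dvd_monomial]
  exact Or.inr (h m (mem_support_iff.mp hm))

lemma monomial_eq_X_pow (m : Fin 2 →₀ ℕ) (c : ℂ) :
    (monomial m c : YZ) = C c * X 0 ^ m 0 * X 1 ^ m 1 := by
  rw [monomial_eq, Finsupp.prod_fintype _ _ (by simp), Fin.prod_univ_two, mul_assoc]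

/-- Over an algebraically closed field, a nonconstant weighted homogeneous polynomial in `y` and `z`
is divisible by `y`, by `z`, or by some `yᵏ - a zˡ`. -/
lemma exists_dvd_of_isWeightedHomogeneous {k l : ℕ} (hk : 0 < k) (hl : 0 < l)
    (hcop : Nat.Coprime k l) {p : YZ} {d : ℤ}
    (hp : IsWeightedHomogeneous (cuspWeight k l) p d) (hd : d ≠ 0) :
    X 0 ∣ p ∨ X 1 ∣ p ∨ ∃ a : ℂ, X 0 ^ k - C a * X 1 ^ l ∣ p := by
  by_cases h0 : ∀ m, coeff m p ≠ 0 → m 0 ≠ 0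
  · exact Or.inl (X_dvd_of_forall_coeff h0)
  by_cases h1 : ∀ m, coeff m p ≠ 0 → m 1 ≠ 0
  · exact Or.inr (Or.inl (X_dvd_of_forall_coeff h1))
  refine Or.inr (Or.inr ?_)
  push Not at h0 h1
  obtain ⟨m₀, hm₀, hm₀0⟩ := h0
  obtain ⟨m₁, hm₁, hm₁0⟩ := h1
  have hw : ∀ m, coeff m p ≠ 0 → (m 0 * l + m 1 * k : ℤ) = d := fun m hm => by
    rw [← weight_cuspWeight, hp hm]
  have e0 := hw m₀ hm₀
  have e1 := hw m₁ hm₁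
  simp only [hm₀0, hm₁0, Nat.cast_zero, zero_mul, zero_add, add_zero] at e0 e1
  -- both `z ^ (m₀ 1)` and `y ^ (m₁ 0)` occur, so the weight is a multiple of `k * l`
  have hn : m₀ 1 * k = m₁ 0 * l := by exact_mod_cast e0.trans e1.symm
  obtain ⟨n, hn1⟩ : k ∣ m₁ 0 := hcop.dvd_of_dvd_mul_right (Dvd.intro_left _ hn)
  have hn0 : n ≠ 0 := by
    rintro rfl
    apply hd
    rw [← e1, hn1]
    simp
  have hdn : d = k * n * l := by rw [← e1, hn1]; push_cast; ring
  have hdiv : ∀ m, coeff m p ≠ 0 → ∃ a b, m 0 = k * a ∧ m 1 = l * b ∧ a + b = n := by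
    intro m hm
    have e : m 0 * l + m 1 * k = k * n * l := by exact_mod_cast (hw m hm).trans hdn
    have hk1 : k ∣ m 0 := by
      apply hcop.dvd_of_dvd_mul_right
      rw [← Nat.dvd_add_left (Dvd.intro_left (m 1) rfl), e, mul_assoc]
      exact dvd_mul_right _ _
    have hl1 : l ∣ m 1 := by
      apply hcop.symm.dvd_of_dvd_mul_right
      rw [← Nat.dvd_add_right (Dvd.intro_left (m 0) rfl), e]
      exact dvd_mul_left _ _
    obtain ⟨a, ha⟩ := hk1
    obtain ⟨b, hb⟩ := hl1
    refine ⟨a, b, ha, hb, ?_⟩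
    rw [ha, hb] at e
    have : k * l * (a + b) = k * l * n := by linear_combination e
    exact Nat.eq_of_mul_eq_mul_left (Nat.mul_pos hk hl) this
  -- the polynomial in one variable obtained by dehomogenization
  let ρ : Polynomial ℂ := ∑ m ∈ p.support, Polynomial.monomial (m 0 / k) (coeff m p)
  have hinj : ∀ m ∈ p.support, ∀ a, m 0 / k = a → a ≤ n ∧ m 0 = k * a ∧ m 1 = l * (n - a) := by
    rintro m hm a rfl
    obtain ⟨a, b, ha, hb, hab⟩ := hdiv m (mem_support_iff.mp hm)
    have h1 : m 0 / k = a := by rw [ha, Nat.mul_div_cancel_left _ hk]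
    rw [h1]
    refine ⟨by omega, ha, by rw [hb]; congr 1; omega⟩
  have hcoeff : ρ.coeff n = coeff m₁ p := by
    have hm₁n : m₁ 0 / k = n := by rw [hn1, Nat.mul_div_cancel_left _ hk]
    simp only [ρ, Polynomial.finsetSum_coeff, Polynomial.coeff_monomial]
    rw [Finset.sum_eq_single m₁]
    · rw [if_pos hm₁n]
    · intro m hm hne
      rw [if_neg]
      intro hmn
      apply hne
      have h2 := hinj m hm n hmn
      have h3 := hinj m₁ (mem_support_iff.mpr hm₁) n hm₁n
      ext i
      fin_cases i
      · exact h2.2.1.trans h3.2.1.symm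
      · exact h2.2.2.trans h3.2.2.symm
    · intro h
      exact absurd (mem_support_iff.mpr hm₁) h
  have hρ : ρ.degree ≠ 0 := by
    intro h
    apply hm₁
    rw [← hcoeff]
    exact Polynomial.coeff_eq_zero_of_degree_lt (by rw [h]; exact_mod_cast Nat.pos_of_ne_zero hn0)
  obtain ⟨r, hr⟩ := IsAlgClosed.exists_root ρ hρ
  refine ⟨r, ?_⟩
  -- modulo `yᵏ - r zˡ` the polynomial becomes `ρ(r) z ^ (l * n)`
  have hsum : ∑ m ∈ p.support, C (coeff m p * r ^ (m 0 / k)) * (X 1 : YZ) ^ (l * n) = 0 := by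
    rw [← Finset.sum_mul, ← map_sum]
    have : ∑ m ∈ p.support, coeff m p * r ^ (m 0 / k) = ρ.eval r := by
      simp [ρ, Polynomial.eval_finsetSum, Polynomial.eval_monomial]
    rw [this, hr, map_zero, zero_mul]
  have hdiff : p = ∑ m ∈ p.support, (monomial m (coeff m p) -
      C (coeff m p * r ^ (m 0 / k)) * (X 1 : YZ) ^ (l * n)) := by
    rw [Finset.sum_sub_distrib, hsum, sub_zero, ← p.as_sum]
  rw [hdiff]
  refine Finset.dvd_sum fun m hm => ?_
  obtain ⟨h1, h2, h3⟩ := hinj m hm _ rfl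
  set a := m 0 / k
  have h4 : (X 1 : YZ) ^ (l * n) = (X 1 ^ l) ^ a * X 1 ^ (l * (n - a)) := by
    rw [← pow_mul, ← pow_add, ← mul_add, Nat.add_sub_cancel' h1]
  have h5 : monomial m (coeff m p) - C (coeff m p * r ^ a) * (X 1 : YZ) ^ (l * n) =
      C (coeff m p) * X 1 ^ (l * (n - a)) * ((X 0 ^ k) ^ a - (C r * X 1 ^ l) ^ a) := by
    rw [monomial_eq_X_pow, h2, h3, h4, pow_mul (X 0) k a, mul_pow, map_mul, map_pow]
    ring
  rw [h5]
  exact (sub_dvd_pow_sub_pow _ _ a).mul_left _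

end Factors

/-! ### Locally nilpotent derivations of the graded ring -/

section GradedNil

variable {F : Type*} [CommRing F] [IsDomain F] [Algebra ℂ F]

lemma charZero_of_algebra_complex (F : Type*) [CommRing F] [IsDomain F] [Algebra ℂ F] :
    CharZero F := charZero_of_injective_algebraMap (FaithfulSMul.algebraMap_injective ℂ F)

omit [IsDomain F] in
/-- The polynomial over the fraction field that describes the flow of a nil element. -/
lemma IsNil.exists_flow_fraction {δ : Derivation ℂ F F} {a : F} (h : IsNil δ a) :
    ∃ P : Polynomial (FractionRing F),
      (P : PowerSeries (FractionRing F)) =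
        PowerSeries.map (algebraMap F (FractionRing F)) (flow δ a) := by
  obtain ⟨P, hP⟩ := h.exists_flow
  refine ⟨P.map (algebraMap F (FractionRing F)), ?_⟩
  rw [← hP, Polynomial.polynomial_map_coe]

lemma apply_eq_zero_of_derivative {δ : Derivation ℂ F F} {a : F}
    {P : Polynomial (FractionRing F)} (hP : (P : PowerSeries (FractionRing F)) =
      PowerSeries.map (algebraMap F (FractionRing F)) (flow δ a))
    (h : Polynomial.derivative P = 0) : δ a = 0 := by
  have := charZero_of_algebra_complex F
  have : CharZero (FractionRing F) :=
    charZero_of_injective_algebraMap (IsFractionRing.injective F (FractionRing F))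
  apply IsFractionRing.injective F (FractionRing F)
  rw [apply_eq_coeff_flow, ← PowerSeries.coeff_map, ← hP, Polynomial.coeff_coe, map_zero]
  exact Polynomial.coeff_eq_zero_of_natDegree_lt
    (by rw [Polynomial.derivative_eq_zero.mp h]; exact one_pos)

/-- If `yᵏ - c zˡ` is a nonzero constant of a derivation, where `c ≠ 0` and `k, l ≥ 2`, then so are
the nil elements `y` and `z`. -/
lemma IsNil.apply_eq_zero_of_pow_sub_pow {δ : Derivation ℂ F F} {y z : F} (hy : IsNil δ y)
    (hz : IsNil δ z) {k l : ℕ} (hk : 2 ≤ k) (hl : 2 ≤ l) {c : ℂ} (hc : c ≠ 0)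
    (h : δ (y ^ k - c • z ^ l) = 0) (h0 : y ^ k - c • z ^ l ≠ 0) : δ y = 0 ∧ δ z = 0 := by
  have := charZero_of_algebra_complex F
  have : CharZero (FractionRing F) :=
    charZero_of_injective_algebraMap (IsFractionRing.injective F (FractionRing F))
  obtain ⟨Y, hY⟩ := hy.exists_flow_fraction
  obtain ⟨Z, hZ⟩ := hz.exists_flow_fraction
  have hinj := IsFractionRing.injective F (FractionRing F)
  have hinj' := FaithfulSMul.algebraMap_injective ℂ F
  have key : Y ^ k - Polynomial.C (algebraMap F (FractionRing F) (algebraMap ℂ F c)) * Z ^ l =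
      Polynomial.C (algebraMap F (FractionRing F) (y ^ k - c • z ^ l)) := by
    apply Polynomial.coe_injective
    have h1 := congrArg (PowerSeries.map (algebraMap F (FractionRing F))) (flow_eq_C h)
    rw [Algebra.smul_def, map_sub, map_pow, map_mul, map_pow,
      flow_eq_C (δ.map_algebraMap c)] at h1
    rw [Polynomial.coe_sub, Polynomial.coe_mul, Polynomial.coe_pow, Polynomial.coe_pow, hY, hZ,
      Polynomial.coe_C, Polynomial.coe_C, Algebra.smul_def]
    simpa using h1
  obtain ⟨h1, h2⟩ := derivative_eq_zero_of_pow_sub_pow hk hl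
    (by rwa [Ne, map_eq_zero_iff _ hinj, map_eq_zero_iff _ hinj'])
    (by rwa [Ne, map_eq_zero_iff _ hinj]) key
  exact ⟨apply_eq_zero_of_derivative hY h1, apply_eq_zero_of_derivative hZ h2⟩

/-- A locally nilpotent derivation on the graded ring generated by `x, y, z` and
`û₀, …, û_{m-1}`, where `x û₀ = yᵏ - zˡ` and `x û_{j+1} = û_j ^ n_j`. -/
structure GradedNil (δ : Derivation ℂ F F) (k l m : ℕ) (n : ℕ → ℕ) (x y z : F) (u : ℕ → F) :
    Prop where
  two_le_k : 2 ≤ k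
  two_le_l : 2 ≤ l
  two_le_m : 2 ≤ m
  exp_pos : ∀ j, j + 1 < m → n j ≠ 0
  x_ne : x ≠ 0
  y_ne : y ≠ 0
  z_ne : z ≠ 0
  u_ne : ∀ j < m, u j ≠ 0
  x_nil : IsNil δ x
  y_nil : IsNil δ y
  z_nil : IsNil δ z
  u_nil : ∀ j < m, IsNil δ (u j)
  rel_zero : x * u 0 = y ^ k - z ^ l
  rel_succ : ∀ j, j + 1 < m → x * u (j + 1) = u j ^ n j
  nontrivial : ¬ (δ x = 0 ∧ δ y = 0 ∧ δ z = 0)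

namespace GradedNil

variable {δ : Derivation ℂ F F} {k l m : ℕ} {n : ℕ → ℕ} {x y z : F} {u : ℕ → F}

/-- A derivation that kills `y` and `z` kills `x û₀ = yᵏ - zˡ`, hence its factor `x`. -/
lemma not_y_z (h : GradedNil δ k l m n x y z u) : ¬ (δ y = 0 ∧ δ z = 0) := by
  rintro ⟨hy, hz⟩
  have hm : 0 < m := by have := h.two_le_m; omega
  have h1 : δ (x * u 0) = 0 := by
    rw [h.rel_zero, map_sub, Derivation.leibniz_pow, Derivation.leibniz_pow, hy, hz]
    simp
  exact h.nontrivial ⟨h.x_nil.apply_eq_zero_of_mul (h.u_nil 0 hm) h1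
    (mul_ne_zero h.x_ne (h.u_ne 0 hm)), hy, hz⟩

lemma pow_sub_ne (h : GradedNil δ k l m n x y z u) : y ^ k - z ^ l ≠ 0 := by
  rw [← h.rel_zero]
  exact mul_ne_zero h.x_ne (h.u_ne 0 (by have := h.two_le_m; omega))

lemma not_pow_sub_pow (h : GradedNil δ k l m n x y z u) {c : ℂ} (hc : c ≠ 0)
    (h0 : y ^ k - c • z ^ l ≠ 0) : δ (y ^ k - c • z ^ l) ≠ 0 := fun hd =>
  h.not_y_z (h.y_nil.apply_eq_zero_of_pow_sub_pow h.z_nil h.two_le_k h.two_le_l hc hd h0)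

lemma not_q (h : GradedNil δ k l m n x y z u) : δ (y ^ k - z ^ l) ≠ 0 := by
  have := h.not_pow_sub_pow one_ne_zero (by simpa using h.pow_sub_ne)
  simpa using this

/-- Going down the relations `x û_{j+1} = û_j ^ n_j`, a derivation that kills `x` and some `û_j`
kills `yᵏ - zˡ`. -/
lemma not_u_x (h : GradedNil δ k l m n x y z u) {j : ℕ} (hj : j < m) (hu : δ (u j) = 0) :
    δ x ≠ 0 := by
  intro hx
  induction j with
  | zero =>
    apply h.not_q
    rw [← h.rel_zero, Derivation.leibniz, hx, hu]
    simp
  | succ j ih =>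
    refine ih (by omega) (IsNil.apply_eq_zero_of_pow (h.exp_pos j hj) ?_)
    rw [← h.rel_succ j hj, Derivation.leibniz, hx, hu]
    simp

/-- Among the `û_j`, only the last one can be a constant. -/
lemma eq_of_u (h : GradedNil δ k l m n x y z u) {j : ℕ} (hj : j < m) (hu : δ (u j) = 0) :
    j + 1 = m := by
  by_contra hne
  have hj' : j + 1 < m := by omega
  refine h.not_u_x hj hu (h.x_nil.apply_eq_zero_of_mul (h.u_nil _ hj') ?_
    (mul_ne_zero h.x_ne (h.u_ne _ hj')))
  rw [h.rel_succ j hj', Derivation.leibniz_pow, hu]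
  simp

/-- If the last `û_j` is a constant, then all prime factors of `yᵏ - zˡ` along a flow line are
multiple: such a factor divides both `x` and `û₀`. -/
lemma squareful (h : GradedNil δ k l m n x y z u) (hu : δ (u (m - 1)) = 0)
    {Q : Polynomial (FractionRing F)} (hQ : (Q : PowerSeries (FractionRing F)) =
      PowerSeries.map (algebraMap F (FractionRing F)) (flow δ (y ^ k - z ^ l)))
    {π : Polynomial (FractionRing F)} (hπ : Prime π) (hdvd : π ∣ Q) : π ^ 2 ∣ Q := by
  have hm := h.two_le_m
  set φ : F →+* PowerSeries (FractionRing F) :=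
    (PowerSeries.map (algebraMap F (FractionRing F))).comp (flow δ) with hφ
  obtain ⟨P, hP⟩ := h.x_nil.exists_flow_fraction
  have hU : ∀ j, ∃ U : Polynomial (FractionRing F), j < m → (U : PowerSeries _) = φ (u j) := by
    intro j
    by_cases hj : j < m
    · obtain ⟨U, hU⟩ := (h.u_nil j hj).exists_flow_fraction
      exact ⟨U, fun _ => hU⟩
    · exact ⟨0, fun h => absurd h hj⟩
  choose U hU using hU
  have hP' : (P : PowerSeries _) = φ x := hP
  have hQ' : (Q : PowerSeries _) = φ (y ^ k - z ^ l) := hQ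
  have rel0 : P * U 0 = Q := by
    apply Polynomial.coe_injective
    rw [Polynomial.coe_mul, hP', hU 0 (by omega), hQ', ← map_mul, h.rel_zero]
  have rel : ∀ j, j + 1 < m → P * U (j + 1) = U j ^ n j := by
    intro j hj
    apply Polynomial.coe_injective
    rw [Polynomial.coe_mul, Polynomial.coe_pow, hP', hU _ hj, hU j (by omega), ← map_mul,
      ← map_pow, h.rel_succ j hj]
  have last : IsUnit (U (m - 1)) := by
    have h1 : U (m - 1) =
        Polynomial.C (algebraMap F (FractionRing F) (u (m - 1))) := by
      apply Polynomial.coe_injective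
      rw [hU _ (by omega), Polynomial.coe_C]
      simp [φ, flow_eq_C hu]
    rw [h1]
    refine Polynomial.isUnit_C.mpr (IsUnit.mk0 _ ?_)
    rw [Ne, map_eq_zero_iff _ (IsFractionRing.injective F (FractionRing F))]
    exact h.u_ne _ (by omega)
  have down : ∀ i j, j + 1 + i = m → π ∣ U j → π ∣ P := by
    intro i
    induction i with
    | zero =>
      intro j hj hd
      have : j = m - 1 := by omega
      rw [this] at hd
      exact absurd (isUnit_of_dvd_unit hd last) hπ.not_isUnit
    | succ i ih =>
      intro j hj hd
      have h1 : π ∣ P * U (j + 1) := by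
        rw [rel j (by omega)]
        exact hd.trans (dvd_pow_self _ (h.exp_pos j (by omega)))
      rcases hπ.dvd_or_dvd h1 with h2 | h2
      · exact h2
      · exact ih (j + 1) (by omega) h2
  have hPdvd : π ∣ P := by
    rw [← rel0] at hdvd
    rcases hπ.dvd_or_dvd hdvd with h2 | h2
    · exact h2
    · exact down (m - 1) 0 (by omega) h2
  have hU0 : π ∣ U 0 := by
    apply hπ.dvd_of_dvd_pow (n := n 0)
    rw [← rel 0 (by omega)]
    exact hPdvd.mul_right _
  rw [← rel0, sq]
  exact mul_dvd_mul hPdvd hU0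

/-- If the last `û_j` is a constant, then `y` and `z` are not. -/
lemma not_y_or_z (h : GradedNil δ k l m n x y z u) (hu : δ (u (m - 1)) = 0) :
    δ y ≠ 0 ∧ δ z ≠ 0 := by
  have := charZero_of_algebra_complex F
  have : CharZero (FractionRing F) :=
    charZero_of_injective_algebraMap (IsFractionRing.injective F (FractionRing F))
  have hinj := IsFractionRing.injective F (FractionRing F)
  obtain ⟨Y, hY⟩ := h.y_nil.exists_flow_fraction
  obtain ⟨Z, hZ⟩ := h.z_nil.exists_flow_fraction
  have hQ : ((Y ^ k - Z ^ l : Polynomial (FractionRing F)) : PowerSeries (FractionRing F)) =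
      PowerSeries.map (algebraMap F (FractionRing F)) (flow δ (y ^ k - z ^ l)) := by
    simp [Polynomial.coe_sub, hY, hZ]
  have hQ0 : Y ^ k - Z ^ l ≠ 0 := by
    intro h0
    rw [h0, Polynomial.coe_zero] at hQ
    have := congrArg (PowerSeries.coeff 0) hQ
    rw [PowerSeries.coeff_map, coeff_flow] at this
    simp only [map_zero, Nat.factorial_zero, Nat.cast_one, inv_one, Function.iterate_zero, id,
      one_smul] at this
    exact h.pow_sub_ne ((map_eq_zero_iff _ hinj).mp this.symm)
  have hsq := fun π (hπ : Prime π) hd => h.squareful hu hQ (π := π) hπ hd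
  have hk := h.two_le_k
  have hl := h.two_le_l
  constructor
  · intro hy
    have hYC : Y = Polynomial.C (algebraMap F (FractionRing F) y) := by
      apply Polynomial.coe_injective
      rw [hY, flow_eq_C hy, Polynomial.coe_C, PowerSeries.map_C]
    have hneg : Z ^ l - Polynomial.C (algebraMap F (FractionRing F) y ^ k) = -(Y ^ k - Z ^ l) := by
      rw [hYC, Polynomial.C_pow]; ring
    refine h.not_y_z ⟨hy, apply_eq_zero_of_derivative hZ (derivative_eq_zero_of_squareful hl
      (a := algebraMap F (FractionRing F) y ^ k) ?_ ?_ ?_)⟩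
    · exact pow_ne_zero _ ((map_ne_zero_iff _ hinj).mpr h.y_ne)
    · rw [hneg]; exact neg_ne_zero.mpr hQ0
    · intro π hπ hd
      rw [hneg, dvd_neg] at hd ⊢
      exact hsq π hπ hd
  · intro hz
    have hZC : Z = Polynomial.C (algebraMap F (FractionRing F) z) := by
      apply Polynomial.coe_injective
      rw [hZ, flow_eq_C hz, Polynomial.coe_C, PowerSeries.map_C]
    have heq : Y ^ k - Polynomial.C (algebraMap F (FractionRing F) z ^ l) = Y ^ k - Z ^ l := by
      rw [hZC, Polynomial.C_pow]
    refine h.not_y_z ⟨apply_eq_zero_of_derivative hY (derivative_eq_zero_of_squareful hk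
      (a := algebraMap F (FractionRing F) z ^ l) ?_ ?_ ?_), hz⟩
    · exact pow_ne_zero _ ((map_ne_zero_iff _ hinj).mpr h.z_ne)
    · rw [heq]; exact hQ0
    · intro π hπ hd
      rw [heq] at hd ⊢
      exact hsq π hπ hd

end GradedNil

end GradedNil

/-! ### The equations of the root `0` and their filtration -/

section Tower

/-- The pole orders `d₀ = 1`, `d_{j+1} = n_j d_j + 1` along `x = 0` of the elements `u_j`. -/
def poleOrder (n : ℕ → ℕ) : ℕ → ℕ
  | 0 => 1
  | j + 1 => n j * poleOrder n j + 1

/-- The exponents `N₀ = 1`, `N_{j+1} = n_j N_j` such that `(yᵏ - zˡ) ^ N_j` is the leading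
coefficient of `u_j`. -/
def cuspExponent (n : ℕ → ℕ) : ℕ → ℕ
  | 0 => 1
  | j + 1 => n j * cuspExponent n j

/-- The values of `y`, `z` and `u` in the Laurent series ring. -/
noncomputable def towerPoint (u : ℕ → Lau) (j : ℕ) : Fin 2 ⊕ Fin j → Lau :=
  Sum.elim ![HahnSeries.C (X 0), HahnSeries.C (X 1)] fun i => u i

/-- Elements `u₀, …, u_{m-1}` of the Laurent series ring that solve the block of equations of the
root `0`: `x u₀ = q` and `x u_{j+1} = u_j ^ n_j - r_{j+1}(y, z, u₀, …, u_j)`. -/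
structure Tower (q : YZ) (m : ℕ) (n : ℕ → ℕ) (r : (j : ℕ) → MvPolynomial (Fin 2 ⊕ Fin j) ℂ)
    (u : ℕ → Lau) : Prop where
  pos : 0 < m
  ne_zero : q ≠ 0
  degree_lt : ∀ j < m, ∀ i : Fin j, (r j).degreeOf (Sum.inr i) < n i
  rel_zero : Lau.x * u 0 = HahnSeries.C q
  rel_succ : ∀ j, j + 1 < m →
    Lau.x * u (j + 1) = u j ^ n j - aeval (towerPoint u (j + 1)) (r (j + 1))

/-- The pole order of the leading part of a monomial in the `u_j`. -/
def monOrder (m : ℕ) (n : ℕ → ℕ) (e : ℕ → ℕ) : ℕ := ∑ j ∈ Finset.range m, e j * poleOrder n j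

/-- The exponent of `yᵏ - zˡ` in the leading part of a monomial in the `u_j`. -/
def monExponent (m : ℕ) (n : ℕ → ℕ) (e : ℕ → ℕ) : ℕ :=
  ∑ j ∈ Finset.range m, e j * cuspExponent n j

/-- The monomial in the `u_j`, `j < m`, with exponents `e`. -/
noncomputable def mon {F : Type*} [CommRing F] (u : ℕ → F) (m : ℕ) (e : ℕ → ℕ) : F :=
  ∏ j ∈ Finset.range m, u j ^ e j

lemma mon_add {F : Type*} [CommRing F] (u : ℕ → F) (m : ℕ) (e e' : ℕ → ℕ) :
    mon u m (e + e') = mon u m e * mon u m e' := by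
  simp [mon, pow_add, Finset.prod_mul_distrib]

lemma mon_single {F : Type*} [CommRing F] (u : ℕ → F) {m j : ℕ} (hj : j < m) (c : ℕ) :
    mon u m (Pi.single j c) = u j ^ c := by
  rw [mon, Finset.prod_eq_single j]
  · simp
  · intro i _ hi
    simp [Pi.single_eq_of_ne hi]
  · intro h
    exact absurd (Finset.mem_range.mpr hj) h

lemma monOrder_add (m : ℕ) (n e e' : ℕ → ℕ) :
    monOrder m n (e + e') = monOrder m n e + monOrder m n e' := by
  simp [monOrder, add_mul, Finset.sum_add_distrib]

lemma monExponent_add (m : ℕ) (n e e' : ℕ → ℕ) :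
    monExponent m n (e + e') = monExponent m n e + monExponent m n e' := by
  simp [monExponent, add_mul, Finset.sum_add_distrib]

lemma sum_single_mul {m j : ℕ} (hj : j < m) (c : ℕ) (f : ℕ → ℕ) :
    ∑ i ∈ Finset.range m, (Pi.single j c : ℕ → ℕ) i * f i = c * f j := by
  rw [Finset.sum_eq_single j]
  · simp
  · intro i _ hi
    simp [Pi.single_eq_of_ne hi]
  · intro h
    exact absurd (Finset.mem_range.mpr hj) h

lemma monOrder_single (n : ℕ → ℕ) {m j : ℕ} (hj : j < m) (c : ℕ) :
    monOrder m n (Pi.single j c) = c * poleOrder n j := sum_single_mul hj c _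

lemma monExponent_single (n : ℕ → ℕ) {m j : ℕ} (hj : j < m) (c : ℕ) :
    monExponent m n (Pi.single j c) = c * cuspExponent n j := sum_single_mul hj c _

/-- The degree bounds on `r_{j+1}` make its pole order smaller than that of `u_j ^ n_j`. -/
lemma sum_lt_mul_poleOrder {n e : ℕ → ℕ} (j : ℕ) (h : ∀ i ≤ j, e i < n i) :
    ∑ i ∈ Finset.range (j + 1), e i * poleOrder n i + 1 ≤ n j * poleOrder n j := by
  induction j with
  | zero =>
    have := h 0 le_rfl
    simp only [zero_add, Finset.range_one, Finset.sum_singleton, poleOrder]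
    omega
  | succ j ih =>
    have h1 := ih fun i hi => h i (by omega)
    have h2 := h (j + 1) le_rfl
    rw [Finset.sum_range_succ]
    have h3 : (e (j + 1) + 1) * poleOrder n (j + 1) ≤ n (j + 1) * poleOrder n (j + 1) :=
      Nat.mul_le_mul_right _ h2
    have h4 : poleOrder n (j + 1) = n j * poleOrder n j + 1 := rfl
    rw [add_mul, one_mul] at h3
    omega

lemma sum_lt_cuspExponent {n e : ℕ → ℕ} (m : ℕ) (h : ∀ i < m, e i < n i) :
    ∑ i ∈ Finset.range m, e i * cuspExponent n i < cuspExponent n m := by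
  induction m with
  | zero => simp [cuspExponent]
  | succ m ih =>
    have h1 := ih fun i hi => h i (by omega)
    have h2 := h m (by omega)
    rw [Finset.sum_range_succ]
    have h3 : (e m + 1) * cuspExponent n m ≤ n m * cuspExponent n m := Nat.mul_le_mul_right _ h2
    have h4 : cuspExponent n (m + 1) = n m * cuspExponent n m := rfl
    rw [add_mul, one_mul] at h3
    omega

/-- Uniqueness of the digits in a mixed radix expansion. -/
lemma eq_of_monExponent_eq {n e e' : ℕ → ℕ} (m : ℕ) (he : ∀ i, i + 1 < m → e i < n i)
    (he' : ∀ i, i + 1 < m → e' i < n i) (h : monExponent m n e = monExponent m n e') :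
    ∀ i < m, e i = e' i := by
  induction m with
  | zero => intro i hi; omega
  | succ m ih =>
    have h1 := sum_lt_cuspExponent (n := n) (e := e) m fun i hi => he i (by omega)
    have h2 := sum_lt_cuspExponent (n := n) (e := e') m fun i hi => he' i (by omega)
    have hpos : 0 < cuspExponent n m := by omega
    rw [monExponent, monExponent, Finset.sum_range_succ, Finset.sum_range_succ] at h
    have hdiv := congrArg (· / cuspExponent n m) h
    simp only [Nat.add_mul_div_right _ _ hpos, Nat.div_eq_of_lt h1, Nat.div_eq_of_lt h2,
      zero_add] at hdiv
    rw [hdiv] at h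
    have h3 := ih (fun i hi => he i (by omega)) (fun i hi => he' i (by omega))
      (Nat.add_right_cancel h)
    intro i hi
    rcases (Nat.lt_succ_iff_lt_or_eq.mp hi) with h4 | rfl
    · exact h3 i h4
    · exact hdiv

lemma C_smul_eq (p : YZ) (a : Lau) : HahnSeries.C p * a = p • a := by
  rw [HahnSeries.C_apply, HahnSeries.single_zero_mul_eq_smul]

/-- A submodule contains the value of a polynomial once it contains all monomials in the `u_i`
whose exponents obey the degree bounds. -/
lemma aeval_towerPoint_mem (V : Submodule YZ Lau) (u : ℕ → Lau) {j : ℕ}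
    {p : MvPolynomial (Fin 2 ⊕ Fin j) ℂ} {b : ℕ → ℕ}
    (hp : ∀ i : Fin j, p.degreeOf (Sum.inr i) < b i)
    (h : ∀ e : ℕ → ℕ, (∀ i < j, e i < b i) → ∏ i ∈ Finset.range j, u i ^ e i ∈ V) :
    aeval (towerPoint u j) p ∈ V := by
  rw [p.as_sum, map_sum]
  refine Submodule.sum_mem _ fun s hs => ?_
  rw [aeval_monomial, Finsupp.prod_fintype _ _ (by simp), Fintype.prod_sum_type, Fin.prod_univ_two]
  let e : ℕ → ℕ := fun i => if hi : i < j then s (Sum.inr ⟨i, hi⟩) else 0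
  have he : ∀ i : Fin j, e i = s (Sum.inr i) := fun i => by simp [e]
  have h1 : ∏ i : Fin j, towerPoint u j (Sum.inr i) ^ s (Sum.inr i) =
      ∏ i ∈ Finset.range j, u i ^ e i := by
    rw [Finset.prod_range]
    refine Finset.prod_congr rfl fun i _ => ?_
    rw [he]
    rfl
  have h2 : algebraMap ℂ Lau (coeff s p) = HahnSeries.C (C (coeff s p)) := rfl
  rw [h1, h2]
  simp only [towerPoint, Sum.elim_inl, Matrix.cons_val_zero, Matrix.cons_val_one]
  rw [← map_pow, ← map_pow, ← map_mul, ← mul_assoc, ← map_mul, C_smul_eq]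
  refine V.smul_mem _ (h e fun i hi => ?_)
  have h3 := he ⟨i, hi⟩
  simp only at h3
  rw [h3]
  exact (monomial_le_degreeOf _ hs).trans_lt (hp ⟨i, hi⟩)

/-- The filtration of the algebra generated by `y, z, x` and the `u_j` by the pole order of the
leading parts of the monomials. -/
noncomputable def towerFiltration (m : ℕ) (n : ℕ → ℕ) (u : ℕ → Lau) (i : ℤ) : Submodule YZ Lau :=
  Submodule.span YZ {f | ∃ (a : ℕ) (e : ℕ → ℕ), (monOrder m n e : ℤ) - a ≤ i ∧
    f = Lau.x ^ a * mon u m e}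

variable {q : YZ} {m : ℕ} {n : ℕ → ℕ} {r : (j : ℕ) → MvPolynomial (Fin 2 ⊕ Fin j) ℂ} {u : ℕ → Lau}

lemma mem_towerFiltration {i : ℤ} {a : ℕ} {e : ℕ → ℕ} (h : (monOrder m n e : ℤ) - a ≤ i) :
    Lau.x ^ a * mon u m e ∈ towerFiltration m n u i :=
  Submodule.subset_span ⟨a, e, h, rfl⟩

lemma mon_mem_towerFiltration {i : ℤ} {e : ℕ → ℕ} (h : (monOrder m n e : ℤ) ≤ i) :
    mon u m e ∈ towerFiltration m n u i := by
  have := mem_towerFiltration (u := u) (a := 0) (e := e) (i := i) (m := m) (n := n) (by simpa)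
  simpa using this

lemma x_pow_mem_towerFiltration (a : ℕ) :
    Lau.x ^ a ∈ towerFiltration m n u (-a) := by
  have := mem_towerFiltration (u := u) (a := a) (e := 0) (i := -a) (m := m) (n := n)
    (by simp [monOrder])
  simpa [mon] using this

lemma towerFiltration_mono {i j : ℤ} (h : i ≤ j) :
    towerFiltration m n u i ≤ towerFiltration m n u j :=
  Submodule.span_mono fun _ ⟨a, e, h1, h2⟩ => ⟨a, e, h1.trans h, h2⟩

lemma mul_mem_towerFiltration {i j : ℤ} {f g : Lau} (hf : f ∈ towerFiltration m n u i)
    (hg : g ∈ towerFiltration m n u j) : f * g ∈ towerFiltration m n u (i + j) := by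
  have h := Submodule.mul_mem_mul hf hg
  rw [towerFiltration, towerFiltration, Submodule.span_mul_span] at h
  refine Submodule.span_mono ?_ h
  rintro _ ⟨_, ⟨a, e, h1, rfl⟩, _, ⟨a', e', h2, rfl⟩, rfl⟩
  refine ⟨a + a', e + e', ?_, ?_⟩
  · rw [monOrder_add]; push_cast; linarith
  · simp only [mon_add, pow_add]; ring

lemma Lau.x_mem : Lau.x ∈ Lau.orderGE 1 := Lau.single_mem_orderGE 1 1

lemma Lau.coeff_x : Lau.x.coeff 1 = 1 := HahnSeries.coeff_single_same 1 1

lemma Lau.x_ne_zero : Lau.x ≠ 0 := HahnSeries.single_ne_zero one_ne_zero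

lemma Lau.coeff_x_mul (a : Lau) (i : ℤ) : (Lau.x * a).coeff (i + 1) = a.coeff i := by
  rw [Lau.x, HahnSeries.coeff_single_mul_add, one_mul]

lemma Lau.mem_of_x_mul_mem {i : ℤ} {a : Lau} (h : Lau.x * a ∈ Lau.orderGE (i + 1)) :
    a ∈ Lau.orderGE i := fun j hj => by
  rw [← Lau.coeff_x_mul]
  exact h _ (by omega)

lemma Lau.pow_mem {i : ℤ} {a : Lau} (h : a ∈ Lau.orderGE i) (N : ℕ) :
    a ^ N ∈ Lau.orderGE (N * i) ∧ (a ^ N).coeff (N * i) = a.coeff i ^ N := by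
  induction N with
  | zero =>
    simp only [pow_zero, Nat.cast_zero, zero_mul]
    exact ⟨Lau.single_mem_orderGE 0 1, HahnSeries.coeff_single_same 0 1⟩
  | succ N ih =>
    have e : ((N + 1 : ℕ) : ℤ) * i = N * i + i := by push_cast; ring
    rw [pow_succ, e, pow_succ]
    exact ⟨Lau.mul_mem_orderGE ih.1 h, by rw [Lau.coeff_mul_of_mem ih.1 h, ih.2]⟩

lemma Lau.prod_mem (s : Finset ℕ) (a : ℕ → Lau) (d : ℕ → ℤ) (h : ∀ j ∈ s, a j ∈ Lau.orderGE (d j)) :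
    ∏ j ∈ s, a j ∈ Lau.orderGE (∑ j ∈ s, d j) ∧
      (∏ j ∈ s, a j).coeff (∑ j ∈ s, d j) = ∏ j ∈ s, (a j).coeff (d j) := by
  classical
  induction s using Finset.induction_on with
  | empty =>
    simp only [Finset.prod_empty, Finset.sum_empty]
    exact ⟨Lau.single_mem_orderGE 0 1, HahnSeries.coeff_single_same 0 1⟩
  | insert i s hi ih =>
    have h1 := ih fun j hj => h j (Finset.mem_insert_of_mem hj)
    have h2 := h i (Finset.mem_insert_self i s)
    rw [Finset.prod_insert hi, Finset.sum_insert hi, Finset.prod_insert hi]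
    exact ⟨Lau.mul_mem_orderGE h2 h1.1, by rw [Lau.coeff_mul_of_mem h2 h1.1, h1.2]⟩

namespace Tower

lemma exp_pos (T : Tower q m n r u) {j : ℕ} (hj : j + 1 < m) : 0 < n j :=
  (Nat.zero_le _).trans_lt (T.degree_lt (j + 1) hj ⟨j, Nat.lt_succ_self j⟩)

/-- The leading part of `u_j` is `q ^ N_j / x ^ d_j`. -/
lemma leading_u (T : Tower q m n r u) (j : ℕ) (hj : j < m) :
    u j ∈ Lau.orderGE (-(poleOrder n j : ℤ)) ∧
      (u j).coeff (-(poleOrder n j : ℤ)) = q ^ cuspExponent n j := by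
  induction j using Nat.strong_induction_on with
  | _ j ih =>
  cases j with
  | zero =>
    have h1 : Lau.x * u 0 ∈ Lau.orderGE (-1 + 1) := by
      rw [T.rel_zero]
      exact Lau.single_mem_orderGE 0 q
    refine ⟨Lau.mem_of_x_mul_mem (i := -1) h1, ?_⟩
    simp only [poleOrder, cuspExponent, Nat.cast_one, pow_one]
    rw [← Lau.coeff_x_mul, T.rel_zero]
    exact HahnSeries.coeff_single_same 0 q
  | succ j =>
    have hu := ih j (by omega) (by omega)
    have hpow := Lau.pow_mem hu.1 (n j)
    have hr : aeval (towerPoint u (j + 1)) (r (j + 1)) ∈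
        Lau.orderGE (-((n j * poleOrder n j : ℕ) : ℤ) + 1) := by
      refine aeval_towerPoint_mem _ u (T.degree_lt (j + 1) hj) fun e he => ?_
      have h1 := Lau.prod_mem (Finset.range (j + 1)) (fun i => u i ^ e i)
        (fun i => (e i : ℤ) * -(poleOrder n i : ℤ)) fun i hi => by
          have hi' := Finset.mem_range.mp hi
          exact (Lau.pow_mem (ih i (by omega) (by omega)).1 (e i)).1
      refine Lau.orderGE_anti ?_ h1.1
      have h2 := sum_lt_mul_poleOrder (n := n) (e := e) j fun i hi => he i (by omega)
      simp only [mul_neg, Finset.sum_neg_distrib]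
      have h3 : ((∑ i ∈ Finset.range (j + 1), e i * poleOrder n i : ℕ) : ℤ) + 1 ≤
        ((n j * poleOrder n j : ℕ) : ℤ) := by exact_mod_cast h2
      push_cast at h3 ⊢
      linarith
    have e1 : (n j : ℤ) * -(poleOrder n j : ℤ) = -((n j * poleOrder n j : ℕ) : ℤ) := by
      push_cast; ring
    rw [e1] at hpow
    have e2 : -(poleOrder n (j + 1) : ℤ) + 1 = -((n j * poleOrder n j : ℕ) : ℤ) := by
      simp only [poleOrder]; push_cast; ring
    constructor
    · apply Lau.mem_of_x_mul_mem
      rw [T.rel_succ j hj, e2]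
      exact sub_mem hpow.1 (Lau.orderGE_anti (by omega) hr)
    · rw [← Lau.coeff_x_mul, T.rel_succ j hj, e2, HahnSeries.coeff_sub, hpow.2, hu.2,
        hr _ (by omega), sub_zero, ← pow_mul, cuspExponent, mul_comm]

lemma leading_mon (T : Tower q m n r u) (a : ℕ) (e : ℕ → ℕ) {i : ℤ}
    (hi : (monOrder m n e : ℤ) - a = i) :
    Lau.x ^ a * mon u m e ∈ Lau.orderGE (-i) ∧
      (Lau.x ^ a * mon u m e).coeff (-i) = q ^ monExponent m n e := by
  have h1 := Lau.prod_mem (Finset.range m) (fun j => u j ^ e j)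
    (fun j => (e j : ℤ) * -(poleOrder n j : ℤ)) fun j hj =>
      (Lau.pow_mem (T.leading_u j (Finset.mem_range.mp hj)).1 (e j)).1
  have h2 := Lau.pow_mem Lau.x_mem a
  have hsum : -i = (a : ℤ) * 1 + ∑ j ∈ Finset.range m, (e j : ℤ) * -(poleOrder n j : ℤ) := by
    rw [← hi, monOrder]
    push_cast
    simp only [mul_neg, Finset.sum_neg_distrib]
    ring
  rw [hsum]
  refine ⟨Lau.mul_mem_orderGE h2.1 h1.1, ?_⟩
  rw [mon, Lau.coeff_mul_of_mem h2.1 h1.1, h2.2, h1.2, Lau.coeff_x, one_pow, one_mul, monExponent,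
    ← Finset.prod_pow_eq_pow_sum]
  refine Finset.prod_congr rfl fun j hj => ?_
  have h3 := T.leading_u j (Finset.mem_range.mp hj)
  rw [(Lau.pow_mem h3.1 (e j)).2, h3.2, ← pow_mul, mul_comm]

lemma filtration_le (T : Tower q m n r u) (i : ℤ) :
    towerFiltration m n u i ≤ Lau.orderGE (-i) := by
  rw [towerFiltration, Submodule.span_le]
  rintro _ ⟨a, e, h, rfl⟩
  exact Lau.orderGE_anti (neg_le_neg h) (T.leading_mon a e rfl).1

lemma aeval_mem_filtration (T : Tower q m n r u) {j : ℕ} (hj : j + 1 < m) :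
    aeval (towerPoint u (j + 1)) (r (j + 1)) ∈
      towerFiltration m n u ((n j * poleOrder n j : ℕ) - 1) := by
  refine aeval_towerPoint_mem _ u (T.degree_lt (j + 1) hj) fun e he => ?_
  let e' : ℕ → ℕ := fun i => if i < j + 1 then e i else 0
  have h1 : ∏ i ∈ Finset.range (j + 1), u i ^ e i = mon u m e' := by
    rw [mon, ← Finset.prod_subset (Finset.range_mono hj.le)]
    · refine Finset.prod_congr rfl fun i hi => ?_
      simp only [e', if_pos (Finset.mem_range.mp hi)]
    · intro i _ hi
      simp only [e', if_neg (Finset.mem_range.not.mp hi), pow_zero]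
  have h2 : monOrder m n e' = ∑ i ∈ Finset.range (j + 1), e i * poleOrder n i := by
    rw [monOrder, ← Finset.sum_subset (Finset.range_mono hj.le)]
    · refine Finset.sum_congr rfl fun i hi => ?_
      simp only [e', if_pos (Finset.mem_range.mp hi)]
    · intro i _ hi
      simp only [e', if_neg (Finset.mem_range.not.mp hi), zero_mul]
  rw [h1]
  apply mon_mem_towerFiltration
  rw [h2]
  have h3 := sum_lt_mul_poleOrder (n := n) (e := e) j fun i hi => he i (by omega)
  omega

/-- Modulo lower terms of the filtration, each monomial in the `u_j` is a power of `x` times a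
monomial with `e_j < n_j` for `j + 1 < m`. -/
lemma exists_normal (T : Tower q m n r u) (e : ℕ → ℕ) : ∃ (a : ℕ) (e' : ℕ → ℕ),
    (∀ j, j + 1 < m → e' j < n j) ∧ monExponent m n e' = monExponent m n e ∧
    monOrder m n e' = monOrder m n e + a ∧
    mon u m e - Lau.x ^ a * mon u m e' ∈ towerFiltration m n u ((monOrder m n e : ℤ) - 1) := by
  -- each reduction step trades a power of `u_j` for one factor `u_{j+1}`
  generalize hN : ∑ j ∈ Finset.range m, e j * (m - j) = N
  induction N using Nat.strong_induction_on generalizing e with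
  | _ N ih =>
  by_cases hnorm : ∀ j, j + 1 < m → e j < n j
  · exact ⟨0, e, hnorm, rfl, rfl, by simp⟩
  push Not at hnorm
  obtain ⟨j, hj, hje⟩ := hnorm
  obtain ⟨e₀, rfl⟩ : ∃ e₀ : ℕ → ℕ, e = e₀ + Pi.single j (n j) := by
    refine ⟨e - Pi.single j (n j), (tsub_add_cancel_of_le fun i => ?_).symm⟩
    by_cases hi : i = j
    · subst hi
      rwa [Pi.single_eq_same]
    · rw [Pi.single_eq_of_ne hi]
      exact Nat.zero_le _
  have hjm : j < m := by omega
  set e₁ : ℕ → ℕ := e₀ + Pi.single (j + 1) 1 with he₁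
  have hord : monOrder m n e₁ = monOrder m n (e₀ + Pi.single j (n j)) + 1 := by
    rw [he₁, monOrder_add, monOrder_add, monOrder_single n hj, monOrder_single n hjm, poleOrder]
    ring
  have hexp : monExponent m n e₁ = monExponent m n (e₀ + Pi.single j (n j)) := by
    rw [he₁, monExponent_add, monExponent_add, monExponent_single n hj, monExponent_single n hjm,
      cuspExponent, one_mul]
  have hlt : ∑ i ∈ Finset.range m, e₁ i * (m - i) < N := by
    rw [← hN]
    simp only [he₁, Pi.add_apply, add_mul, Finset.sum_add_distrib]
    rw [sum_single_mul hj, sum_single_mul hjm]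
    have h1 : 1 * (m - j) ≤ n j * (m - j) := Nat.mul_le_mul_right _ (T.exp_pos hj)
    omega
  obtain ⟨a, e', h1, h2, h3, h4⟩ := ih _ hlt e₁ rfl
  refine ⟨a + 1, e', h1, h2.trans hexp, by omega, ?_⟩
  have hrel := T.rel_succ j hj
  have hmon : mon u m (e₀ + Pi.single j (n j)) - Lau.x ^ (a + 1) * mon u m e' =
      Lau.x ^ 1 * (mon u m e₁ - Lau.x ^ a * mon u m e') +
        mon u m e₀ * aeval (towerPoint u (j + 1)) (r (j + 1)) := by
    rw [he₁, mon_add, mon_add, mon_single u hj, mon_single u hjm]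
    linear_combination -mon u m e₀ * hrel
  rw [hmon]
  refine add_mem ?_ ?_
  · have := mul_mem_towerFiltration (x_pow_mem_towerFiltration (m := m) (n := n) (u := u) 1) h4
    refine towerFiltration_mono ?_ this
    rw [hord]; push_cast; omega
  · have := mul_mem_towerFiltration (mon_mem_towerFiltration (u := u) (e := e₀) (m := m) (n := n)
      le_rfl) (T.aeval_mem_filtration hj)
    refine towerFiltration_mono ?_ this
    rw [monOrder_add, monOrder_single n hjm]
    push_cast
    omega

/-- Two monomials with the same leading part agree modulo lower terms of the filtration. -/
lemma sub_mem_of_monExponent_eq (T : Tower q m n r u) {a₁ a₂ : ℕ} {e₁ e₂ : ℕ → ℕ} {i : ℤ}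
    (h₁ : (monOrder m n e₁ : ℤ) - a₁ = i) (h₂ : (monOrder m n e₂ : ℤ) - a₂ = i)
    (h : monExponent m n e₁ = monExponent m n e₂) :
    Lau.x ^ a₁ * mon u m e₁ - Lau.x ^ a₂ * mon u m e₂ ∈ towerFiltration m n u (i - 1) := by
  obtain ⟨b₁, f₁, hn₁, hE₁, hO₁, hm₁⟩ := T.exists_normal e₁
  obtain ⟨b₂, f₂, hn₂, hE₂, hO₂, hm₂⟩ := T.exists_normal e₂
  have hf := eq_of_monExponent_eq m hn₁ hn₂ (by rw [hE₁, hE₂, h])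
  have hmon : mon u m f₁ = mon u m f₂ := Finset.prod_congr rfl fun j hj => by
    rw [hf j (Finset.mem_range.mp hj)]
  have hord : monOrder m n f₁ = monOrder m n f₂ := Finset.sum_congr rfl fun j hj => by
    rw [hf j (Finset.mem_range.mp hj)]
  have hb : a₁ + b₁ = a₂ + b₂ := by omega
  have key : Lau.x ^ a₁ * mon u m e₁ - Lau.x ^ a₂ * mon u m e₂ =
      Lau.x ^ a₁ * (mon u m e₁ - Lau.x ^ b₁ * mon u m f₁) -
        Lau.x ^ a₂ * (mon u m e₂ - Lau.x ^ b₂ * mon u m f₂) := by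
    have : Lau.x ^ a₁ * Lau.x ^ b₁ = Lau.x ^ a₂ * Lau.x ^ b₂ := by rw [← pow_add, ← pow_add, hb]
    rw [hmon]
    linear_combination mon u m f₂ * this
  rw [key]
  refine sub_mem (towerFiltration_mono ?_ (mul_mem_towerFiltration
    (x_pow_mem_towerFiltration a₁) hm₁)) (towerFiltration_mono ?_ (mul_mem_towerFiltration
    (x_pow_mem_towerFiltration a₂) hm₂)) <;> omega

/-- In each degree the graded ring of the filtration is generated, as a `ℂ[y, z]`-module, by one
monomial. -/
lemma exists_generator (T : Tower q m n r u) (i : ℤ) : ∃ (a : ℕ) (e : ℕ → ℕ),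
    (monOrder m n e : ℤ) - a = i ∧ ∀ f ∈ towerFiltration m n u i, ∃ p : YZ,
      f - p • (Lau.x ^ a * mon u m e) ∈ towerFiltration m n u (i - 1) := by
  classical
  have hex : ∃ E, ∃ (a : ℕ) (e : ℕ → ℕ), (monOrder m n e : ℤ) - a = i ∧ monExponent m n e = E := by
    refine ⟨_, (-i).toNat, Pi.single 0 i.toNat, ?_, rfl⟩
    rw [monOrder_single n T.pos, poleOrder]
    omega
  obtain ⟨a, e, hi, hE⟩ := Nat.find_spec hex
  have hmin : ∀ (a' : ℕ) (e' : ℕ → ℕ), (monOrder m n e' : ℤ) - a' = i →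
      monExponent m n e ≤ monExponent m n e' := fun a' e' h => by
    rw [hE]
    exact Nat.find_min' hex ⟨a', e', h, rfl⟩
  refine ⟨a, e, hi, fun f hf => ?_⟩
  induction hf using Submodule.span_induction with
  | mem f hf =>
    obtain ⟨a', e', h, rfl⟩ := hf
    rcases h.lt_or_eq with h | h
    · exact ⟨0, by simpa using mem_towerFiltration (by omega)⟩
    · obtain ⟨s, hs⟩ := Nat.exists_eq_add_of_le (hmin a' e' h)
      refine ⟨q ^ s, ?_⟩
      -- multiplication by `q = x u₀` raises the exponent of `q` and keeps the degree
      have h1 : q ^ s • (Lau.x ^ a * mon u m e) =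
          Lau.x ^ (a + s) * mon u m (e + Pi.single 0 s) := by
        rw [← C_smul_eq, map_pow, ← T.rel_zero, mon_add, mon_single u T.pos]
        ring
      rw [h1]
      refine T.sub_mem_of_monExponent_eq h ?_ ?_
      · rw [monOrder_add, monOrder_single n T.pos, poleOrder]
        push_cast
        omega
      · rw [monExponent_add, monExponent_single n T.pos, cuspExponent, hs, mul_one]
  | zero => exact ⟨0, by simp⟩
  | add f g _ _ hf hg =>
    obtain ⟨p, hp⟩ := hf
    obtain ⟨p', hp'⟩ := hg
    refine ⟨p + p', ?_⟩
    convert add_mem hp hp' using 1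
    rw [add_smul]
    abel
  | smul c f _ hf =>
    obtain ⟨p, hp⟩ := hf
    refine ⟨c * p, ?_⟩
    convert Submodule.smul_mem _ c hp using 1
    rw [smul_sub, smul_smul]

/-- The filtration is the one by the order in `x`; the coefficients of order `-i` are multiples of
the leading coefficient of one monomial of pole order `i`. -/
lemma exists_coeff_eq (T : Tower q m n r u) (i : ℤ) : ∃ (a : ℕ) (e : ℕ → ℕ),
    (monOrder m n e : ℤ) - a = i ∧ ∀ f ∈ towerFiltration m n u i,
      (∃ p : YZ, f.coeff (-i) = p * q ^ monExponent m n e) ∧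
      (f.coeff (-i) = 0 → f ∈ towerFiltration m n u (i - 1)) := by
  obtain ⟨a, e, hi, h⟩ := T.exists_generator i
  refine ⟨a, e, hi, fun f hf => ?_⟩
  obtain ⟨p, hp⟩ := h f hf
  have h1 : f.coeff (-i) = p * q ^ monExponent m n e := by
    have h2 := T.filtration_le _ hp (-i) (by omega)
    rw [HahnSeries.coeff_sub, HahnSeries.coeff_smul, (T.leading_mon a e hi).2, smul_eq_mul,
      sub_eq_zero] at h2
    exact h2
  refine ⟨⟨p, h1⟩, fun h0 => ?_⟩
  rw [h1] at h0
  have hp0 : p = 0 := (mul_eq_zero.mp h0).resolve_right (pow_ne_zero _ T.ne_zero)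
  simpa [hp0] using hp

lemma mem_filtration_of_mem (T : Tower q m n r u) {i j : ℤ} {f : Lau}
    (hf : f ∈ towerFiltration m n u j) (h : f ∈ Lau.orderGE (-i)) :
    f ∈ towerFiltration m n u i := by
  rcases le_total j i with hji | hji
  · exact towerFiltration_mono hji hf
  induction j, hji using Int.leInduction with
  | base => exact hf
  | succ j hj ih =>
    obtain ⟨a, e, -, h1⟩ := T.exists_coeff_eq (j + 1)
    have := (h1 f hf).2 (h _ (by omega))
    exact ih (by simpa using this)

/-- An element of the algebra generated by `x, y, z` and the `u_j` that has positive order in `x`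
is divisible by `x` in that algebra. -/
lemma exists_eq_x_mul (T : Tower q m n r u) {i : ℤ} {f : Lau}
    (hf : f ∈ towerFiltration m n u i) (h : f ∈ Lau.orderGE 1) :
    ∃ j, ∃ g ∈ towerFiltration m n u j, f = Lau.x * g := by
  have h1 := T.mem_filtration_of_mem (i := -1) hf (by simpa using h)
  refine ⟨0, ?_⟩
  clear hf h
  induction h1 using Submodule.span_induction with
  | mem f hf =>
    obtain ⟨a, e, h, rfl⟩ := hf
    obtain ⟨b, rfl⟩ : ∃ b, a = b + 1 := ⟨a - 1, by omega⟩
    refine ⟨Lau.x ^ b * mon u m e, mem_towerFiltration (by push_cast at h; omega), by ring⟩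
  | zero => exact ⟨0, zero_mem _, by simp⟩
  | add f g _ _ hf hg =>
    obtain ⟨f', h1, rfl⟩ := hf
    obtain ⟨g', h2, rfl⟩ := hg
    exact ⟨f' + g', add_mem h1 h2, by ring⟩
  | smul c f _ hf =>
    obtain ⟨f', h1, rfl⟩ := hf
    exact ⟨c • f', Submodule.smul_mem _ c h1, by rw [mul_smul_comm]⟩

end Tower

end Tower

/-! ### The transcendence degree of the kernel of a derivation -/

section Kernel

variable {F : Type*} [CommRing F] [Algebra ℂ F]

lemma derivation_apply_aeval {d : Derivation ℂ F F} {S : Subalgebra ℂ F}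
    (hS : ∀ s ∈ S, d s = 0) (a : F) (p : Polynomial S) :
    d (Polynomial.aeval a p) = Polynomial.aeval a (Polynomial.derivative p) * d a := by
  induction p using Polynomial.induction_on' with
  | add p q hp hq => simp only [map_add, hp, hq, add_mul]
  | monomial n c =>
    have hc : d (algebraMap S F c) = 0 := hS c c.2
    rw [Polynomial.aeval_monomial, Polynomial.derivative_monomial, Polynomial.aeval_monomial,
      d.leibniz, hc, d.leibniz_pow]
    simp only [smul_eq_mul, nsmul_eq_mul, map_mul, map_natCast]
    ring

/-- If `δ²s = 0`, then `δⁿ⁺¹(s b) = s δⁿ⁺¹(b) + (n + 1) δ(s) δⁿ(b)`. -/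
lemma iterate_slice_mul {δ : Derivation ℂ F F} {s : F} (hs : δ (δ s) = 0) (n : ℕ) (b : F) :
    (⇑δ)^[n + 1] (s * b) = s * (⇑δ)^[n + 1] b + (n + 1) * δ s * (⇑δ)^[n] b := by
  induction n with
  | zero => simp [δ.leibniz]; ring
  | succ n ih =>
    rw [Function.iterate_succ_apply', ih, Function.iterate_succ_apply' _ (n + 1) b,
      map_add, δ.leibniz, δ.leibniz, δ.leibniz, hs, Function.iterate_succ_apply' _ n b]
    have hn : δ ((n : F) + 1) = 0 := by
      have : (n : F) + 1 = algebraMap ℂ F (n + 1) := by simp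
      rw [this, δ.map_algebraMap]
    simp only [smul_eq_mul, hn]
    push_cast
    ring

lemma iterate_const_mul {δ : Derivation ℂ F F} {c : F} (hc : δ c = 0) (n : ℕ) (b : F) :
    (⇑δ)^[n] (c * b) = c * (⇑δ)^[n] b := by
  induction n with
  | zero => rfl
  | succ n ih =>
    rw [Function.iterate_succ_apply', ih, δ.leibniz, hc, Function.iterate_succ_apply']
    simp

variable [IsDomain F]

/-- A derivation that vanishes on a subalgebra vanishes on all elements algebraic over it. -/
lemma derivation_eq_zero_of_isAlgebraic {d : Derivation ℂ F F} {S : Subalgebra ℂ F}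
    (hS : ∀ s ∈ S, d s = 0) {a : F} (ha : IsAlgebraic S a) : d a = 0 := by
  have : CharZero S := charZero_of_algebra_complex S
  obtain ⟨p, hp, hpa⟩ := ha
  induction h : p.natDegree using Nat.strong_induction_on generalizing p with
  | _ N ih =>
  have h1 := derivation_apply_aeval hS a p
  rw [hpa, map_zero, eq_comm, mul_eq_zero] at h1
  refine h1.elim (fun h3 => ?_) id
  by_cases hN : p.natDegree = 0
  · exfalso
    rw [Polynomial.eq_C_of_natDegree_eq_zero hN, Polynomial.aeval_C] at hpa
    apply hp
    rw [Polynomial.eq_C_of_natDegree_eq_zero hN,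
      (map_eq_zero_iff _ (FaithfulSMul.algebraMap_injective S F)).mp hpa, map_zero]
  · have hd : Polynomial.derivative p ≠ 0 := fun h4 => hN (Polynomial.derivative_eq_zero.mp h4)
    exact ih _ (h ▸ Polynomial.natDegree_derivative_lt hN) _ hd h3 rfl

variable {δ : Derivation ℂ F F} {A : Subalgebra ℂ F}

/-- A nontrivial locally nilpotent derivation has a local slice, over which everything is algebraic
together with the kernel. -/
lemma exists_slice (hstab : ∀ a ∈ A, δ a ∈ A) (hnil : ∀ a ∈ A, IsNil δ a) {x : F} (hx : x ∈ A)
    (hδx : δ x ≠ 0) : ∃ s : F, ∀ a ∈ A,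
      IsAlgebraic (Algebra.adjoin ℂ ({a | a ∈ A ∧ δ a = 0} ∪ {s})) a := by
  classical
  have hfind := hnil x hx
  obtain ⟨N, hN⟩ : ∃ N, Nat.find hfind = N + 2 := by
    refine ⟨Nat.find hfind - 2, ?_⟩
    have h0 : Nat.find hfind ≠ 0 := fun h => by
      have h1 := Nat.find_spec hfind
      rw [h] at h1
      exact hδx (by rw [show x = 0 from h1, map_zero])
    have h1 : Nat.find hfind ≠ 1 := fun h => by
      have h1 := Nat.find_spec hfind
      rw [h] at h1
      exact hδx h1
    omega
  have hstab' : ∀ n, ∀ a ∈ A, (⇑δ)^[n] a ∈ A := by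
    intro n a ha
    induction n with
    | zero => exact ha
    | succ n ih =>
      rw [Function.iterate_succ_apply']
      exact hstab _ ih
  set s := (⇑δ)^[N] x with hs
  have hδs : δ s ≠ 0 := by
    have := Nat.find_min hfind (m := N + 1) (by omega)
    rwa [Function.iterate_succ_apply'] at this
  have hδδs : δ (δ s) = 0 := by
    have := Nat.find_spec hfind
    rwa [hN, Function.iterate_succ_apply', Function.iterate_succ_apply'] at this
  have hsA : s ∈ A := hstab' N x hx
  refine ⟨s, fun a ha => ?_⟩
  set S := Algebra.adjoin ℂ ({a | a ∈ A ∧ δ a = 0} ∪ {s}) with hS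
  have hKS : ∀ a ∈ A, δ a = 0 → a ∈ S := fun a h1 h2 => Algebra.subset_adjoin (Or.inl ⟨h1, h2⟩)
  have hsS : s ∈ S := Algebra.subset_adjoin (Or.inr rfl)
  have halg : ∀ b ∈ S, IsAlgebraic S b := fun b hb =>
    isAlgebraic_algebraMap (⟨b, hb⟩ : S)
  have hchar : CharZero F := charZero_of_algebra_complex F
  obtain ⟨n, hn⟩ := hnil a ha
  induction n using Nat.strong_induction_on generalizing a with
  | _ n ih =>
  match n with
  | 0 =>
    have h0 : a = 0 := hn
    rw [h0]
    exact isAlgebraic_zero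
  | 1 => exact halg a (hKS a ha hn)
  | n + 2 =>
    have hδa := ih (n + 1) (by omega) (δ a) (hstab a ha)
      (by rw [← Function.iterate_succ_apply]; exact hn)
    -- this combination has lower degree along the flow than `a`
    have hb := ih (n + 1) (by omega) (((n : F) + 1) * δ s * a - s * δ a)
      (sub_mem (mul_mem (mul_mem (add_mem (natCast_mem A n) (one_mem A)) (hstab s hsA)) ha)
        (mul_mem hsA (hstab a ha))) (by
        have hc : δ (((n : F) + 1) * δ s) = 0 := by
          have : (n : F) + 1 = algebraMap ℂ F (n + 1) := by simp
          rw [δ.leibniz, hδδs, this, δ.map_algebraMap]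
          simp
        rw [iterate_map_sub, iterate_const_mul hc, iterate_slice_mul hδδs,
          ← Function.iterate_succ_apply, ← Function.iterate_succ_apply, hn]
        ring)
    have h1 : IsAlgebraic S (((n : F) + 1) * δ s * a) := by
      have := hb.add ((halg s hsS).mul hδa)
      rwa [sub_add_cancel] at this
    have hcS : ((n : F) + 1) * δ s ∈ S :=
      mul_mem (add_mem (natCast_mem S n) (one_mem S)) (hKS _ (hstab s hsA) hδδs)
    have hc0 : ((n : F) + 1) * δ s ≠ 0 :=
      mul_ne_zero (by exact_mod_cast Nat.succ_ne_zero n) hδs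
    have h2 : IsAlgebraic S ((⟨_, hcS⟩ : S) • a) := h1
    refine IsAlgebraic.of_smul (y := (⟨_, hcS⟩ : S)) (mem_nonZeroDivisors_of_ne_zero ?_) h2
    intro h3
    exact hc0 (congrArg Subtype.val h3)

/-- The kernel of a nontrivial locally nilpotent derivation of a subalgebra of transcendence degree
at least `3` has transcendence degree at least `2`. -/
lemma exists_algebraicIndependent_kernel (hstab : ∀ a ∈ A, δ a ∈ A) (hnil : ∀ a ∈ A, IsNil δ a)
    {v : Fin 3 → F} (hv : AlgebraicIndependent ℂ v) (hvA : ∀ i, v i ∈ A) {x : F} (hx : x ∈ A)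
    (hδx : δ x ≠ 0) : ∃ f g : F, (f ∈ A ∧ δ f = 0) ∧ (g ∈ A ∧ δ g = 0) ∧
      AlgebraicIndependent ℂ ![f, g] := by
  obtain ⟨s, hs⟩ := exists_slice hstab hnil hx hδx
  set K : Set F := {a | a ∈ A ∧ δ a = 0} with hK
  let M := AlgebraicIndependent.matroid ℂ F
  have hind : M.Indep (Set.range v) :=
    AlgebraicIndependent.matroid_indep_iff.mpr hv.coe_range
  have hcard : (Set.range v).encard = 3 := by
    rw [← Set.image_univ, hv.injective.encard_image, Set.encard_univ]
    simp
  have hsub : Set.range v ⊆ M.closure (K ∪ {s}) := by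
    rw [AlgebraicIndependent.matroid_closure_eq]
    rintro _ ⟨i, rfl⟩
    exact hs _ (hvA i)
  have h1 : (3 : ℕ∞) ≤ M.eRk K + 1 := by
    calc (3 : ℕ∞) = M.eRk (Set.range v) := by rw [hind.eRk_eq_encard, hcard]
      _ ≤ M.eRk (M.closure (K ∪ {s})) := M.eRk_mono hsub
      _ = M.eRk (K ∪ {s}) := M.eRk_closure_eq _
      _ ≤ M.eRk K + ({s} : Set F).encard := M.eRk_union_le_eRk_add_encard _ _
      _ = M.eRk K + 1 := by rw [Set.encard_singleton]
  have h2 : (2 : ℕ∞) ≤ M.eRk K := by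
    have : (2 : ℕ∞) + 1 ≤ M.eRk K + 1 := by
      rw [two_add_one_eq_three]
      exact h1
    exact (ENat.add_le_add_iff_right ENat.one_ne_top).mp this
  obtain ⟨I, hIK, hI, hIc⟩ := Matroid.le_eRk_iff.mp h2
  obtain ⟨f, g, hfg, rfl⟩ := Set.encard_eq_two.mp hIc
  have hI' := AlgebraicIndependent.matroid_indep_iff.mp hI
  refine ⟨f, g, hIK (by simp), hIK (by simp), ?_⟩
  let ι : Fin 2 → ({f, g} : Set F) := ![⟨f, by simp⟩, ⟨g, by simp⟩]
  have hι : Function.Injective ι := by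
    intro i j hij
    fin_cases i <;> fin_cases j <;> simp_all [ι, eq_comm]
  convert hI'.comp ι hι using 1
  funext i
  fin_cases i <;> rfl

end Kernel

/-- Two algebraically independent polynomials in `ℂ[y, z]` are not both constants of a nonzero
derivation. -/
lemma derivation_eq_zero_of_algebraicIndependent {d : Derivation ℂ YZ YZ} {f g : YZ}
    (h : AlgebraicIndependent ℂ ![f, g]) (hf : d f = 0) (hg : d g = 0) (p : YZ) : d p = 0 := by
  have htr : Algebra.trdeg ℂ YZ ≤ Cardinal.mk (Fin 2) := by
    rw [MvPolynomial.trdeg_of_isDomain, Cardinal.lift_id]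
  have hb := h.isTranscendenceBasis_of_trdeg_le_of_finite htr
  have halg := hb.isAlgebraic.isAlgebraic p
  refine derivation_eq_zero_of_isAlgebraic (fun s hs => ?_) halg
  induction hs using Algebra.adjoin_induction with
  | mem s hs =>
    obtain ⟨i, rfl⟩ := hs
    fin_cases i
    · exact hf
    · exact hg
  | algebraMap r => exact d.map_algebraMap r
  | add a b _ _ ha hb => rw [map_add, ha, hb, add_zero]
  | mul a b _ _ ha hb => simp [d.leibniz, ha, hb]

/-! ### Algebraic independence of `x`, `y`, `z` -/

section Coordinates

/-- The elements `x, y, z` of the Laurent series ring. -/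
noncomputable def coordXYZ : Fin 3 → Lau := Fin.cons Lau.x fun i => HahnSeries.C (X i)

lemma x_pow (a : ℕ) : Lau.x ^ a = HahnSeries.single (a : ℤ) 1 := by
  rw [Lau.x, HahnSeries.single_pow]
  simp

lemma coeff_aeval_x (p : Polynomial YZ) (i : ℕ) :
    (Polynomial.aeval Lau.x p).coeff (i : ℤ) = p.coeff i := by
  induction p using Polynomial.induction_on' with
  | add p q hp hq => simp [hp, hq]
  | monomial n c =>
    rw [Polynomial.aeval_monomial, ← Algebra.smul_def, HahnSeries.coeff_smul, x_pow,
      Polynomial.coeff_monomial, HahnSeries.coeff_single]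
    by_cases h : n = i
    · simp [h]
    · rw [if_neg h, if_neg (by omega), smul_zero]

lemma aeval_coordXYZ (P : MvPolynomial (Fin 3) ℂ) :
    aeval coordXYZ P = Polynomial.aeval Lau.x (finSuccEquiv ℂ 2 P) := by
  let ψ : MvPolynomial (Fin 3) ℂ →ₐ[ℂ] Lau :=
    ((Polynomial.aeval (R := YZ) Lau.x).restrictScalars ℂ).comp
      (finSuccEquiv ℂ 2).toAlgHom
  have h : aeval coordXYZ = ψ := by
    apply MvPolynomial.algHom_ext
    intro i
    refine Fin.cases ?_ (fun j => ?_) i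
    · simp [ψ, coordXYZ, finSuccEquiv_X_zero]
    · simp only [ψ, coordXYZ, aeval_X, AlgHom.comp_apply, Fin.cons_succ]
      change _ = Polynomial.aeval Lau.x (finSuccEquiv ℂ 2 (X j.succ))
      rw [finSuccEquiv_X_succ, Polynomial.aeval_C]
      rfl
  rw [h]
  rfl

lemma algebraicIndependent_coordXYZ : AlgebraicIndependent ℂ coordXYZ := by
  rw [algebraicIndependent_iff]
  intro P hP
  rw [aeval_coordXYZ] at hP
  have h : finSuccEquiv ℂ 2 P = 0 := by
    ext1 i
    rw [← coeff_aeval_x, hP]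
    simp
  simpa using h

end Coordinates

/-! ### Leading parts -/

section Leading

/-- The polynomial `yᵏ - zˡ`. -/
noncomputable def cusp (k l : ℕ) : YZ := X 0 ^ k - X 1 ^ l

lemma isWeightedHomogeneous_cusp (k l : ℕ) :
    IsWeightedHomogeneous (cuspWeight k l) (cusp k l) (k * l) := by
  have hy := (isWeightedHomogeneous_X ℂ (cuspWeight k l) 0).pow k
  have hz := (isWeightedHomogeneous_X ℂ (cuspWeight k l) 1).pow l
  have h1 : k • cuspWeight k l 0 = (k * l : ℤ) := by simp [cuspWeight]
  have h2 : l • cuspWeight k l 1 = (k * l : ℤ) := by simp [cuspWeight, mul_comm]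
  rw [h1] at hy
  rw [h2] at hz
  exact hy.sub hz

/-- The evaluation at `(y, z) = (1, 0)`. -/
noncomputable def evalOneZero : YZ →ₐ[ℂ] ℂ := aeval ![1, 0]

lemma evalOneZero_cusp {k l : ℕ} (hl : l ≠ 0) : evalOneZero (cusp k l) = 1 := by
  simp [evalOneZero, cusp, hl]

lemma cusp_ne_zero {k l : ℕ} (hl : l ≠ 0) : cusp k l ≠ 0 := fun h => by
  have := evalOneZero_cusp (k := k) hl
  rw [h, map_zero] at this
  exact zero_ne_one this

/-- The leading part `q ^ N_j / x ^ d_j` of `u_j`. -/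
noncomputable def leadU (q : YZ) (n : ℕ → ℕ) (j : ℕ) : Lau :=
  HahnSeries.single (-(poleOrder n j : ℤ)) (q ^ cuspExponent n j)

lemma x_mul_leadU_zero (q : YZ) (n : ℕ → ℕ) : Lau.x * leadU q n 0 = HahnSeries.C q := by
  simp [Lau.x, leadU, poleOrder, cuspExponent]

lemma x_mul_leadU_succ (q : YZ) (n : ℕ → ℕ) (j : ℕ) :
    Lau.x * leadU q n (j + 1) = leadU q n j ^ n j := by
  rw [Lau.x, leadU, leadU, HahnSeries.single_pow, HahnSeries.single_mul_single, one_mul, ← pow_mul,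
    poleOrder, cuspExponent, mul_comm (n j) (cuspExponent n j)]
  congr 1
  simp

lemma leadU_ne_zero {q : YZ} (hq : q ≠ 0) (n : ℕ → ℕ) (j : ℕ) : leadU q n j ≠ 0 :=
  HahnSeries.single_ne_zero (pow_ne_zero _ hq)

lemma x_pow_mul_mon_leadU (q : YZ) (n : ℕ → ℕ) (m a : ℕ) (e : ℕ → ℕ) {i : ℤ}
    (hi : (monOrder m n e : ℤ) - a = i) :
    Lau.x ^ a * mon (leadU q n) m e = HahnSeries.single (-i) (q ^ monExponent m n e) := by
  have h : ∀ M, mon (leadU q n) M e =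
      HahnSeries.single (-(monOrder M n e : ℤ)) (q ^ monExponent M n e) := by
    intro M
    induction M with
    | zero => simp [mon, monOrder, monExponent]
    | succ M ih =>
      have h1 : mon (leadU q n) (M + 1) e = mon (leadU q n) M e * leadU q n M ^ e M :=
        Finset.prod_range_succ _ _
      have h2 : monOrder (M + 1) n e = monOrder M n e + e M * poleOrder n M :=
        Finset.sum_range_succ _ _
      have h3 : monExponent (M + 1) n e = monExponent M n e + e M * cuspExponent n M :=
        Finset.sum_range_succ _ _
      rw [h1, ih, leadU, HahnSeries.single_pow, HahnSeries.single_mul_single, h2, h3, ← pow_mul,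
        ← pow_add, mul_comm (cuspExponent n M)]
      congr 1
      simp only [nsmul_eq_mul]
      push_cast
      ring_nf
  rw [h, x_pow, HahnSeries.single_mul_single, one_mul, ← hi]
  congr 1
  ring_nf

lemma gradedField_x (e : ℤ) (f₀ f₁ f₂ : YZ) :
    Lau.gradedField e f₀ f₁ f₂ Lau.x = HahnSeries.single e f₀ * Lau.x := Lau.vectorField_x _ _ _

lemma gradedField_y (e : ℤ) (f₀ f₁ f₂ : YZ) :
    Lau.gradedField e f₀ f₁ f₂ (HahnSeries.C (X 0)) = HahnSeries.single e f₁ :=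
  Lau.vectorField_y _ _ _

lemma gradedField_z (e : ℤ) (f₀ f₁ f₂ : YZ) :
    Lau.gradedField e f₀ f₁ f₂ (HahnSeries.C (X 1)) = HahnSeries.single e f₂ :=
  Lau.vectorField_z _ _ _

lemma C_ne_zero_of_ne {p : YZ} (hp : p ≠ 0) : (HahnSeries.C p : Lau) ≠ 0 :=
  HahnSeries.single_ne_zero hp

/-- The relations of a `GradedNil` hold between the leading parts of `x, y, z` and the `u_j`. -/
lemma gradedNil_gradedField {k l m : ℕ} {n : ℕ → ℕ} (hk : 2 ≤ k) (hl : 2 ≤ l) (hm : 2 ≤ m)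
    (hn : ∀ j, j + 1 < m → n j ≠ 0) {e : ℤ} {f₀ f₁ f₂ : YZ}
    (hx : IsNil (Lau.gradedField e f₀ f₁ f₂) Lau.x)
    (hy : IsNil (Lau.gradedField e f₀ f₁ f₂) (HahnSeries.C (X 0)))
    (hz : IsNil (Lau.gradedField e f₀ f₁ f₂) (HahnSeries.C (X 1)))
    (hu : ∀ j < m, IsNil (Lau.gradedField e f₀ f₁ f₂) (leadU (cusp k l) n j))
    (hne : ¬ (f₀ = 0 ∧ f₁ = 0 ∧ f₂ = 0)) :
    GradedNil (Lau.gradedField e f₀ f₁ f₂) k l m n Lau.x (HahnSeries.C (X 0)) (HahnSeries.C (X 1))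
      (leadU (cusp k l) n) where
  two_le_k := hk
  two_le_l := hl
  two_le_m := hm
  exp_pos := hn
  x_ne := Lau.x_ne_zero
  y_ne := C_ne_zero_of_ne (X_ne_zero 0)
  z_ne := C_ne_zero_of_ne (X_ne_zero 1)
  u_ne j _ := leadU_ne_zero (cusp_ne_zero (by omega)) n j
  x_nil := hx
  y_nil := hy
  z_nil := hz
  u_nil := hu
  rel_zero := by rw [x_mul_leadU_zero, cusp, map_sub, map_pow, map_pow]
  rel_succ j _ := x_mul_leadU_succ _ n j
  nontrivial := by
    rintro ⟨h0, h1, h2⟩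
    rw [gradedField_x, mul_eq_zero, or_iff_left Lau.x_ne_zero, HahnSeries.single_eq_zero_iff] at h0
    rw [gradedField_y, HahnSeries.single_eq_zero_iff] at h1
    rw [gradedField_z, HahnSeries.single_eq_zero_iff] at h2
    exact hne ⟨h0, h1, h2⟩

/-- The common order of the coefficients of a nonzero vector field. -/
lemma exists_leading_order {X Y Z : Lau} (h : X ≠ 0) :
    ∃ e : ℤ, (X ∈ Lau.orderGE e ∧ Y ∈ Lau.orderGE e ∧ Z ∈ Lau.orderGE e) ∧
      ¬ (X.coeff e = 0 ∧ Y.coeff e = 0 ∧ Z.coeff e = 0) := by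
  obtain ⟨a, -, hX⟩ := Lau.exists_order h
  obtain ⟨b₀, h₀⟩ := Lau.exists_mem_orderGE X
  obtain ⟨b₁, h₁⟩ := Lau.exists_mem_orderGE Y
  obtain ⟨b₂, h₂⟩ := Lau.exists_mem_orderGE Z
  obtain ⟨e, he, hmax⟩ := Int.exists_greatest_of_bdd
    (P := fun e => X ∈ Lau.orderGE e ∧ Y ∈ Lau.orderGE e ∧ Z ∈ Lau.orderGE e)
    ⟨a, fun e he => not_lt.mp fun hlt => hX (he.1 a hlt)⟩
    ⟨min b₀ (min b₁ b₂), Lau.orderGE_anti (by simp) h₀, Lau.orderGE_anti (by simp) h₁,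
      Lau.orderGE_anti (by simp) h₂⟩
  refine ⟨e, he, fun h0 => ?_⟩
  have := hmax (e + 1) ⟨Lau.mem_orderGE_succ he.1 h0.1, Lau.mem_orderGE_succ he.2.1 h0.2.1,
    Lau.mem_orderGE_succ he.2.2 h0.2.2⟩
  omega

/-- The weight of the leading part of a nonzero vector field. -/
lemma exists_leading_weight (w : Fin 2 → ℤ) {f₀ f₁ f₂ : YZ} (h : ¬ (f₀ = 0 ∧ f₁ = 0 ∧ f₂ = 0)) :
    ∃ e : ℤ, (f₀ ∈ weightLE w e ∧ f₁ ∈ weightLE w (e + w 0) ∧ f₂ ∈ weightLE w (e + w 1)) ∧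
      ¬ (weightedHomogeneousComponent w e f₀ = 0 ∧
        weightedHomogeneousComponent w (e + w 0) f₁ = 0 ∧
        weightedHomogeneousComponent w (e + w 1) f₂ = 0) := by
  obtain ⟨b₀, h₀⟩ := exists_weightLE (w := w) f₀
  obtain ⟨b₁, h₁⟩ := exists_weightLE (w := w) f₁
  obtain ⟨b₂, h₂⟩ := exists_weightLE (w := w) f₂
  have hbdd : ∃ b : ℤ, ∀ e, (f₀ ∈ weightLE w e ∧ f₁ ∈ weightLE w (e + w 0) ∧
      f₂ ∈ weightLE w (e + w 1)) → b ≤ e := by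
    have key : ∀ {f : YZ}, f ≠ 0 → ∀ c : ℤ, ∃ b, ∀ e, f ∈ weightLE w (e + c) → b ≤ e := by
      intro f hf c
      obtain ⟨m, hm⟩ := ne_zero_iff.mp hf
      exact ⟨Finsupp.weight w m - c, fun e he => by have := he m hm; omega⟩
    by_cases h0 : f₀ = 0
    · by_cases h1 : f₁ = 0
      · obtain ⟨b, hb⟩ := key (fun h2 => h ⟨h0, h1, h2⟩) (w 1)
        exact ⟨b, fun e he => hb e he.2.2⟩
      · obtain ⟨b, hb⟩ := key h1 (w 0)
        exact ⟨b, fun e he => hb e he.2.1⟩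
    · obtain ⟨b, hb⟩ := key h0 0
      exact ⟨b, fun e he => hb e (by simpa using he.1)⟩
  obtain ⟨b, hb⟩ := hbdd
  obtain ⟨e, he, hmin⟩ := Int.exists_least_of_bdd
    (P := fun e => f₀ ∈ weightLE w e ∧ f₁ ∈ weightLE w (e + w 0) ∧ f₂ ∈ weightLE w (e + w 1))
    ⟨b, hb⟩ ⟨max b₀ (max (b₁ - w 0) (b₂ - w 1)), weightLE_mono (by omega) h₀,
      weightLE_mono (by omega) h₁, weightLE_mono (by omega) h₂⟩
  refine ⟨e, he, fun h0 => ?_⟩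
  have h1 := mem_weightLE_pred he.2.1 h0.2.1
  have h2 := mem_weightLE_pred he.2.2 h0.2.2
  have := hmin (e - 1) ⟨mem_weightLE_pred he.1 h0.1,
    by rwa [sub_add_eq_add_sub], by rwa [sub_add_eq_add_sub]⟩
  omega

end Leading

/-! ### Growth of algebras of Laurent series -/

section Growth

lemma aeval_mem_subalgebra {σ : Type*} {R : Type*} [CommRing R] [Algebra ℂ R] (W : Subalgebra ℂ R)
    {v : σ → R} (hv : ∀ i, v i ∈ W) (p : MvPolynomial σ ℂ) : aeval v p ∈ W := by
  have h : aeval v p ∈ Algebra.adjoin ℂ (Set.range v) := by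
    rw [Algebra.adjoin_range_eq_range_aeval]
    exact ⟨p, rfl⟩
  refine Algebra.adjoin_le ?_ h
  rintro _ ⟨i, rfl⟩
  exact hv i

/-- A subalgebra of `ℂ[y, z]((x))` whose nonzero elements all have a leading coefficient that does
not vanish at `(1, 0)`, in some order `-r ≤ 0`, does not contain two algebraically independent
elements: it has too few elements of bounded order. -/
lemma not_algebraicIndependent_of_leading {K : Subalgebra ℂ Lau} {f g : Lau} (hf : f ∈ K)
    (hg : g ∈ K)
    (hK : ∀ h ∈ K, h ≠ 0 → ∃ r : ℕ, evalOneZero (h.coeff (-(r : ℤ))) ≠ 0) :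
    ¬ AlgebraicIndependent ℂ ![f, g] := by
  intro hind
  obtain ⟨c₁, hc₁⟩ := Lau.exists_mem_orderGE f
  obtain ⟨c₂, hc₂⟩ := Lau.exists_mem_orderGE g
  obtain ⟨c, hc, hfc, hgc⟩ : ∃ c : ℕ, 0 < c ∧ f ∈ Lau.orderGE (-(c : ℤ)) ∧
      g ∈ Lau.orderGE (-(c : ℤ)) := by
    refine ⟨c₁.natAbs + c₂.natAbs + 1, by omega, Lau.orderGE_anti (by omega) hc₁,
      Lau.orderGE_anti (by omega) hc₂⟩
  -- the `(n + 1) ^ 2` monomials of degree at most `n` in `f` and in `g` have pole order at most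
  -- `N = 2 * n * c`, and `(n + 1) ^ 2 > N + 1` for this `n`
  set n : ℕ := 2 * c with hn
  set N : ℕ := 2 * n * c with hN
  let b : Fin (n + 1) × Fin (n + 1) → MvPolynomial (Fin 2) ℂ := fun ij =>
    monomial (Finsupp.single 0 (ij.1 : ℕ) + Finsupp.single 1 (ij.2 : ℕ)) 1
  have hb : LinearIndependent ℂ b := by
    have h1 := (basisMonomials (Fin 2) ℂ).linearIndependent.comp
      (fun ij : Fin (n + 1) × Fin (n + 1) =>
        (Finsupp.single 0 (ij.1 : ℕ) + Finsupp.single 1 (ij.2 : ℕ) : Fin 2 →₀ ℕ)) (by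
        intro ij ij' h
        have h0 := DFunLike.congr_fun h 0
        have h1 := DFunLike.congr_fun h 1
        simp at h0 h1
        ext
        · exact_mod_cast h0
        · exact_mod_cast h1)
    rwa [coe_basisMonomials] at h1
  let ψ : Lau →ₗ[ℂ] (Fin (N + 1) → ℂ) :=
    { toFun := fun h r => evalOneZero (h.coeff (-((r : ℕ) : ℤ)))
      map_add' := fun a a' => by ext r; simp
      map_smul' := fun s a => by ext r; simp }
  let Ψ : (Fin (n + 1) × Fin (n + 1) → ℂ) →ₗ[ℂ] (Fin (N + 1) → ℂ) :=
    (ψ.comp (aeval ![f, g]).toLinearMap).comp (Fintype.linearCombination ℂ b)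
  have hmem : ∀ ij, aeval ![f, g] (b ij) ∈ Lau.orderGE (-(N : ℤ)) := by
    intro ij
    have h1 : aeval ![f, g] (b ij) = f ^ (ij.1 : ℕ) * g ^ (ij.2 : ℕ) := by
      simp only [b]
      rw [monomial_eq_X_pow]
      simp
    rw [h1]
    refine Lau.orderGE_anti ?_ (Lau.mul_mem_orderGE (Lau.pow_mem hfc _).1 (Lau.pow_mem hgc _).1)
    have h2 : (ij.1 : ℕ) * c ≤ n * c := Nat.mul_le_mul_right _ (by omega)
    have h3 : (ij.2 : ℕ) * c ≤ n * c := Nat.mul_le_mul_right _ (by omega)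
    have h4 : (ij.1 : ℕ) * c + (ij.2 : ℕ) * c ≤ N := by rw [hN]; linarith
    zify at h4
    linarith
  have hinj : Function.Injective Ψ := by
    rw [← LinearMap.ker_eq_bot, LinearMap.ker_eq_bot']
    intro s hs
    set P := Fintype.linearCombination ℂ b s with hP
    have hPK : aeval ![f, g] P ∈ K := by
      refine aeval_mem_subalgebra K (fun i => ?_) P
      fin_cases i
      · exact hf
      · exact hg
    have hPN : aeval ![f, g] P ∈ Lau.orderGE (-(N : ℤ)) := by
      rw [hP, Fintype.linearCombination_apply, map_sum]
      refine Submodule.sum_mem _ fun ij _ => ?_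
      rw [map_smul, Algebra.smul_def]
      change HahnSeries.C (C (s ij)) * _ ∈ _
      rw [C_smul_eq]
      exact Submodule.smul_mem _ _ (hmem ij)
    have hP0 : aeval ![f, g] P = 0 := by
      by_contra h0
      obtain ⟨r, hr⟩ := hK _ hPK h0
      by_cases hrN : r ≤ N
      · exact hr (congrFun hs ⟨r, by omega⟩)
      · rw [hPN _ (by omega), map_zero] at hr
        exact hr rfl
    have hP1 : P = 0 := (algebraicIndependent_iff.mp hind) P hP0
    have := Fintype.linearIndependent_iff.mp hb s (by
      rw [← Fintype.linearCombination_apply]; exact hP1)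
    exact funext this
  have hle := LinearMap.finrank_le_finrank_of_injective hinj
  simp only [Module.finrank_fintype_fun_eq_card, Fintype.card_prod, Fintype.card_fin] at hle
  rw [hN, hn] at hle
  nlinarith

end Growth

/-! ### Locally nilpotent vector fields on Laurent series kill `x` -/

/-- A subalgebra of `ℂ[y, z]((x))`, stable under a vector field that acts on it in a locally
nilpotent way, that contains `x, y, z` and the `u_j` of a tower, and whose elements are, up to
polynomials in `x` that do not vanish at `0`, polynomials in `x, y, z` and the `u_j`. -/
structure NilTower (k l m : ℕ) (n : ℕ → ℕ) (r : (j : ℕ) → MvPolynomial (Fin 2 ⊕ Fin j) ℂ)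
    (u : ℕ → Lau) (X Y Z : Lau) (A : Subalgebra ℂ Lau) : Prop where
  coprime : Nat.Coprime k l
  two_le_k : 2 ≤ k
  two_le_l : 2 ≤ l
  two_le_m : 2 ≤ m
  tower : Tower (cusp k l) m n r u
  x_mem : Lau.x ∈ A
  C_mem : ∀ p : YZ, HahnSeries.C p ∈ A
  u_mem : ∀ j < m, u j ∈ A
  stable : ∀ a ∈ A, Lau.vectorField X Y Z a ∈ A
  nil : ∀ a ∈ A, IsNil (Lau.vectorField X Y Z) a
  exists_mul_mem : ∀ a ∈ A, ∃ G : Polynomial ℂ, G.eval 0 ≠ 0 ∧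
    ∃ i, Polynomial.aeval Lau.x G * a ∈ towerFiltration m n u i

namespace NilTower

variable {k l m : ℕ} {n : ℕ → ℕ} {r : (j : ℕ) → MvPolynomial (Fin 2 ⊕ Fin j) ℂ} {u : ℕ → Lau}
  {X Y Z : Lau} {A : Subalgebra ℂ Lau}

lemma filtration_le (S : NilTower k l m n r u X Y Z A) {i : ℤ} {f : Lau}
    (hf : f ∈ towerFiltration m n u i) : f ∈ A := by
  induction hf using Submodule.span_induction with
  | mem f hf =>
    obtain ⟨a, e, -, rfl⟩ := hf
    exact mul_mem (pow_mem S.x_mem a) (prod_mem fun j hj =>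
      pow_mem (S.u_mem j (Finset.mem_range.mp hj)) _)
  | zero => exact zero_mem A
  | add f g _ _ hf hg => exact add_mem hf hg
  | smul c f _ hf =>
    rw [← C_smul_eq]
    exact mul_mem (S.C_mem c) hf

lemma aeval_x_eq (G : Polynomial ℂ) : Polynomial.aeval Lau.x G =
    Lau.x * Polynomial.aeval Lau.x G.divX + algebraMap ℂ Lau (G.eval 0) := by
  conv_lhs => rw [← G.divX_mul_X_add]
  rw [map_add, map_mul, Polynomial.aeval_X, Polynomial.aeval_C, mul_comm,
    Polynomial.coeff_zero_eq_eval_zero]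

lemma algebraMap_mem_orderGE (c : ℂ) : algebraMap ℂ Lau c ∈ Lau.orderGE 0 :=
  Lau.single_mem_orderGE 0 _

lemma aeval_x_mem (G : Polynomial ℂ) : Polynomial.aeval Lau.x G ∈ Lau.orderGE 0 := by
  induction G using Polynomial.induction_on' with
  | add p q hp hq => rw [map_add]; exact add_mem hp hq
  | monomial i c =>
    rw [Polynomial.aeval_monomial]
    have := Lau.mul_mem_orderGE (algebraMap_mem_orderGE c) (Lau.pow_mem Lau.x_mem i).1
    exact Lau.orderGE_anti (by omega) this

lemma coeff_aeval_x_zero (G : Polynomial ℂ) :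
    (Polynomial.aeval Lau.x G).coeff 0 = C (G.eval 0) := by
  rw [aeval_x_eq, HahnSeries.coeff_add]
  have h1 := Lau.mul_mem_orderGE Lau.x_mem (aeval_x_mem G.divX) 0 (by omega)
  rw [h1, zero_add]
  exact HahnSeries.coeff_single_same 0 _

lemma aeval_mem {a : Lau} (ha : a ∈ A) (G : Polynomial ℂ) : Polynomial.aeval a G ∈ A := by
  have := Subalgebra.aeval_coe A ⟨a, ha⟩ G
  rw [this]
  exact Subtype.property _

/-- An element of positive order in `x` is divisible by `x`. -/
lemma exists_eq_x_mul (S : NilTower k l m n r u X Y Z A) {f : Lau} (hf : f ∈ A)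
    (h : f ∈ Lau.orderGE 1) : ∃ g ∈ A, f = Lau.x * g := by
  obtain ⟨G, hG, i, hi⟩ := S.exists_mul_mem f hf
  obtain ⟨j, g, hg, hfg⟩ := S.tower.exists_eq_x_mul hi (by
    have := Lau.mul_mem_orderGE (aeval_x_mem G) h
    simpa using this)
  have hc : algebraMap ℂ Lau (G.eval 0)⁻¹ * algebraMap ℂ Lau (G.eval 0) = 1 := by
    rw [← map_mul, inv_mul_cancel₀ hG, map_one]
  refine ⟨algebraMap ℂ Lau (G.eval 0)⁻¹ * (g - Polynomial.aeval Lau.x G.divX * f),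
    mul_mem (A.algebraMap_mem _) (sub_mem (S.filtration_le hg)
      (mul_mem (aeval_mem S.x_mem _) hf)), ?_⟩
  rw [aeval_x_eq G] at hfg
  linear_combination algebraMap ℂ Lau (G.eval 0)⁻¹ * hfg - f * hc

/-- The leading coefficient of an element of pole order `i` is a multiple of the leading coefficient
of a monomial in the `u_j` and `x` of pole order `i`. -/
lemma exists_coeff_eq (S : NilTower k l m n r u X Y Z A) {f : Lau} (hf : f ∈ A) {i : ℤ}
    (h : f ∈ Lau.orderGE (-i)) : ∃ (a : ℕ) (e : ℕ → ℕ) (p : YZ),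
      (monOrder m n e : ℤ) - a = i ∧ f.coeff (-i) = p * cusp k l ^ monExponent m n e := by
  obtain ⟨G, hG, j, hj⟩ := S.exists_mul_mem f hf
  have h1 := Lau.mul_mem_orderGE (aeval_x_mem G) h
  rw [zero_add] at h1
  obtain ⟨a, e, hi, h2⟩ := S.tower.exists_coeff_eq i
  obtain ⟨p, hp⟩ := (h2 _ (S.tower.mem_filtration_of_mem hj h1)).1
  refine ⟨a, e, C (G.eval 0)⁻¹ * p, hi, ?_⟩
  rw [Lau.coeff_mul_of_mem' (aeval_x_mem G) h (zero_add _).symm, coeff_aeval_x_zero] at hp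
  have hc : (C (G.eval 0)⁻¹ * C (G.eval 0) : YZ) = 1 := by
    rw [← map_mul, inv_mul_cancel₀ hG, map_one]
  linear_combination C (G.eval 0)⁻¹ * hp - f.coeff (-i) * hc

end NilTower

/-- The vector field `x ^ e * (f₀ x ∂/∂x + f₁ ∂/∂y + f₂ ∂/∂z)` is the leading part of
`X x ∂/∂x + Y ∂/∂y + Z ∂/∂z`: the part of lowest order in `x` and then of highest weight. -/
structure IsLeading (w : Fin 2 → ℤ) (X Y Z : Lau) (e d : ℤ) (f₀ f₁ f₂ : YZ) : Prop where
  X_mem : X ∈ Lau.orderGE e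
  Y_mem : Y ∈ Lau.orderGE e
  Z_mem : Z ∈ Lau.orderGE e
  X_weight : X.coeff e ∈ weightLE w d
  Y_weight : Y.coeff e ∈ weightLE w (d + w 0)
  Z_weight : Z.coeff e ∈ weightLE w (d + w 1)
  X_eq : weightedHomogeneousComponent w d (X.coeff e) = f₀
  Y_eq : weightedHomogeneousComponent w (d + w 0) (Y.coeff e) = f₁
  Z_eq : weightedHomogeneousComponent w (d + w 1) (Z.coeff e) = f₂
  coeff_ne : ¬ (X.coeff e = 0 ∧ Y.coeff e = 0 ∧ Z.coeff e = 0)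
  ne : ¬ (f₀ = 0 ∧ f₁ = 0 ∧ f₂ = 0)

lemma exists_isLeading (w : Fin 2 → ℤ) {X : Lau} (Y Z : Lau) (h : X ≠ 0) :
    ∃ e d f₀ f₁ f₂, IsLeading w X Y Z e d f₀ f₁ f₂ := by
  obtain ⟨e, ⟨hX, hY, hZ⟩, he⟩ := exists_leading_order (Y := Y) (Z := Z) h
  obtain ⟨d, ⟨h0, h1, h2⟩, hd⟩ := exists_leading_weight w he
  exact ⟨e, d, _, _, _, hX, hY, hZ, h0, h1, h2, rfl, rfl, rfl, he, hd⟩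

namespace IsLeading

variable {w : Fin 2 → ℤ} {X Y Z : Lau} {e d : ℤ} {f₀ f₁ f₂ : YZ}

lemma iterate (L : IsLeading w X Y Z e d f₀ f₁ f₂) {i c : ℤ} {a : Lau} (ha : a ∈ Lau.orderGE i)
    (hc : a.coeff i ∈ weightLE w c) {N : ℕ} (h : (Lau.vectorField X Y Z)^[N] a = 0) :
    (Lau.gradedField e f₀ f₁ f₂)^[N]
      (HahnSeries.single i (weightedHomogeneousComponent w c (a.coeff i))) = 0 := by
  have h1 := Lau.gradedField_leading_iterate L.X_mem L.Y_mem L.Z_mem ha h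
  have h2 := Lau.gradedField_component_iterate L.X_weight L.Y_weight L.Z_weight e i hc h1
  rwa [L.X_eq, L.Y_eq, L.Z_eq] at h2

lemma isNil_single (L : IsLeading w X Y Z e d f₀ f₁ f₂) {a : Lau}
    (h : IsNil (Lau.vectorField X Y Z) a) {i c : ℤ} {p : YZ} (ha : a ∈ Lau.orderGE i)
    (hp : a.coeff i = p) (hc : IsWeightedHomogeneous w p c) :
    IsNil (Lau.gradedField e f₀ f₁ f₂) (HahnSeries.single i p) ∧
      IsNil (Lau.gradedField e (X.coeff e) (Y.coeff e) (Z.coeff e)) (HahnSeries.single i p) := by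
  obtain ⟨N, hN⟩ := h
  have h1 := L.iterate ha (by rw [hp]; exact IsWeightedHomogeneous.mem_weightLE hc) hN
  rw [hp, hc.weightedHomogeneousComponent_same] at h1
  have h2 := Lau.gradedField_leading_iterate L.X_mem L.Y_mem L.Z_mem ha hN
  rw [hp] at h2
  exact ⟨⟨N, h1⟩, ⟨N, h2⟩⟩

end IsLeading

namespace NilTower

variable {k l m : ℕ} {n : ℕ → ℕ} {r : (j : ℕ) → MvPolynomial (Fin 2 ⊕ Fin j) ℂ} {u : ℕ → Lau}
  {X Y Z : Lau} {A : Subalgebra ℂ Lau} {e d : ℤ} {f₀ f₁ f₂ : YZ}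

/-- Both leading parts of the vector field are locally nilpotent on the graded ring. -/
lemma gradedNil (S : NilTower k l m n r u X Y Z A)
    (L : IsLeading (cuspWeight k l) X Y Z e d f₀ f₁ f₂) :
    GradedNil (Lau.gradedField e f₀ f₁ f₂) k l m n Lau.x (HahnSeries.C (MvPolynomial.X 0))
      (HahnSeries.C (MvPolynomial.X 1)) (leadU (cusp k l) n) ∧
    GradedNil (Lau.gradedField e (X.coeff e) (Y.coeff e) (Z.coeff e)) k l m n Lau.x
      (HahnSeries.C (MvPolynomial.X 0)) (HahnSeries.C (MvPolynomial.X 1))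
      (leadU (cusp k l) n) := by
  have hx := L.isNil_single (S.nil _ S.x_mem) Lau.x_mem Lau.coeff_x
    (isWeightedHomogeneous_one ℂ _)
  have hy := L.isNil_single (S.nil _ (S.C_mem (MvPolynomial.X 0)))
    (Lau.single_mem_orderGE 0 _) (HahnSeries.coeff_single_same 0 _)
    (isWeightedHomogeneous_X ℂ (cuspWeight k l) 0)
  have hz := L.isNil_single (S.nil _ (S.C_mem (MvPolynomial.X 1)))
    (Lau.single_mem_orderGE 0 _) (HahnSeries.coeff_single_same 0 _)
    (isWeightedHomogeneous_X ℂ (cuspWeight k l) 1)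
  have hu : ∀ j < m, _ := fun j hj => L.isNil_single (S.nil _ (S.u_mem j hj))
    (S.tower.leading_u j hj).1 (S.tower.leading_u j hj).2
    ((isWeightedHomogeneous_cusp k l).pow (cuspExponent n j))
  have hn : ∀ j, j + 1 < m → n j ≠ 0 := fun j hj => (S.tower.exp_pos hj).ne'
  exact ⟨gradedNil_gradedField S.two_le_k S.two_le_l S.two_le_m hn hx.1 hy.1 hz.1
      (fun j hj => (hu j hj).1) L.ne,
    gradedNil_gradedField S.two_le_k S.two_le_l S.two_le_m hn hx.2 hy.2 hz.2
      (fun j hj => (hu j hj).2) L.coeff_ne⟩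

lemma isNil_C {δ : Derivation ℂ Lau Lau} (hy : IsNil δ (HahnSeries.C (MvPolynomial.X 0)))
    (hz : IsNil δ (HahnSeries.C (MvPolynomial.X 1))) (s : YZ) : IsNil δ (HahnSeries.C s) := by
  rw [← mem_nilSubalgebra]
  induction s using MvPolynomial.induction_on with
  | C s => exact (nilSubalgebra δ).algebraMap_mem s
  | add s t hs ht => rw [map_add]; exact add_mem hs ht
  | mul_X s i hs =>
    rw [map_mul]
    refine mul_mem hs ?_
    fin_cases i
    · exact hy
    · exact hz

/-- The leading part of a constant of the vector field is a product of constants of the leading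
part of the vector field: a weighted homogeneous polynomial in `y` and `z`, and some of `x` and the
leading parts of the `u_j`. -/
lemma exists_factors (S : NilTower k l m n r u X Y Z A)
    (L : IsLeading (cuspWeight k l) X Y Z e d f₀ f₁ f₂) {f : Lau} (hf : f ∈ A)
    (hf0 : Lau.vectorField X Y Z f = 0) {i : ℤ} (hi : f ∈ Lau.orderGE (-i))
    (hfi : f.coeff (-i) ≠ 0) : ∃ (a : ℕ) (b : ℕ → ℕ) (p : YZ) (c : ℤ),
      (monOrder m n b : ℤ) - a = i ∧ f.coeff (-i) = p * cusp k l ^ monExponent m n b ∧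
      p ∈ weightLE (cuspWeight k l) c ∧
      weightedHomogeneousComponent (cuspWeight k l) c p ≠ 0 ∧
      Lau.gradedField e f₀ f₁ f₂
        (HahnSeries.C (weightedHomogeneousComponent (cuspWeight k l) c p)) = 0 ∧
      (a ≠ 0 → Lau.gradedField e f₀ f₁ f₂ Lau.x = 0) ∧
      ∀ j < m, b j ≠ 0 → Lau.gradedField e f₀ f₁ f₂ (leadU (cusp k l) n j) = 0 := by
  obtain ⟨a, b, p, hab, hcoeff⟩ := S.exists_coeff_eq hf hi
  have hp0 : p ≠ 0 := fun h => hfi (by rw [hcoeff, h, zero_mul])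
  obtain ⟨c, hc, hc0⟩ := exists_weightedHomogeneousComponent_ne_zero (w := cuspWeight k l) hp0
  refine ⟨a, b, p, c, hab, hcoeff, hc, hc0, ?_⟩
  set δ := Lau.gradedField e f₀ f₁ f₂ with hδ
  set p' := weightedHomogeneousComponent (cuspWeight k l) c p with hp'
  have G := (S.gradedNil L).1
  have hq := (isWeightedHomogeneous_cusp k l).pow (monExponent m n b)
  have hqm := IsWeightedHomogeneous.mem_weightLE hq
  have h1 := L.iterate hi (by rw [hcoeff]; exact mul_mem_weightLE hc hqm) (N := 1) hf0
  rw [hcoeff, weightedHomogeneousComponent_mul_of_mem hc hqm,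
    hq.weightedHomogeneousComponent_same, ← hp'] at h1
  have h2 : HahnSeries.single (-i) (p' * cusp k l ^ monExponent m n b) =
      HahnSeries.C p' * (Lau.x ^ a * mon (leadU (cusp k l) n) m b) := by
    rw [x_pow_mul_mon_leadU _ n m a b hab, HahnSeries.C_apply, HahnSeries.single_mul_single,
      zero_add]
  have h3 : δ (HahnSeries.C p' * (Lau.x ^ a * mon (leadU (cusp k l) n) m b)) = 0 := h2 ▸ h1
  have hu0 : ∀ j, leadU (cusp k l) n j ≠ 0 := leadU_ne_zero S.tower.ne_zero n
  have hmon0 : mon (leadU (cusp k l) n) m b ≠ 0 :=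
    Finset.prod_ne_zero_iff.mpr fun j _ => pow_ne_zero _ (hu0 j)
  have hxa0 : Lau.x ^ a ≠ 0 := pow_ne_zero _ Lau.x_ne_zero
  have hC0 : (HahnSeries.C p' : Lau) ≠ 0 := C_ne_zero_of_ne hc0
  have nilC := isNil_C G.y_nil G.z_nil
  have nilx : IsNil δ (Lau.x ^ a) :=
    pow_mem (S := nilSubalgebra δ) (mem_nilSubalgebra.mpr G.x_nil) a
  have nilu : ∀ s : Finset ℕ, (∀ j ∈ s, j < m) →
      IsNil δ (∏ j ∈ s, leadU (cusp k l) n j ^ b j) := fun s hs =>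
    prod_mem (S := nilSubalgebra δ) fun j hj => pow_mem (G.u_nil j (hs j hj)) _
  have nilmon : IsNil δ (mon (leadU (cusp k l) n) m b) :=
    nilu _ fun j hj => Finset.mem_range.mp hj
  have hC := (nilC p').apply_eq_zero_of_mul (nilx.mul nilmon) h3
    (mul_ne_zero hC0 (mul_ne_zero hxa0 hmon0))
  have h4 : δ (Lau.x ^ a * mon (leadU (cusp k l) n) m b) = 0 :=
    (nilx.mul nilmon).apply_eq_zero_of_mul (nilC p') (by rw [mul_comm]; exact h3)
      (mul_ne_zero (mul_ne_zero hxa0 hmon0) hC0)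
  have hxa := nilx.apply_eq_zero_of_mul nilmon h4 (mul_ne_zero hxa0 hmon0)
  have hmon := nilmon.apply_eq_zero_of_mul nilx (by rw [mul_comm]; exact h4)
    (mul_ne_zero hmon0 hxa0)
  refine ⟨hC, fun ha => IsNil.apply_eq_zero_of_pow ha hxa, fun j hj hbj => ?_⟩
  apply IsNil.apply_eq_zero_of_pow hbj
  have hsplit : mon (leadU (cusp k l) n) m b = leadU (cusp k l) n j ^ b j *
      ∏ j' ∈ (Finset.range m).erase j, leadU (cusp k l) n j' ^ b j' :=
    (Finset.mul_prod_erase _ _ (Finset.mem_range.mpr hj)).symm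
  rw [hsplit] at hmon hmon0
  refine IsNil.apply_eq_zero_of_mul (pow_mem (S := nilSubalgebra δ) (G.u_nil j hj) _)
    (nilu _ fun j' hj' => ?_) hmon hmon0
  exact Finset.mem_range.mp (Finset.mem_of_mem_erase hj')

/-- If the leading part of the vector field kills the leading part of `u_{m-1}`, then a nonzero
constant of the vector field has a leading coefficient `c (yᵏ - zˡ) ^ N` with `c ∈ ℂ`, `c ≠ 0`, in
some order `≤ 0`. Such a coefficient does not vanish at `(1, 0)`. -/
lemma exists_evalOneZero_ne_zero (S : NilTower k l m n r u X Y Z A)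
    (L : IsLeading (cuspWeight k l) X Y Z e d f₀ f₁ f₂)
    (hu : Lau.gradedField e f₀ f₁ f₂ (leadU (cusp k l) n (m - 1)) = 0) {f : Lau} (hf : f ∈ A)
    (hf0 : Lau.vectorField X Y Z f = 0) (hne : f ≠ 0) :
    ∃ i : ℕ, evalOneZero (f.coeff (-(i : ℤ))) ≠ 0 := by
  have G := (S.gradedNil L).1
  have hm := S.two_le_m
  obtain ⟨i', hi, hfi⟩ := Lau.exists_order hne
  obtain ⟨i, rfl⟩ : ∃ i, i' = -i := ⟨-i', (neg_neg i').symm⟩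
  obtain ⟨a, b, p, c, hab, hcoeff, hc, hc0, hC, hx, -⟩ := S.exists_factors L hf hf0 hi hfi
  have ha : a = 0 := by
    by_contra ha
    exact G.not_u_x (by omega) hu (hx ha)
  set p' := weightedHomogeneousComponent (cuspWeight k l) c p with hp'
  set δ := Lau.gradedField e f₀ f₁ f₂ with hδ
  have hhom : IsWeightedHomogeneous (cuspWeight k l) p' c :=
    weightedHomogeneousComponent_isWeightedHomogeneous c p
  obtain ⟨hy, hz⟩ := G.not_y_or_z hu
  have nilC := isNil_C G.y_nil G.z_nil
  have hfactor : ∀ s : YZ, s ∣ p' → δ (HahnSeries.C s) = 0 ∧ s ≠ 0 := by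
    rintro s ⟨t, ht⟩
    have h0 := hc0
    rw [ht] at h0
    rw [ht, map_mul] at hC
    refine ⟨(nilC s).apply_eq_zero_of_mul (nilC t) hC ?_, left_ne_zero_of_mul h0⟩
    rw [← map_mul]
    exact C_ne_zero_of_ne h0
  have hc1 : c = 0 := by
    by_contra hne
    have hk := S.two_le_k
    have hl := S.two_le_l
    rcases exists_dvd_of_isWeightedHomogeneous (by omega) (by omega) S.coprime hhom hne with
      h | h | ⟨s, h⟩
    · exact hy (hfactor _ h).1
    · exact hz (hfactor _ h).1
    · obtain ⟨h1, h2⟩ := hfactor _ h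
      by_cases hs : s = 0
      · rw [hs, map_zero, zero_mul, sub_zero, map_pow] at h1
        exact hy (IsNil.apply_eq_zero_of_pow (by omega) h1)
      · have h3 : HahnSeries.C (MvPolynomial.X 0 ^ k - C s * MvPolynomial.X 1 ^ l) =
            HahnSeries.C (MvPolynomial.X 0) ^ k - s • (HahnSeries.C (MvPolynomial.X 1) : Lau) ^ l
            := by
          rw [map_sub, map_mul, map_pow, map_pow]
          exact congrArg _ (Algebra.smul_def s _).symm
        rw [h3] at h1
        refine G.not_pow_sub_pow hs ?_ h1
        rw [← h3]
        exact C_ne_zero_of_ne h2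
  subst hc1
  obtain ⟨s, rfl⟩ : ∃ s : ℂ, p = C s := by
    refine ⟨coeff 0 p, ?_⟩
    ext t
    rw [coeff_C]
    split_ifs with h
    · rw [← h]
    · by_contra h0
      have h1 := hc t h0
      rw [weight_cuspWeight] at h1
      have hk : 0 < k := by have := S.two_le_k; omega
      have hl : 0 < l := by have := S.two_le_l; omega
      have h2 : t 0 * l + t 1 * k = 0 := by
        have : (t 0 * l + t 1 * k : ℕ) ≤ 0 := by exact_mod_cast h1
        omega
      apply h
      ext j
      fin_cases j
      · simp only [Nat.add_eq_zero_iff, Nat.mul_eq_zero] at h2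
        exact (h2.1.resolve_right hl.ne').symm
      · simp only [Nat.add_eq_zero_iff, Nat.mul_eq_zero] at h2
        exact (h2.2.resolve_right hk.ne').symm
  refine ⟨i.toNat, ?_⟩
  have hi0 : ((i.toNat : ℕ) : ℤ) = i := by
    rw [ha] at hab
    omega
  rw [hi0, hcoeff, map_mul, map_pow, evalOneZero_cusp (by have := S.two_le_l; omega), one_pow,
    mul_one]
  have hs : s ≠ 0 := fun h => hfi (by rw [hcoeff, h, map_zero, zero_mul])
  simpa [evalOneZero] using hs

/-- On the series of order at least `0` the restriction to `x = 0` is multiplicative. -/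
lemma coeff_zero_aeval {f g : Lau} (hf : f ∈ Lau.orderGE 0) (hg : g ∈ Lau.orderGE 0)
    (P : MvPolynomial (Fin 2) ℂ) : aeval ![f, g] P ∈ Lau.orderGE 0 ∧
      (aeval ![f, g] P).coeff 0 = aeval ![f.coeff 0, g.coeff 0] P := by
  induction P using MvPolynomial.induction_on with
  | C s =>
    rw [algHom_C, algHom_C]
    exact ⟨algebraMap_mem_orderGE s, HahnSeries.coeff_single_same 0 _⟩
  | add P Q hP hQ =>
    rw [map_add, map_add, HahnSeries.coeff_add, hP.2, hQ.2]
    exact ⟨add_mem hP.1 hQ.1, rfl⟩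
  | mul_X P i hP =>
    have key : ∀ b ∈ Lau.orderGE 0, aeval ![f, g] P * b ∈ Lau.orderGE 0 ∧
        (aeval ![f, g] P * b).coeff 0 = aeval ![f.coeff 0, g.coeff 0] P * b.coeff 0 := by
      intro b hb
      rw [← hP.2]
      exact ⟨by simpa using Lau.mul_mem_orderGE hP.1 hb,
        Lau.coeff_mul_of_mem' hP.1 hb (add_zero 0).symm⟩
    rw [map_mul, map_mul, aeval_X, aeval_X]
    fin_cases i
    · exact key f hf
    · exact key g hg

/-- The vector field kills `x`. Otherwise two algebraically independent elements are constants of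
it. If some constant has a pole along `x = 0`, then the constants have too few leading coefficients
for this. If not, then restricting the constants to `x = 0` yields either a constant divisible by
`x`, or two algebraically independent constants of the leading part of the vector field in
`ℂ[y, z]`. -/
theorem apply_x (S : NilTower k l m n r u X Y Z A) : Lau.vectorField X Y Z Lau.x = 0 := by
  by_contra hx
  have hX : X ≠ 0 := fun h => hx (by rw [Lau.vectorField_x, h, zero_mul])
  obtain ⟨e, d, f₀, f₁, f₂, L⟩ := exists_isLeading (cuspWeight k l) Y Z hX
  obtain ⟨G, G'⟩ := S.gradedNil L
  have hmem : ∀ i, coordXYZ i ∈ A := by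
    intro i
    refine Fin.cases S.x_mem (fun j => ?_) i
    rw [coordXYZ, Fin.cons_succ]
    exact S.C_mem _
  obtain ⟨f, g, hf, hg, hfg⟩ := exists_algebraicIndependent_kernel S.stable S.nil
    algebraicIndependent_coordXYZ hmem S.x_mem hx
  let K : Subalgebra ℂ Lau :=
    { carrier := {a | a ∈ A ∧ Lau.vectorField X Y Z a = 0}
      mul_mem' := fun {a b} ha hb => ⟨mul_mem ha.1 hb.1, by
        rw [Derivation.leibniz, ha.2, hb.2, smul_zero, smul_zero, add_zero]⟩
      add_mem' := fun {a b} ha hb => ⟨add_mem ha.1 hb.1, by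
        rw [map_add, ha.2, hb.2, add_zero]⟩
      algebraMap_mem' := fun c => ⟨A.algebraMap_mem c, Derivation.map_algebraMap _ c⟩ }
  by_cases hpole : ∃ h ∈ K, ∃ i : ℤ, 0 < i ∧ h ∈ Lau.orderGE (-i) ∧ h.coeff (-i) ≠ 0
  · -- some constant has a pole along `x = 0`
    obtain ⟨h, hh, i, hi, h1, h2⟩ := hpole
    obtain ⟨a, b, p, c, hab, -, -, -, -, -, hu⟩ := S.exists_factors L hh.1 hh.2 h1 h2
    obtain ⟨j, hj, hbj⟩ : ∃ j < m, b j ≠ 0 := by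
      by_contra hall
      push Not at hall
      have : monOrder m n b = 0 := Finset.sum_eq_zero fun j hj => by
        rw [hall j (Finset.mem_range.mp hj), zero_mul]
      omega
    have huj := hu j hj hbj
    have hjm := G.eq_of_u hj huj
    have hu' : Lau.gradedField e f₀ f₁ f₂ (leadU (cusp k l) n (m - 1)) = 0 := by
      rwa [show m - 1 = j by omega]
    exact not_algebraicIndependent_of_leading (K := K) hf hg
      (fun h hh hne => S.exists_evalOneZero_ne_zero L hu' hh.1 hh.2 hne) hfg
  · -- no constant has a pole along `x = 0`: the constants may be restricted to `x = 0`
    have hord : ∀ h ∈ K, h ∈ Lau.orderGE 0 := by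
      intro h hh
      by_cases h0 : h = 0
      · rw [h0]; exact zero_mem _
      obtain ⟨i, hi, hne⟩ := Lau.exists_order h0
      refine Lau.orderGE_anti ?_ hi
      by_contra hneg
      exact hpole ⟨h, hh, -i, by omega, by rwa [neg_neg], by rwa [neg_neg]⟩
    have hf0 := hord f hf
    have hg0 := hord g hg
    by_cases hind : AlgebraicIndependent ℂ ![f.coeff 0, g.coeff 0]
    · -- the leading part of the vector field kills `y` and `z`
      let δ₀ : Derivation ℂ YZ YZ := Y.coeff e • pderiv 0 + Z.coeff e • pderiv 1
      have hδ₀ : ∀ h ∈ K, δ₀ (h.coeff 0) = 0 := by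
        intro h hh
        have h1 := Lau.coeff_vectorField L.X_mem L.Y_mem L.Z_mem (hord h hh)
        rw [hh.2, HahnSeries.coeff_zero, Lau.gradedAction, Int.cast_zero, zero_smul, mul_zero,
          zero_add] at h1
        exact h1.symm
      have hall := derivation_eq_zero_of_algebraicIndependent hind (hδ₀ f hf) (hδ₀ g hg)
      have hY := hall (MvPolynomial.X 0)
      have hZ := hall (MvPolynomial.X 1)
      simp [δ₀] at hY hZ
      apply G'.not_y_z
      rw [gradedField_y, gradedField_z, hY, hZ]
      simp
    · -- an algebraic relation on `x = 0` yields a constant that is divisible by `x`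
      rw [algebraicIndependent_iff] at hind
      push Not at hind
      obtain ⟨P, hP, hP0⟩ := hind
      have h1 := coeff_zero_aeval hf0 hg0 P
      rw [hP] at h1
      have hne : aeval ![f, g] P ≠ 0 := fun h => hP0 ((algebraicIndependent_iff.mp hfg) P h)
      have hK : aeval ![f, g] P ∈ K := by
        refine aeval_mem_subalgebra K (fun i => ?_) P
        fin_cases i
        · exact hf
        · exact hg
      obtain ⟨h', hh', hxh⟩ := S.exists_eq_x_mul hK.1
        (by simpa using Lau.mem_orderGE_succ h1.1 h1.2)
      rw [hxh] at hne
      have hK2 := hK.2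
      rw [hxh] at hK2
      exact hx ((S.nil _ S.x_mem).apply_eq_zero_of_mul (S.nil _ hh') hK2 hne)

end NilTower

/-! ### Solutions of the system of equations -/

section Solutions

variable {t : ℕ} {c : Fin (t + 1) → ℂ} {B : Fin (t + 1) → Block} {S : Type} [CommRing S]
  [Algebra ℂ S]

/-- `P` is a solution of the system of equations with values in the algebra `S`. -/
def IsSolution (c : Fin (t + 1) → ℂ) (B : Fin (t + 1) → Block) (P : Coord B → S) : Prop :=
  ∀ (s : Fin (t + 1)) (j : ℕ) (hj : j < (B s).len), aeval P (equation c B s j hj) = 0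

lemma aeval_polIn (P : Coord B → S) (s : Fin (t + 1)) (j : ℕ) (hj : j < (B s).len) :
    aeval P (Block.polIn B s j hj) = aeval (Sum.elim ![P Coord.y, P Coord.z]
      fun i : Fin j => P (Coord.u s ⟨i, i.2.trans hj⟩)) ((B s).pol j) := by
  rw [Block.polIn, aeval_rename]
  congr 2
  ext i
  rcases i with i | i
  · fin_cases i <;> rfl
  · rfl

lemma aeval_equation_zero (P : Coord B → S) (s : Fin (t + 1)) (h : 0 < (B s).len) :
    aeval P (equation c B s 0 h) = (P Coord.x - algebraMap ℂ S (c s)) * P (Coord.u s ⟨0, h⟩) -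
      aeval P (Block.polIn B s 0 h) := by
  simp [equation, algHom_C]

lemma aeval_equation_succ (P : Coord B → S) (s : Fin (t + 1)) (j : ℕ) (h : j + 1 < (B s).len) :
    aeval P (equation c B s (j + 1) h) =
      (P Coord.x - algebraMap ℂ S (c s)) * P (Coord.u s ⟨j + 1, h⟩) -
        P (Coord.u s ⟨j, (Nat.lt_succ_self j).trans h⟩) ^ (B s).exp (j + 1) +
      aeval P (Block.polIn B s (j + 1) h) := by
  simp [equation, algHom_C]

/-- The values of the `u_j` that solve a block of equations for given `y`, `z` and a given
inverse `w` of `x - c`. -/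
noncomputable def solveBlock (b : Block) (w y z : S) : ℕ → S
  | 0 => w * aeval (Sum.elim ![y, z] fun i : Fin 0 => i.elim0) (b.pol 0)
  | j + 1 => w * (solveBlock b w y z j ^ b.exp (j + 1) -
      aeval (Sum.elim ![y, z] fun i : Fin (j + 1) => solveBlock b w y z i) (b.pol (j + 1)))
decreasing_by
  · omega
  · exact i.2

/-- The solution of the system for given `x, y, z` and given inverses `w s` of `x - c s`. -/
noncomputable def solve (B : Fin (t + 1) → Block) (w : Fin (t + 1) → S) (x y z : S) : Coord B → S
  | Coord.x => x
  | Coord.y => y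
  | Coord.z => z
  | Coord.u s i => solveBlock (B s) (w s) y z i

lemma isSolution_solve {w : Fin (t + 1) → S} {x : S}
    (hw : ∀ s, (x - algebraMap ℂ S (c s)) * w s = 1) (y z : S) :
    IsSolution c B (solve B w x y z) := by
  intro s j hj
  cases j with
  | zero =>
    rw [aeval_equation_zero, aeval_polIn]
    simp only [solve]
    rw [solveBlock, ← mul_assoc, hw, one_mul, sub_eq_zero]
    congr 2
    ext i
    rcases i with i | i
    · rfl
    · exact i.elim0
  | succ j =>
    rw [aeval_equation_succ, aeval_polIn]
    simp only [solve]
    rw [solveBlock, ← mul_assoc, hw, one_mul]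
    ring

/-- The coordinates `x, y, z` of a point. -/
def xyz (P : Coord B → S) : Fin 3 → S := ![P Coord.x, P Coord.y, P Coord.z]

/-- The polynomial `∏ (x - c s)`. -/
noncomputable def rootPoly (c : Fin (t + 1) → ℂ) : Polynomial ℂ :=
  ∏ s, (Polynomial.X - Polynomial.C (c s))

variable (c B) in
/-- The polynomials that agree on all solutions, up to a power of `∏ (x - c s)`, with a polynomial
in `x, y, z`. -/
def clearable : Subalgebra ℂ (MvPolynomial (Coord B) ℂ) where
  carrier := {f | ∃ (N : ℕ) (h : MvPolynomial (Fin 3) ℂ), ∀ (S : Type) [CommRing S] [Algebra ℂ S]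
    (P : Coord B → S), IsSolution c B P →
      Polynomial.aeval (P Coord.x) (rootPoly c) ^ N * aeval P f = aeval (xyz P) h}
  mul_mem' := by
    rintro f f' ⟨N, h, H⟩ ⟨N', h', H'⟩
    refine ⟨N + N', h * h', fun S _ _ P hP => ?_⟩
    rw [map_mul, map_mul, ← H S P hP, ← H' S P hP]
    ring
  add_mem' := by
    rintro f f' ⟨N, h, H⟩ ⟨N', h', H'⟩
    refine ⟨N + N', Polynomial.aeval (X 0) (rootPoly c) ^ N' * h +
      Polynomial.aeval (X 0) (rootPoly c) ^ N * h', fun S _ _ P hP => ?_⟩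
    have hx : aeval (xyz P) (Polynomial.aeval (X 0 : MvPolynomial (Fin 3) ℂ) (rootPoly c)) =
        Polynomial.aeval (P Coord.x) (rootPoly c) := by
      rw [← Polynomial.aeval_algHom_apply, aeval_X]
      rfl
    rw [map_add, map_add, map_mul, map_mul, map_pow, map_pow, hx, ← H S P hP, ← H' S P hP]
    ring
  algebraMap_mem' := fun a => ⟨0, C a, fun S _ _ P _ => by
    rw [pow_zero, one_mul, algHom_C, MvPolynomial.algebraMap_eq, algHom_C]⟩

/-- A polynomial is clearable if its product with some `x - c s` agrees on all solutions with a
clearable polynomial. -/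
lemma mem_clearable_of_mul_mem {f f' : MvPolynomial (Coord B) ℂ} (s : Fin (t + 1))
    (hf' : f' ∈ clearable c B) (hff' : ∀ (S : Type) [CommRing S] [Algebra ℂ S]
    (P : Coord B → S), IsSolution c B P →
      (P Coord.x - algebraMap ℂ S (c s)) * aeval P f = aeval P f') : f ∈ clearable c B := by
  obtain ⟨N, h, H⟩ := hf'
  set g' : Polynomial ℂ := ∏ s' ∈ Finset.univ.erase s, (Polynomial.X - Polynomial.C (c s'))
  have hg : rootPoly c = (Polynomial.X - Polynomial.C (c s)) * g' :=
    (Finset.mul_prod_erase _ _ (Finset.mem_univ s)).symm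
  refine ⟨N + 1, Polynomial.aeval (X 0) g' * h, fun S _ _ P hP => ?_⟩
  have hx : aeval (xyz P) (Polynomial.aeval (X 0 : MvPolynomial (Fin 3) ℂ) g') =
      Polynomial.aeval (P Coord.x) g' := by
    rw [← Polynomial.aeval_algHom_apply, aeval_X]
    rfl
  rw [map_mul, hx, ← H S P hP, ← hff' S P hP, pow_succ]
  nth_rw 2 [hg]
  rw [map_mul, map_sub, Polynomial.aeval_X, Polynomial.aeval_C]
  ring

lemma polIn_mem (W : Subalgebra ℂ (MvPolynomial (Coord B) ℂ)) (hy : X Coord.y ∈ W)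
    (hz : X Coord.z ∈ W) (s : Fin (t + 1)) (j : ℕ) (hj : j < (B s).len)
    (hu : ∀ i (hi : i < j), X (Coord.u s ⟨i, hi.trans hj⟩) ∈ W) :
    Block.polIn B s j hj ∈ W := by
  have h : Block.polIn B s j hj = aeval (X : Coord B → MvPolynomial (Coord B) ℂ)
    (Block.polIn B s j hj) := by simp
  rw [h, aeval_polIn]
  refine aeval_mem_subalgebra W ?_ _
  rintro (i | i)
  · fin_cases i
    · exact hy
    · exact hz
  · exact hu i i.2

/-- On the solutions all coordinates become polynomials in `x, y, z` after multiplication by a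
power of `∏ (x - c s)`. -/
lemma clearable_eq_top : clearable c B = ⊤ := by
  have hy : X Coord.y ∈ clearable c B := ⟨0, X 1, fun S _ _ P _ => by
    rw [pow_zero, one_mul, aeval_X, aeval_X]; rfl⟩
  have hz : X Coord.z ∈ clearable c B := ⟨0, X 2, fun S _ _ P _ => by
    rw [pow_zero, one_mul, aeval_X, aeval_X]; rfl⟩
  have hu : ∀ s j (hj : j < (B s).len), X (Coord.u s ⟨j, hj⟩) ∈ clearable c B := by
    intro s j
    induction j using Nat.strong_induction_on with
    | _ j ih =>
    intro hj
    have hpol := polIn_mem (clearable c B) hy hz s j hj fun i hi => ih i hi (hi.trans hj)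
    cases j with
    | zero =>
      refine mem_clearable_of_mul_mem s hpol fun S _ _ P hP => ?_
      have h := hP s 0 hj
      rw [aeval_equation_zero] at h
      rw [aeval_X]
      linear_combination h
    | succ j =>
      refine mem_clearable_of_mul_mem s (sub_mem (pow_mem (ih j (Nat.lt_succ_self j)
        ((Nat.lt_succ_self j).trans hj)) ((B s).exp (j + 1))) hpol) fun S _ _ P hP => ?_
      have h := hP s (j + 1) hj
      rw [aeval_equation_succ] at h
      rw [aeval_X, map_sub, map_pow, aeval_X]
      linear_combination h
  rw [eq_top_iff, ← MvPolynomial.adjoin_range_X]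
  refine Algebra.adjoin_le ?_
  rintro _ ⟨i, rfl⟩
  cases i with
  | x => exact ⟨0, X 0, fun S _ _ P _ => by rw [pow_zero, one_mul, aeval_X, aeval_X]; rfl⟩
  | y => exact hy
  | z => exact hz
  | u s i => exact hu s i i.2

variable (c) in
lemma exists_clear (f : MvPolynomial (Coord B) ℂ) : ∃ (N : ℕ) (h : MvPolynomial (Fin 3) ℂ),
    ∀ (S : Type) [CommRing S] [Algebra ℂ S] (P : Coord B → S), IsSolution c B P →
      Polynomial.aeval (P Coord.x) (rootPoly c) ^ N * aeval P f = aeval (xyz P) h := by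
  have h : f ∈ clearable c B := by rw [clearable_eq_top]; trivial
  exact h

end Solutions

/-! ### Expansion of regular functions into Laurent series -/

section Laurent

variable {t : ℕ} (c : Fin (t + 1) → ℂ) (B : Fin (t + 1) → Block)

/-- Each `x - a` is invertible as a Laurent series: for `a ≠ 0` as a power series, and for `a = 0`
with inverse `x⁻¹`. -/
lemma Lau.exists_inv (a : ℂ) : ∃ w : Lau, (Lau.x - algebraMap ℂ Lau a) * w = 1 := by
  by_cases ha : a = 0
  · refine ⟨HahnSeries.single (-1) 1, ?_⟩
    rw [ha, map_zero, sub_zero, Lau.x, HahnSeries.single_mul_single]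
    simp
  · have h : IsUnit (PowerSeries.X - PowerSeries.C (C a : YZ)) := by
      rw [PowerSeries.isUnit_iff_constantCoeff, map_sub, PowerSeries.constantCoeff_X,
        PowerSeries.constantCoeff_C, zero_sub, IsUnit.neg_iff]
      exact (isUnit_iff_ne_zero.mpr ha).map C
    obtain ⟨w, hw⟩ := isUnit_iff_exists_inv.mp h
    refine ⟨HahnSeries.ofPowerSeries ℤ YZ w, ?_⟩
    have := congrArg (HahnSeries.ofPowerSeries ℤ YZ) hw
    rw [map_mul, map_sub, HahnSeries.ofPowerSeries_X, HahnSeries.ofPowerSeries_C,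
      RingHom.map_one] at this
    exact this

/-- The generic point of the variety: the coordinates as Laurent series in `x`. -/
noncomputable def lauPoint : Coord B → Lau :=
  solve B (fun s => (Lau.exists_inv (c s)).choose) Lau.x (HahnSeries.C (X 0)) (HahnSeries.C (X 1))

lemma isSolution_lauPoint : IsSolution c B (lauPoint c B) :=
  isSolution_solve (fun s => (Lau.exists_inv (c s)).choose_spec) _ _

lemma xyz_lauPoint : xyz (lauPoint c B) = coordXYZ := by
  ext1 i
  fin_cases i <;> rfl

lemma aeval_x_rootPoly_ne_zero : Polynomial.aeval Lau.x (rootPoly c) ≠ 0 := by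
  rw [rootPoly, map_prod]
  refine Finset.prod_ne_zero_iff.mpr fun s _ h => ?_
  obtain ⟨w, hw⟩ := Lau.exists_inv (c s)
  rw [map_sub, Polynomial.aeval_X, Polynomial.aeval_C] at h
  rw [h, zero_mul] at hw
  exact zero_ne_one hw

variable {c B} in
/-- A polynomial that vanishes on the variety vanishes at the generic point. -/
lemma aeval_lauPoint_eq_zero {f : MvPolynomial (Coord B) ℂ}
    (hf : f ∈ vanishingIdeal ℂ (solutionSet c B)) : aeval (lauPoint c B) f = 0 := by
  obtain ⟨N, h, H⟩ := exists_clear c f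
  have hg : Polynomial.aeval (X 0 : MvPolynomial (Fin 3) ℂ) (rootPoly c) ≠ 0 := by
    intro h0
    have := congrArg (aeval coordXYZ) h0
    rw [← Polynomial.aeval_algHom_apply, aeval_X, map_zero] at this
    exact aeval_x_rootPoly_ne_zero c this
  have h0 : h = 0 := by
    refine (mul_eq_zero.mp (MvPolynomial.funext (p := Polynomial.aeval (X 0) (rootPoly c) * h)
      (q := 0) fun v => ?_)).resolve_left hg
    rw [map_zero, map_mul]
    by_cases hv : eval v (Polynomial.aeval (X 0 : MvPolynomial (Fin 3) ℂ) (rootPoly c)) = 0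
    · rw [hv, zero_mul]
    · have hv' : Polynomial.aeval (v 0) (rootPoly c) ≠ 0 := by
        rw [← aeval_eq_eval, ← Polynomial.aeval_algHom_apply, aeval_X] at hv
        exact hv
      have hw : ∀ s, (v 0 - algebraMap ℂ ℂ (c s)) * (v 0 - c s)⁻¹ = 1 := by
        intro s
        refine mul_inv_cancel₀ fun h1 => hv' ?_
        rw [rootPoly, map_prod]
        refine Finset.prod_eq_zero (Finset.mem_univ s) ?_
        rw [map_sub, Polynomial.aeval_X, Polynomial.aeval_C]
        exact h1
      have hP := isSolution_solve (B := B) hw (v 1) (v 2)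
      have h2 := H ℂ _ hP
      rw [hf _ hP, mul_zero] at h2
      have h3 : xyz (solve B (fun s => (v 0 - c s)⁻¹) (v 0) (v 1) (v 2)) = v := by
        ext i
        fin_cases i <;> rfl
      rw [h3, aeval_eq_eval] at h2
      rw [← h2, mul_zero]
  have h1 := H Lau _ (isSolution_lauPoint c B)
  rw [h0, map_zero] at h1
  exact (mul_eq_zero.mp h1).resolve_left (pow_ne_zero _ (aeval_x_rootPoly_ne_zero c))

/-- The expansion of regular functions into Laurent series in `x`. -/
noncomputable def expand : RegularFunctions (solutionSet c B) →ₐ[ℂ] Lau :=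
  Ideal.Quotient.liftₐ _ (aeval (lauPoint c B)) fun _ => aeval_lauPoint_eq_zero

lemma expand_mk (f : MvPolynomial (Coord B) ℂ) :
    expand c B (Ideal.Quotient.mk _ f) = aeval (lauPoint c B) f := rfl

lemma expand_coordFun (i : Coord B) : expand c B (coordFun _ i) = lauPoint c B i := by
  rw [coordFun, expand_mk, aeval_X]

lemma aeval_coordFun (f : MvPolynomial (Coord B) ℂ) :
    aeval (coordFun (solutionSet c B)) f = Ideal.Quotient.mk _ f := by
  have h : aeval (coordFun (solutionSet c B)) =
      Ideal.Quotient.mkₐ ℂ (vanishingIdeal ℂ (solutionSet c B)) := by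
    apply MvPolynomial.algHom_ext
    intro i
    rw [aeval_X]
    rfl
  rw [h]
  rfl

lemma isSolution_coordFun : IsSolution c B (coordFun (solutionSet c B)) := by
  intro s j hj
  rw [aeval_coordFun, Ideal.Quotient.eq_zero_iff_mem]
  exact fun p hp => hp s j hj

variable {c B}

lemma exists_clear_regular (a : RegularFunctions (solutionSet c B)) :
    ∃ (N : ℕ) (h : MvPolynomial (Fin 3) ℂ),
      Polynomial.aeval (coordFun (solutionSet c B) Coord.x) (rootPoly c) ^ N * a =
        aeval (xyz (coordFun (solutionSet c B))) h := by
  obtain ⟨f, rfl⟩ := Ideal.Quotient.mk_surjective a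
  obtain ⟨N, h, H⟩ := exists_clear c f
  refine ⟨N, h, ?_⟩
  rw [← H _ _ (isSolution_coordFun c B), aeval_coordFun]

lemma expand_aeval_xyz (h : MvPolynomial (Fin 3) ℂ) :
    expand c B (aeval (xyz (coordFun (solutionSet c B))) h) = aeval coordXYZ h := by
  rw [← AlgHom.comp_apply, comp_aeval, ← xyz_lauPoint c B]
  congr 2
  ext1 i
  fin_cases i <;> exact expand_coordFun c B _

/-- The regular functions form a reduced ring. -/
lemma eq_zero_of_pow_eq_zero {σ : Type*} {V : Set (σ → ℂ)} {a : RegularFunctions V} {N : ℕ}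
    (h : a ^ N = 0) : a = 0 := by
  obtain ⟨f, rfl⟩ := Ideal.Quotient.mk_surjective a
  rw [← map_pow, Ideal.Quotient.eq_zero_iff_mem] at h
  rw [Ideal.Quotient.eq_zero_iff_mem]
  intro p hp
  have := h p hp
  rw [map_pow] at this
  exact IsReduced.eq_zero _ ⟨N, this⟩

/-- A regular function with vanishing expansion is supported on the fibres `x = c s`. -/
lemma rootPoly_mul_eq_zero {a : RegularFunctions (solutionSet c B)} (ha : expand c B a = 0) :
    Polynomial.aeval (coordFun (solutionSet c B) Coord.x) (rootPoly c) * a = 0 := by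
  obtain ⟨N, h, H⟩ := exists_clear_regular a
  have h1 := congrArg (expand c B) H
  rw [map_mul, ha, mul_zero, expand_aeval_xyz] at h1
  have h0 : h = 0 := algebraicIndependent_iff.mp algebraicIndependent_coordXYZ h h1.symm
  rw [h0, map_zero] at H
  refine eq_zero_of_pow_eq_zero (N := N + 1) ?_
  rw [mul_pow, pow_succ, pow_succ]
  linear_combination
    (a ^ N * Polynomial.aeval (coordFun (solutionSet c B) Coord.x) (rootPoly c)) * H

end Laurent

/-! ### Derivations of the regular functions as vector fields -/

section Transfer

variable {t : ℕ} {c : Fin (t + 1) → ℂ} {B : Fin (t + 1) → Block}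
  (D : Derivation ℂ (RegularFunctions (solutionSet c B)) (RegularFunctions (solutionSet c B)))

/-- The vector field on Laurent series that extends a derivation of the regular functions. -/
noncomputable def expandField : Derivation ℂ Lau Lau :=
  Lau.vectorField (expand c B (D (coordFun _ Coord.x)) * HahnSeries.single (-1) 1)
    (expand c B (D (coordFun _ Coord.y))) (expand c B (D (coordFun _ Coord.z)))

lemma expandField_x : expandField D Lau.x = expand c B (D (coordFun _ Coord.x)) := by
  rw [expandField, Lau.vectorField_x, mul_assoc, Lau.x, HahnSeries.single_mul_single]
  simp

/-- The expansion into Laurent series turns a derivation of the regular functions into its vector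
field: both sides agree on `x, y, z`, and these determine all regular functions up to factors
`∏ (x - c s)`. -/
lemma expand_apply (a : RegularFunctions (solutionSet c B)) :
    expand c B (D a) = expandField D (expand c B a) := by
  let E : Subalgebra ℂ (RegularFunctions (solutionSet c B)) :=
    { carrier := {a | expand c B (D a) = expandField D (expand c B a)}
      mul_mem' := fun {a b} ha hb => by
        change _ = _ at ha hb
        change expand c B (D (a * b)) = _
        simp only [D.leibniz, smul_eq_mul, map_add, map_mul, ha, hb,
          (expandField D).leibniz]
      add_mem' := fun {a b} ha hb => by
        change _ = _ at ha hb
        change expand c B (D (a + b)) = _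
        simp only [map_add, ha, hb]
      algebraMap_mem' := fun r => by
        change expand c B (D (algebraMap ℂ _ r)) = _
        rw [D.map_algebraMap, map_zero, AlgHom.commutes, (expandField D).map_algebraMap] }
  have hx : coordFun _ Coord.x ∈ E := by
    change _ = _
    rw [expand_coordFun]
    exact (expandField_x D).symm
  have hy : coordFun _ Coord.y ∈ E := by
    change _ = _
    rw [expand_coordFun]
    exact (Lau.vectorField_y _ _ _).symm
  have hz : coordFun _ Coord.z ∈ E := by
    change _ = _
    rw [expand_coordFun]
    exact (Lau.vectorField_z _ _ _).symm
  obtain ⟨N, h, H⟩ := exists_clear_regular a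
  have hE : aeval (xyz (coordFun (solutionSet c B))) h ∈ E := by
    refine aeval_mem_subalgebra E (fun i => ?_) h
    fin_cases i
    · exact hx
    · exact hy
    · exact hz
  set b := Polynomial.aeval (coordFun (solutionSet c B) Coord.x) (rootPoly c) ^ N with hb
  have hbE : b ∈ E := by
    refine pow_mem (Algebra.adjoin_le (Set.singleton_subset_iff.mpr hx)
      (Polynomial.aeval_mem_adjoin_singleton ℂ _)) N
  have hb0 : expand c B b ≠ 0 := by
    rw [hb, map_pow, ← Polynomial.aeval_algHom_apply, expand_coordFun]
    exact pow_ne_zero _ (aeval_x_rootPoly_ne_zero c)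
  rw [← H] at hE
  change expand c B (D (b * a)) = _ at hE
  change expand c B (D b) = _ at hbE
  rw [D.leibniz, map_mul, (expandField D).leibniz, map_add, smul_eq_mul, smul_eq_mul, smul_eq_mul,
    smul_eq_mul, map_mul, map_mul, hbE] at hE
  exact mul_left_cancel₀ hb0 (add_right_cancel hE)

lemma expand_iterate (N : ℕ) (a : RegularFunctions (solutionSet c B)) :
    expand c B ((⇑D)^[N] a) = (⇑(expandField D))^[N] (expand c B a) := by
  induction N with
  | zero => rfl
  | succ N ih => rw [Function.iterate_succ_apply', expand_apply, ih, Function.iterate_succ_apply']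

/-- If a derivation kills `x` in the Laurent series, it kills `x`. This uses that the `c s` are
distinct: the ring of regular functions need not be a domain, but it is reduced. -/
lemma apply_x_eq_zero (hc : Function.Injective c)
    (h : expand c B (D (coordFun _ Coord.x)) = 0) :
    D (coordFun (solutionSet c B) Coord.x) = 0 := by
  set ξ := coordFun (solutionSet c B) Coord.x
  set w := D ξ
  have h1 : Polynomial.aeval ξ (rootPoly c) * w = 0 := rootPoly_mul_eq_zero h
  have h2 := congrArg D h1
  rw [D.leibniz, map_zero, D.map_aeval, smul_eq_mul, smul_eq_mul, smul_eq_mul] at h2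
  obtain ⟨p, q, hpq⟩ : (rootPoly c).Separable := Polynomial.separable_prod_X_sub_C_iff.mpr hc
  have h3 := congrArg (Polynomial.aeval ξ) hpq
  rw [map_add, map_mul, map_mul, map_one] at h3
  refine eq_zero_of_pow_eq_zero (N := 3) ?_
  linear_combination (-w ^ 3) * h3 + (Polynomial.aeval ξ p * w ^ 2) * h1 +
    Polynomial.aeval ξ q * (w * h2 - D w * h1)

end Transfer

/-! ### The function `x` is killed by locally nilpotent derivations -/

section Generic

variable {t : ℕ} {c : Fin (t + 1) → ℂ} {B : Fin (t + 1) → Block}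

/-- The elements that become polynomials in `x, y, z` and the `u_j` after multiplication by a
polynomial in `x` without zero at `0`. -/
def localTower (m : ℕ) (n : ℕ → ℕ) (u : ℕ → Lau) : Subalgebra ℂ Lau where
  carrier := {a | ∃ G : Polynomial ℂ, G.eval 0 ≠ 0 ∧
    ∃ i, Polynomial.aeval Lau.x G * a ∈ towerFiltration m n u i}
  mul_mem' := by
    rintro a b ⟨G, hG, i, hi⟩ ⟨G', hG', i', hi'⟩
    refine ⟨G * G', by rw [Polynomial.eval_mul]; exact mul_ne_zero hG hG', i + i', ?_⟩
    have := mul_mem_towerFiltration hi hi'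
    rwa [mul_mul_mul_comm, ← map_mul] at this
  add_mem' := by
    have key : ∀ (G : Polynomial ℂ) {a : Lau} {i j : ℤ}, i ≤ j → a ∈ towerFiltration m n u i →
        Polynomial.aeval Lau.x G * a ∈ towerFiltration m n u j := by
      intro G a i j hij ha
      refine towerFiltration_mono hij ?_
      induction G using Polynomial.induction_on' with
      | add p q hp hq => rw [map_add, add_mul]; exact add_mem hp hq
      | monomial e s =>
        rw [Polynomial.aeval_monomial, mul_assoc]
        have h1 := mul_mem_towerFiltration (x_pow_mem_towerFiltration (m := m) (n := n) (u := u) e)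
          ha
        have h2 : algebraMap ℂ Lau s = HahnSeries.C (C s) := rfl
        rw [h2, C_smul_eq]
        exact Submodule.smul_mem _ _ (towerFiltration_mono (by omega) h1)
    rintro a b ⟨G, hG, i, hi⟩ ⟨G', hG', i', hi'⟩
    refine ⟨G * G', by rw [Polynomial.eval_mul]; exact mul_ne_zero hG hG', max i i', ?_⟩
    have h : Polynomial.aeval Lau.x (G * G') * (a + b) =
        Polynomial.aeval Lau.x G' * (Polynomial.aeval Lau.x G * a) +
          Polynomial.aeval Lau.x G * (Polynomial.aeval Lau.x G' * b) := by
      rw [map_mul]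
      ring
    rw [h]
    exact add_mem (key _ (le_max_left _ _) hi) (key _ (le_max_right _ _) hi')
  algebraMap_mem' := fun s => ⟨1, by simp, 0, by
    rw [map_one, one_mul]
    have h1 := x_pow_mem_towerFiltration (m := m) (n := n) (u := u) 0
    have h2 : algebraMap ℂ Lau s = HahnSeries.C (C s) * Lau.x ^ 0 := by
      rw [pow_zero, mul_one]
      rfl
    rw [h2, C_smul_eq]
    exact Submodule.smul_mem _ _ (by simpa using h1)⟩

lemma mem_localTower_of_mem {m : ℕ} {n : ℕ → ℕ} {u : ℕ → Lau} {a : Lau} {i : ℤ}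
    (h : a ∈ towerFiltration m n u i) : a ∈ localTower m n u :=
  ⟨1, by simp, i, by rwa [map_one, one_mul]⟩

lemma C_mem_localTower (m : ℕ) (n : ℕ → ℕ) (u : ℕ → Lau) (p : YZ) :
    HahnSeries.C p ∈ localTower m n u := by
  have h1 := x_pow_mem_towerFiltration (m := m) (n := n) (u := u) 0
  have h2 := Submodule.smul_mem _ p h1
  rw [← C_smul_eq, pow_zero, mul_one] at h2
  exact mem_localTower_of_mem h2

lemma mem_localTower_of_mul_mem {m : ℕ} {n : ℕ → ℕ} {u : ℕ → Lau} {a : Lau} {s : ℂ} (hs : s ≠ 0)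
    (h : (Lau.x - algebraMap ℂ Lau s) * a ∈ localTower m n u) : a ∈ localTower m n u := by
  obtain ⟨G, hG, i, hi⟩ := h
  refine ⟨G * (Polynomial.X - Polynomial.C s), ?_, i, ?_⟩
  · rw [Polynomial.eval_mul]
    refine mul_ne_zero hG ?_
    simpa using hs
  · rw [map_mul, map_sub, Polynomial.aeval_X, Polynomial.aeval_C, mul_assoc]
    exact hi

variable (c B) in
/-- The Laurent series `u_j` of the block of equations of the root `0`. -/
noncomputable def lauTower : ℕ → Lau :=
  solveBlock (B 0) (Lau.exists_inv (c 0)).choose (HahnSeries.C (X 0)) (HahnSeries.C (X 1))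

/-- The coordinates of the blocks of the nonzero roots `c s` need only denominators `x - c s`, which
do not vanish at `x = 0`. -/
lemma lauPoint_mem_localTower (hc : Function.Injective c) (hc0 : c 0 = 0) (i : Coord B) :
    lauPoint c B i ∈ localTower (B 0).len (fun j => (B 0).exp (j + 1)) (lauTower c B) := by
  set W := localTower (B 0).len (fun j => (B 0).exp (j + 1)) (lauTower c B) with hW
  have hy : lauPoint c B Coord.y ∈ W := C_mem_localTower _ _ _ (X 0)
  have hz : lauPoint c B Coord.z ∈ W := C_mem_localTower _ _ _ (X 1)
  have hsol := isSolution_lauPoint c B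
  cases i with
  | x =>
    have := x_pow_mem_towerFiltration (m := (B 0).len) (n := fun j => (B 0).exp (j + 1))
      (u := lauTower c B) 1
    rw [pow_one] at this
    exact mem_localTower_of_mem this
  | y => exact hy
  | z => exact hz
  | u s i =>
    by_cases hs : s = 0
    · subst hs
      have h := mon_mem_towerFiltration (u := lauTower c B) (e := Pi.single (i : ℕ) 1)
        (m := (B 0).len) (n := fun j => (B 0).exp (j + 1)) le_rfl
      rw [mon_single _ i.2, pow_one] at h
      exact mem_localTower_of_mem h
    · have hcs : c s ≠ 0 := fun h => hs (hc (h.trans hc0.symm))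
      obtain ⟨j, hj⟩ := i
      induction j using Nat.strong_induction_on with
      | _ j ih =>
      have hpol : aeval (lauPoint c B) (Block.polIn B s j hj) ∈ W := by
        rw [aeval_polIn]
        refine aeval_mem_subalgebra W ?_ _
        rintro (i | i)
        · fin_cases i
          · exact hy
          · exact hz
        · exact ih i i.2 _
      apply mem_localTower_of_mul_mem hcs
      have h := hsol s j hj
      cases j with
      | zero =>
        rw [aeval_equation_zero, sub_eq_zero] at h
        rw [← h] at hpol
        exact hpol
      | succ j =>
        rw [aeval_equation_succ] at h
        have h1 : (lauPoint c B Coord.x - algebraMap ℂ Lau (c s)) *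
            lauPoint c B (Coord.u s ⟨j + 1, hj⟩) =
            lauPoint c B (Coord.u s ⟨j, (Nat.lt_succ_self j).trans hj⟩) ^ (B s).exp (j + 1) -
              aeval (lauPoint c B) (Block.polIn B s (j + 1) hj) := by
          linear_combination h
        have h2 := sub_mem (pow_mem (ih j (Nat.lt_succ_self j)
          ((Nat.lt_succ_self j).trans hj)) ((B s).exp (j + 1))) hpol
        rw [← h1] at h2
        exact h2

lemma x_mul_choose {s : Fin (t + 1)} (hs : c s = 0) :
    Lau.x * (Lau.exists_inv (c s)).choose = 1 := by
  have h : algebraMap ℂ Lau (c s) = 0 := by rw [hs, map_zero]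
  have hw := (Lau.exists_inv (c s)).choose_spec
  generalize (Lau.exists_inv (c s)).choose = w at hw ⊢
  rwa [h, sub_zero] at hw

lemma tower_lauTower (hc0 : c 0 = 0) {k l : ℕ} (hl : 2 ≤ l)
    (hq0 : (B 0).pol 0 = X (Sum.inl 0) ^ k - X (Sum.inl 1) ^ l) (hm : 2 ≤ (B 0).len) :
    Tower (cusp k l) (B 0).len (fun j => (B 0).exp (j + 1)) (B 0).pol (lauTower c B) where
  pos := by omega
  ne_zero := cusp_ne_zero (by omega)
  degree_lt := (B 0).degree_lt
  rel_zero := by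
    rw [lauTower, solveBlock, ← mul_assoc, x_mul_choose hc0, one_mul, hq0, cusp]
    simp
  rel_succ := fun j _ => by
    rw [lauTower, solveBlock, ← mul_assoc, x_mul_choose hc0, one_mul]
    rfl

/-- A locally nilpotent derivation of the regular functions kills `x`. -/
theorem derivation_x_eq_zero (hc : Function.Injective c) (hc0 : c 0 = 0)
    {k l : ℕ} (hcop : Nat.Coprime k l) (hk : 2 ≤ k) (hl : 2 ≤ l)
    (hq0 : (B 0).pol 0 = X (Sum.inl 0) ^ k - X (Sum.inl 1) ^ l) (hm : 2 ≤ (B 0).len)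
    (D : Derivation ℂ (RegularFunctions (solutionSet c B)) (RegularFunctions (solutionSet c B)))
    (hD : IsLocallyNilpotent D) : D (coordFun (solutionSet c B) Coord.x) = 0 := by
  apply apply_x_eq_zero D hc
  have key : NilTower k l (B 0).len (fun j => (B 0).exp (j + 1)) (B 0).pol (lauTower c B) _ _ _
      (expand c B).range :=
    { coprime := hcop
      two_le_k := hk
      two_le_l := hl
      two_le_m := hm
      tower := tower_lauTower hc0 hl hq0 hm
      x_mem := ⟨coordFun _ Coord.x, expand_coordFun c B _⟩
      C_mem := fun p => by
        have h : (HahnSeries.C p : Lau) =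
            aeval ![lauPoint c B Coord.y, lauPoint c B Coord.z] p := by
          induction p using MvPolynomial.induction_on with
          | C s => rw [algHom_C]; rfl
          | add p q hp hq => rw [map_add, map_add, hp, hq]
          | mul_X p i hp =>
            rw [map_mul, map_mul, hp, aeval_X]
            fin_cases i <;> rfl
        rw [h]
        refine aeval_mem_subalgebra _ (fun i => ?_) p
        fin_cases i
        · exact ⟨coordFun _ Coord.y, expand_coordFun c B _⟩
        · exact ⟨coordFun _ Coord.z, expand_coordFun c B _⟩
      u_mem := fun j hj => ⟨coordFun _ (Coord.u 0 ⟨j, hj⟩), expand_coordFun c B _⟩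
      stable := by
        rintro _ ⟨a, rfl⟩
        exact ⟨D a, expand_apply D a⟩
      nil := by
        rintro _ ⟨a, rfl⟩
        obtain ⟨N, hN⟩ := hD a
        refine ⟨N, (expand_iterate D N a).symm.trans ?_⟩
        rw [hN, map_zero]
      exists_mul_mem := by
        rintro _ ⟨a, rfl⟩
        obtain ⟨f, rfl⟩ := Ideal.Quotient.mk_surjective a
        exact aeval_mem_subalgebra _ (lauPoint_mem_localTower hc hc0) f }
  rw [← expandField_x]
  exact key.apply_x

/-- The regular function `x` is not constant. -/
lemma coordFun_x_ne_algebraMap (s : ℂ) :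
    coordFun (solutionSet c B) Coord.x ≠ algebraMap ℂ _ s := by
  intro h
  have h1 := congrArg (expand c B) h
  rw [expand_coordFun, AlgHom.commutes] at h1
  have h2 := congrArg (fun a : Lau => a.coeff 1) h1
  have h3 : (algebraMap ℂ Lau s).coeff 1 = 0 := HahnSeries.coeff_single_of_ne one_ne_zero
  have h4 : (lauPoint c B Coord.x).coeff 1 = 1 := Lau.coeff_x
  simp only [h3, h4] at h2
  exact one_ne_zero h2

end Generic

/-! ### Varieties isomorphic to an affine space -/

section AffineSpace

variable {σ : Type*}

/-- The partial derivatives of a polynomial ring are locally nilpotent. -/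
lemma isNil_pderiv (i : σ) (p : MvPolynomial σ ℂ) : IsNil (pderiv i) p := by
  classical
  rw [← mem_nilSubalgebra]
  have h := aeval_mem_subalgebra (nilSubalgebra (pderiv (R := ℂ) i)) (v := X)
    (fun j => (⟨2, by
      rw [Function.iterate_succ_apply, Function.iterate_one, pderiv_X, Pi.single_apply]
      split_ifs <;> simp⟩ : IsNil (pderiv i) (X j))) p
  rwa [aeval_X_left_apply] at h

lemma eq_C_of_pderiv_eq_zero {p : MvPolynomial σ ℂ} (h : ∀ i, pderiv i p = 0) :
    p = C (coeff 0 p) := by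
  classical
  ext m
  rw [coeff_C]
  split_ifs with hm
  · rw [← hm]
  · obtain ⟨i, hi⟩ : ∃ i, m i ≠ 0 := by
      by_contra! hall
      exact hm (Finsupp.ext hall).symm
    have h1 := coeff_pderiv (i := i) p (m - Finsupp.single i 1)
    have h2 : m - Finsupp.single i 1 + Finsupp.single i 1 = m :=
      tsub_add_cancel_of_le (Finsupp.single_le_iff.mpr (Nat.one_le_iff_ne_zero.mpr hi))
    rw [h i, coeff_zero, h2] at h1
    refine (mul_eq_zero.mp h1.symm).resolve_right ?_
    exact Nat.cast_add_one_ne_zero _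

/-- On a variety isomorphic to an affine space, the functions killed by all locally nilpotent
derivations are constant. -/
lemma eq_algebraMap_of_isIsomorphic {τ : Type*} {V : Set (σ → ℂ)}
    (h : IsIsomorphic V (Set.univ : Set (τ → ℂ))) {a : RegularFunctions V}
    (ha : ∀ D : Derivation ℂ (RegularFunctions V) (RegularFunctions V),
      IsLocallyNilpotent D → D a = 0) : ∃ s : ℂ, a = algebraMap ℂ _ s := by
  obtain ⟨F, G, -, hG, hGF, hFG⟩ := h
  have hev : ∀ (v : τ → ℂ) (f : MvPolynomial σ ℂ), eval v (aeval G f) = eval (polyMap G v) f := by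
    intro v f
    rw [← aeval_eq_eval, ← AlgHom.comp_apply, comp_aeval]
    rfl
  have hev' : ∀ (p : σ → ℂ) (f : MvPolynomial τ ℂ), eval p (aeval F f) = eval (polyMap F p) f := by
    intro p f
    rw [← aeval_eq_eval, ← AlgHom.comp_apply, comp_aeval]
    rfl
  let ψ : RegularFunctions V →ₐ[ℂ] MvPolynomial τ ℂ :=
    Ideal.Quotient.liftₐ _ (aeval G) fun f hf => MvPolynomial.funext fun v => by
      rw [map_zero]
      exact (hev v f).trans (hf _ (hG (Set.mem_univ v)))
  let χ : MvPolynomial τ ℂ →ₐ[ℂ] RegularFunctions V :=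
    (Ideal.Quotient.mkₐ ℂ (vanishingIdeal ℂ V)).comp (aeval F)
  have hχψ : ∀ b, χ (ψ b) = b := by
    intro b
    obtain ⟨f, rfl⟩ := Ideal.Quotient.mk_surjective b
    refine Ideal.Quotient.eq.mpr fun p hp => ?_
    change eval p (aeval F (aeval G f) - f) = 0
    rw [map_sub, hev', hev, hGF hp, sub_self]
  have hψχ : ∀ b, ψ (χ b) = b := by
    intro b
    refine MvPolynomial.funext fun v => ?_
    change eval v (aeval G (aeval F b)) = _
    rw [hev, hev', hFG (Set.mem_univ v)]
  have hψa : ∀ i, pderiv i (ψ a) = 0 := by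
    intro i
    let D : Derivation ℂ (RegularFunctions V) (RegularFunctions V) :=
      Derivation.mk' (χ.toLinearMap ∘ₗ (pderiv i).toLinearMap ∘ₗ ψ.toLinearMap) fun b b' => by
        change χ (pderiv i (ψ (b * b'))) = b * χ (pderiv i (ψ b')) + b' * χ (pderiv i (ψ b))
        rw [map_mul, (pderiv i).leibniz, smul_eq_mul, smul_eq_mul, map_add, map_mul, map_mul,
          hχψ, hχψ]
    have hDapp : ∀ b, D b = χ (pderiv i (ψ b)) := fun b => rfl
    have hit : ∀ N b, ψ ((⇑D)^[N] b) = (⇑(pderiv i))^[N] (ψ b) := by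
      intro N b
      induction N with
      | zero => rfl
      | succ N ih =>
        rw [Function.iterate_succ_apply', hDapp, hψχ, ih, Function.iterate_succ_apply']
    have h1 := ha D fun b => by
      obtain ⟨N, hN⟩ := isNil_pderiv i (ψ b)
      refine ⟨N, ?_⟩
      rw [← hχψ ((⇑D)^[N] b), hit, hN, map_zero]
    rw [← hψχ (pderiv i (ψ a)), ← hDapp, h1, map_zero]
  refine ⟨coeff 0 (ψ a), ?_⟩
  rw [← hχψ a, eq_C_of_pderiv_eq_zero hψa, ← MvPolynomial.algebraMap_eq, AlgHom.commutes]
  simp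

end AffineSpace

end ExoticAffine

theorem proposition5p5 {t : ℕ} (c : Fin (t + 1) → ℂ) (B : Fin (t + 1) → Block)
    (hc : Function.Injective c) (hc0 : c 0 = 0)
    (k l : ℕ) (hcop : Nat.Coprime k l) (hlk : l < k) (hl : 2 ≤ l)
    (hq0 : (B 0).pol 0 = MvPolynomial.X (Sum.inl 0) ^ k - MvPolynomial.X (Sum.inl 1) ^ l)
    (hm : 2 ≤ (B 0).len)
    (hsmooth : Algebra.Smooth ℂ (RegularFunctions (solutionSet c B))) :
    (∀ D : Derivation ℂ (RegularFunctions (solutionSet c B))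
        (RegularFunctions (solutionSet c B)),
      IsLocallyNilpotent D → D (coordFun (solutionSet c B) Coord.x) = 0) ∧
    makarLimanov (RegularFunctions (solutionSet c B)) ≠ ⊥ ∧
    ¬ IsIsomorphic (solutionSet c B) (Set.univ : Set (Fin 3 → ℂ)) := by
  have hx := derivation_x_eq_zero hc hc0 hcop (hl.trans hlk.le) hl hq0 hm
  refine ⟨hx, fun h => ?_, fun h => ?_⟩
  · have h1 : coordFun (solutionSet c B) Coord.x ∈
        makarLimanov (RegularFunctions (solutionSet c B)) := hx
    rw [h, Algebra.mem_bot] at h1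
    obtain ⟨s, hs⟩ := h1
    exact coordFun_x_ne_algebraMap s hs.symm
  · obtain ⟨s, hs⟩ := eq_algebraMap_of_isIsomorphic h hx
    exact coordFun_x_ne_algebraMap s hs
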